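/- Let $R\subset\mathbb R^N\setminus\{0\}$ be a root system, i.e. a finite set with $R\cap\mathbb R\alpha=\{\pm\alpha\}$ and $\sigma_\alpha R=R$ for all $\alpha\in R$, where $\sigma_\alpha$ is the reflection in the hyperplane orthogonal to $\alpha$; assume $|\alpha|=\sqrt2$ for all $\alpha\in R$. Let $W$ be the group generated by the $\sigma_\alpha$, let $R_+=\{\alpha\in R:\langle\alpha,\beta\rangle>0\}$ for some fixed $\beta\in\mathbb R^N$ orthogonal to no root, and let $k:R\to[0,\infty)$ be $W$-invariant. Put $$T_if(x)=\partial_if(x)+\sum_{\alpha\in R_+}k(\alpha)\,\alpha_i\,\frac{f(x)-f(\sigma_\alpha x)}{\langle\alpha,x\rangle}\qquad(i=1,\dots,N),$$ where the quotient is extended continuously to $\langle\alpha,x\rangle=0$. Let $\mathcal P=\mathbb C[\mathbb R^N]$, let $\mathcal P_n\subset\mathcal P$ be the space of homogeneous polynomials of degree $n$, and let $V:\mathcal P\to\mathcal P$ be the intertwining operator, i.e. the unique linear operator with $V(\mathcal P_n)=\mathcal P_n$ for all $n$, $V|_{\mathcal P_0}=\mathrm{id}$ and $T_iV=V\partial_i$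 for all $i$. The Dunkl kernel is $$K(z,w)=\sum_{n\ge0}V\Bigl(\frac{\langle\cdot,w\rangle^n}{n!}\Bigr)(z)\qquad(z,w\in\mathbb C^N),$$ with $\langle\cdot,\cdot\rangle$ extended bilinearly to $\mathbb C^N$. Let $w_k(x)=\prod_{\alpha\in R_+}|\langle\alpha,x\rangle|^{2k(\alpha)}$, $\gamma=\sum_{\alpha\in R_+}k(\alpha)$ and $c_k=\bigl(\int_{\mathbb R^N}e^{-|x|^2}w_k(x)\,dx\bigr)^{-1}$. For $t>0$ and $x\in\mathbb R^N$ the $k$-Gaussian measure $P_t^\Gamma(x,\cdot)$ on $\mathbb R^N$ is $$dP_t^\Gamma(x,\cdot)(y)=\frac{c_k}{(4t)^{\gamma+N/2}}\,e^{-(|x|^2+|y|^2)/4t}\,K\Bigl(\frac{x}{\sqrt{2t}},\frac{y}{\sqrt{2t}}\Bigr)w_k(y)\,dy .$$ For multi-indices $\nu\in\mathbb Z_+^N$ and $x,y\in\mathbb R^N$ define the Appell characters and cocharacters by $$R_\nu(t,x)=i^{|\nu|}\,\partial_y^\nu\Bigl(K(x,-iy)\,e^{t|y|^2}\Bigr)\Big|_{y=0},\qquad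 S_\nu(t,y)=T_x^\nu\Bigl(e^{-|x|^2/4t}\,K\bigl(x,\tfrac{y}{2t}\bigr)\Bigr)\Big|_{x=0},$$ where $T^\nu=T_1^{\nu_1}\cdots T_N^{\nu_N}$ and the subscript of an operator names the variable on which it acts. **Theorem.** Let $t>0$. Then all integrals below converge absolutely, and: 1. for all $\nu,\rho\in\mathbb Z_+^N$, $$\int_{\mathbb R^N}R_\nu(t,y)\,S_\rho(t,y)\,dP_t^\Gamma(0,\cdot)(y)=\nu!\,\delta_{\nu,\rho};$$ 2. for all $\nu\in\mathbb Z_+^N$ and every polynomial $p\in\mathcal P$ of degree less than $|\nu|$, $$\int_{\mathbb R^N}p(y)\,S_\nu(t,y)\,dP_t^\Gamma(0,\cdot)(y)=\int_{\mathbb R^N}p(y)\,R_\nu(t,y)\,dP_t^\Gamma(0,\cdot)(y)=0 .$$ -/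

import Mathlib

open MeasureTheory
open scoped Nat RealInnerProductSpace

noncomputable section

namespace Dunkl

/-- The Euclidean space `ℝ^N`. -/
abbrev E (N : ℕ) := EuclideanSpace ℝ (Fin N)

/-- The algebra `ℂ[x_1, …, x_N]` of complex polynomial functions on `ℝ^N`. -/
abbrev Poly (N : ℕ) := MvPolynomial (Fin N) ℂ

variable {N : ℕ}

/-! ### Root systems -/

/-- The reflection `σ_α` in the hyperplane orthogonal to `α`. -/
def refl (α : E N) : E N ≃ₗᵢ[ℝ] E N := (ℝ ∙ α)ᗮ.reflection

/-- `R` is a (reduced, not necessarily spanning or crystallographic) root system all of whose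
roots have length `√2`. -/
structure IsNormalizedRootSystem (R : Finset (E N)) : Prop where
  norm_eq : ∀ α ∈ R, ‖α‖ = √2
  inter_line : ∀ α ∈ R, (R : Set (E N)) ∩ (ℝ ∙ α : Submodule ℝ (E N)) = {α, -α}
  refl_image : ∀ α ∈ R, refl α '' (R : Set (E N)) = R

/-- The reflection group `W` generated by the `σ_α`, `α ∈ R`. -/
def reflectionGroup (R : Finset (E N)) : Subgroup (E N ≃ₗᵢ[ℝ] E N) :=
  Subgroup.closure {g | ∃ α ∈ R, g = refl α}

open scoped Classical in
/-- The positive subsystem `R₊ = {α ∈ R : ⟨α, β⟩ > 0}`. -/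
def positiveRoots (R : Finset (E N)) (β : E N) : Finset (E N) :=
  R.filter fun α => 0 < ⟪α, β⟫

/-! ### Multi-indices -/

/-- `|ν| = ν_1 + … + ν_N`. -/
def deg (ν : Fin N → ℕ) : ℕ := ∑ i, ν i

/-- `ν! = ν_1! ⋯ ν_N!`. -/
def fact (ν : Fin N → ℕ) : ℕ := ∏ i, (ν i)!

/-- `A^ν = A_1^{ν_1} ∘ ⋯ ∘ A_N^{ν_N}` for a family of operators. -/
def opPow {F : Type*} (A : Fin N → F → F) (ν : Fin N → ℕ) : F → F :=
  (List.ofFn fun i => (A i)^[ν i]).foldr (· ∘ ·) id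

/-! ### Partial derivatives and Dunkl operators

In what follows `P` is the set of positive roots and `k` the multiplicity function. -/

/-- The partial derivative `∂_i`. -/
def pderiv (i : Fin N) (f : E N → ℂ) : E N → ℂ :=
  fun x => fderiv ℝ f x (EuclideanSpace.single i 1)

open scoped Classical in
/-- The difference quotient `(f(x) - f(σ_α x)) / ⟨α, x⟩`. On the hyperplane `⟨α, x⟩ = 0` it is given
its limiting value, which for differentiable `f` and `|α|² = 2` is the derivative of `f` at `x` in
the direction `α` (recall `σ_α x = x - ⟨α, x⟩ α`). -/
def diffQuot (α : E N) (f : E N → ℂ) : E N → ℂ :=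
  fun x => if ⟪α, x⟫ = 0 then fderiv ℝ f x α else (f x - f (refl α x)) / ((⟪α, x⟫ : ℝ) : ℂ)

/-- The Dunkl operator `T_i f = ∂_i f + ∑_{α ∈ R₊} k(α) α_i (f - f ∘ σ_α) / ⟨α, ·⟩`. -/
def T (P : Finset (E N)) (k : E N → ℝ) (i : Fin N) (f : E N → ℂ) : E N → ℂ :=
  fun x => pderiv i f x + ∑ α ∈ P, ((k α * α i : ℝ) : ℂ) * diffQuot α f x

/-! ### The intertwining operator and the Dunkl kernel -/

/-- A real vector as a complex vector. -/
def toC (x : E N) : Fin N → ℂ := fun i => (x i : ℂ)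

/-- The polynomial function on `ℝ^N` given by `p`. -/
def polyFun (p : Poly N) : E N → ℂ := fun x => MvPolynomial.eval (toC x) p

/-- The properties `V(𝒫_n) = 𝒫_n`, `V|_{𝒫_0} = id`, `T_i V = V ∂_i` that characterize the
intertwining operator. -/
structure IsIntertwiner (P : Finset (E N)) (k : E N → ℝ) (V : Poly N →ₗ[ℂ] Poly N) : Prop where
  map_homogeneous : ∀ n : ℕ,
    (MvPolynomial.homogeneousSubmodule (Fin N) ℂ n).map V =
      MvPolynomial.homogeneousSubmodule (Fin N) ℂ n
  map_const : ∀ c : ℂ, V (MvPolynomial.C c) = MvPolynomial.C c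
  intertwines : ∀ (i : Fin N) (p : Poly N),
    T P k i (polyFun (V p)) = polyFun (V (MvPolynomial.pderiv i p))

/-- The intertwining operator `V`: the linear operator on polynomials that has the properties
`IsIntertwiner` (for `k ≥ 0` there is exactly one). -/
def V (P : Finset (E N)) (k : E N → ℝ) : Poly N →ₗ[ℂ] Poly N :=
  Classical.epsilon (IsIntertwiner P k)

/-- The homogeneous component `⟨·, w⟩^n / n!` of the function `e^{⟨·, w⟩}`. -/
def expComponent (w : Fin N → ℂ) (n : ℕ) : Poly N :=
  MvPolynomial.C ((n ! : ℂ)⁻¹) * (∑ i, MvPolynomial.C (w i) * MvPolynomial.X i) ^ n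

/-- The Dunkl kernel `K(z, w) = V(e^{⟨·, w⟩})(z) = ∑_n V(⟨·, w⟩^n / n!)(z)` on `ℂ^N × ℂ^N`. -/
def K (P : Finset (E N)) (k : E N → ℝ) (z w : Fin N → ℂ) : ℂ :=
  ∑' n : ℕ, MvPolynomial.eval z (V P k (expComponent w n))

/-! ### The heat kernel and the `k`-Gaussian measures -/

/-- `γ = ∑_{α ∈ R₊} k(α)`. -/
def gam (P : Finset (E N)) (k : E N → ℝ) : ℝ := ∑ α ∈ P, k α

/-- The weight `w_k(x) = ∏_{α ∈ R₊} |⟨α, x⟩|^{2 k(α)}`. -/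
def weight (P : Finset (E N)) (k : E N → ℝ) (x : E N) : ℝ := ∏ α ∈ P, |⟪α, x⟫| ^ (2 * k α)

/-- `c_k = (∫ e^{-|x|²} w_k(x) dx)⁻¹`. -/
def ck (P : Finset (E N)) (k : E N → ℝ) : ℝ :=
  (∫ x : E N, Real.exp (-‖x‖ ^ 2) * weight P k x)⁻¹

/-- The heat kernel
`Γ_k(x, y, t) = c_k (4t)^{-(γ + N/2)} e^{-(|x|² + |y|²)/4t} K(x/√(2t), y/√(2t))`.
The Dunkl kernel is real on real arguments, so taking the real part only changes the type. -/
def heatKernel (P : Finset (E N)) (k : E N → ℝ) (x y : E N) (t : ℝ) : ℝ :=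
  ck P k / (4 * t) ^ (gam P k + N / 2) * Real.exp (-(‖x‖ ^ 2 + ‖y‖ ^ 2) / (4 * t)) *
    (K P k (toC ((√(2 * t))⁻¹ • x)) (toC ((√(2 * t))⁻¹ • y))).re

/-- The `k`-Gaussian measure `P_t^Γ(x, ·)`, with Lebesgue density `Γ_k(x, ·, t) w_k`. -/
def gaussian (P : Finset (E N)) (k : E N → ℝ) (t : ℝ) (x : E N) : Measure (E N) :=
  volume.withDensity fun y => ENNReal.ofReal (heatKernel P k x y t * weight P k y)

/-! ### Appell characters and cocharacters -/

/-- The Appell character `R_ν(t, x) = i^{|ν|} ∂_y^ν (K(x, -iy) e^{t|y|²}) |_{y = 0}`, that is, the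
coefficient of `(-iy)^ν / ν!` in the power series expansion of `K(x, -iy) e^{t|y|²}`. -/
def appellR (P : Finset (E N)) (k : E N → ℝ) (ν : Fin N → ℕ) (t : ℝ) (x : E N) : ℂ :=
  Complex.I ^ deg ν *
    opPow pderiv ν
      (fun y : E N => K P k (toC x) (fun i => -Complex.I * toC y i) *
        (Real.exp (t * ‖y‖ ^ 2) : ℂ)) 0

/-- The Appell cocharacter `S_ν(t, y) = T_x^ν (e^{-|x|²/4t} K(x, y/2t)) |_{x = 0}`. -/
def appellS (P : Finset (E N)) (k : E N → ℝ) (ν : Fin N → ℕ) (t : ℝ) (y : E N) : ℂ :=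
  opPow (T P k) ν
    (fun x : E N => (Real.exp (-‖x‖ ^ 2 / (4 * t)) : ℂ) *
      K P k (toC x) (toC ((2 * t)⁻¹ • y))) 0

end Dunkl

end

noncomputable section

namespace Dunkl

variable {N : ℕ}

section

/-! Everything reduces to algebra with the functional L(p) = ∫ p dP_t(0, ·) on polynomials. Since
K(0, ·) = 1, the density of this measure is a constant times e^{-|y|²/4t} w_k, and three facts
(`IsGaussianFunctional`) are all that is needed of it: L(1) = 1, L is invariant under reflections in
the roots, and 2t L(T_i p) = L(y_i p). The last is the antisymmetry of T_i; it follows by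
integrating by parts against the smooth weight ∏(⟨α,y⟩² + ε)^{k(α)} and letting ε → 0.

Let A_n(y, w) be the component of degree n in w of e^{-t⟨w,w⟩} K(y, w). Then T_i A_{n+1} = w_i A_n
in the variable y, and L(K(·, w)) = e^{t⟨w,w⟩}, read degree by degree, gives L(A_n) = 0 for n ≥ 1.
Although T_i is no derivation, reflection invariance gives L(y_i p q) = 2t (L(T_i p · q) + L(p · T_i
q)). Induction on the degree yields the reproducing identity
`IsGaussianFunctional.map_mul_appellGen`: for q homogeneous of degree m ≤ n, L(q A_n(·, w)) is
(2t)^n q(w) if m = n and 0 if m < n.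

Taking w = -iy, R_ν is ν! times the coefficient of w^ν in A_{|ν|}: it is orthogonal to all
polynomials of lower degree, and its top component is V(x^ν). Taking w = x/2t and using the symmetry
of K, S_ρ arises from (2t)^{-|ρ|} A_{|ρ|}(·, x) by applying T_x^ρ at x = 0; hence L(p S_ρ) = (T^ρ
p_{|ρ|})(0) whenever deg p ≤ |ρ|, where p_n denotes the component of degree n. For p = R_ν with |ν|
= |ρ| this is T^ρ V x^ν (0) = V ∂^ρ x^ν (0) = ν! δ_{νρ}.

The required facts about V and K rest on the identity ∑ x_i T_i = E_n := n + ∑ k(α)(1 - σ_α) in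
degree n. As k ≥ 0 and the σ_α preserve balls of ℂ^N, E_n obeys a maximum principle
(`max_principle`). It makes E_n invertible in degree n ≥ 1, which yields V by recursion on the
degree, as well as the bound |K_n(z,w)| ≤ (|z||w|)^n/n!, the reflection invariance and the symmetry
of the components K_n of K. -/

open MvPolynomial in
/-- Induction principle for homogeneous polynomials, by multiplication with the variables. -/
theorem homogeneous_induction {motive : ℕ → Poly N → Prop}
    (const : ∀ c, motive 0 (C c)) (zero : ∀ n, motive n 0)
    (add : ∀ n p q, motive n p → motive n q → motive n (p + q))
    (X_mul : ∀ n i q, q.IsHomogeneous n → motive n q → motive (n + 1) (X i * q))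
    {n : ℕ} {p : Poly N} (hp : p.IsHomogeneous n) : motive n p := by
  induction n generalizing p with
  | zero =>
    rw [← totalDegree_zero_iff_isHomogeneous, totalDegree_eq_zero_iff_eq_C] at hp
    rw [hp]
    exact const _
  | succ n ih =>
    have e : p = ∑ i, X i * (C ((n + 1 : ℂ)⁻¹) * MvPolynomial.pderiv i p) := by
      have h := hp.sum_X_mul_pderiv
      have h0 : (n + 1 : ℂ) ≠ 0 := by exact_mod_cast n.succ_ne_zero
      calc p = C ((n + 1 : ℂ)⁻¹) * ((n + 1) • p) := by
            rw [← Nat.cast_smul_eq_nsmul ℂ, smul_eq_C_mul, ← mul_assoc, ← C_mul]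
            push_cast
            rw [inv_mul_cancel₀ h0, C_1, one_mul]
        _ = _ := by
            rw [← h, Finset.mul_sum]
            exact Finset.sum_congr rfl fun i _ => by ring
    have key : ∀ s : Finset (Fin N), motive (n + 1)
        (∑ i ∈ s, X i * (C ((n + 1 : ℂ)⁻¹) * MvPolynomial.pderiv i p)) := by
      classical
      intro s
      induction s using Finset.induction_on with
      | empty => simpa using zero _
      | insert a s ha hs =>
        rw [Finset.sum_insert ha]
        have hq : (C ((n + 1 : ℂ)⁻¹) * MvPolynomial.pderiv a p).IsHomogeneous n :=
          (hp.pderiv).C_mul _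
        exact add _ _ _ (X_mul _ _ _ hq (ih hq)) hs
    rw [e]
    exact key _

/-! ### Reflections and difference quotients of polynomials -/

open MvPolynomial

/-- The linear form `⟨α, ·⟩`. -/
def linForm (α : E N) : Poly N := ∑ j, C (α j : ℂ) * X j

/-- The substitution `p ↦ p ∘ σ_α`. -/
def reflPoly (α : E N) : Poly N →ₐ[ℂ] Poly N :=
  aeval fun i => X i - C (α i : ℂ) * linForm α

/-- The bilinear dot product of real vectors. -/
def dot (α γ : E N) : ℝ := ∑ j, α j * γ j

theorem dot_comm (α γ : E N) : dot α γ = dot γ α := by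
  simp only [dot, mul_comm]

/-- The reflection `α ↦ α - ⟨α, γ⟩ γ`. -/
def reflVec (γ α : E N) : E N := α - dot α γ • γ

@[simp]
theorem reflPoly_X (α : E N) (i : Fin N) :
    reflPoly α (X i) = X i - C (α i : ℂ) * linForm α := by
  simp [reflPoly]

@[simp]
theorem reflPoly_C (α : E N) (c : ℂ) : reflPoly α (C c) = C c := by
  simp [reflPoly]

theorem linForm_sub_smul (α γ : E N) (c : ℝ) :
    linForm (α - c • γ) = linForm α - C (c : ℂ) * linForm γ := by
  simp only [linForm, Finset.mul_sum, ← Finset.sum_sub_distrib]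
  refine Finset.sum_congr rfl fun j _ => ?_
  simp
  ring

theorem linForm_neg (α : E N) : linForm (-α) = -linForm α := by
  simp [linForm]

theorem reflPoly_linForm (γ α : E N) : reflPoly γ (linForm α) = linForm (reflVec γ α) := by
  rw [reflVec, linForm_sub_smul]
  conv_lhs => rw [linForm]
  simp only [map_sum, map_mul, reflPoly_C, reflPoly_X, mul_sub, Finset.sum_sub_distrib]
  congr 1
  simp only [dot, Complex.ofReal_sum, map_sum, Finset.sum_mul]
  refine Finset.sum_congr rfl fun j _ => ?_
  simp
  ring

theorem dot_sub_smul_left (α γ δ : E N) (c : ℝ) :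
    dot (α - c • γ) δ = dot α δ - c * dot γ δ := by
  simp only [dot, Finset.mul_sum, ← Finset.sum_sub_distrib]
  refine Finset.sum_congr rfl fun j _ => ?_
  simp only [PiLp.sub_apply, PiLp.smul_apply, smul_eq_mul]
  ring

theorem dot_reflVec_left (γ α : E N) (hγ : dot γ γ = 2) : dot (reflVec γ α) γ = -dot α γ := by
  rw [reflVec, dot_sub_smul_left, hγ]
  ring

theorem reflVec_reflVec (γ α : E N) (hγ : dot γ γ = 2) : reflVec γ (reflVec γ α) = α := by
  rw [reflVec, dot_reflVec_left γ α hγ, reflVec]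
  simp

theorem reflVec_self (γ : E N) (hγ : dot γ γ = 2) : reflVec γ γ = -γ := by
  rw [reflVec, hγ, two_smul]
  abel

theorem dot_reflVec_reflVec (γ α δ : E N) (hγ : dot γ γ = 2) :
    dot (reflVec γ α) (reflVec γ δ) = dot α δ := by
  rw [dot_comm, reflVec, dot_sub_smul_left, dot_comm γ, dot_reflVec_left γ α hγ, dot_comm,
    reflVec, dot_sub_smul_left, dot_comm γ δ]
  ring

theorem linForm_ne_zero (α : E N) (hα : dot α α = 2) : linForm α ≠ 0 := by
  intro h
  have h2 := congrArg (MvPolynomial.eval fun j => (α j : ℂ)) h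
  simp only [linForm, map_sum, map_mul, eval_C, eval_X, map_zero] at h2
  have h3 : ((dot α α : ℝ) : ℂ) = 0 := by
    rw [← h2]
    simp [dot]
  rw [hα] at h3
  norm_num at h3

theorem algHom_comp_eq {f g : Poly N →ₐ[ℂ] Poly N} (h : ∀ i, f (X i) = g (X i)) (p : Poly N) :
    f p = g p := by
  rw [MvPolynomial.algHom_ext h]

theorem reflPoly_reflPoly (γ : E N) (hγ : dot γ γ = 2) (p : Poly N) :
    reflPoly γ (reflPoly γ p) = p := by
  refine algHom_comp_eq (f := (reflPoly γ).comp (reflPoly γ)) (g := AlgHom.id ℂ _)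
    (fun i => ?_) p
  simp [reflPoly_linForm, reflVec_self γ hγ, linForm_neg]

theorem reflPoly_conj (γ α : E N) (hγ : dot γ γ = 2) (p : Poly N) :
    reflPoly γ (reflPoly α p) = reflPoly (reflVec γ α) (reflPoly γ p) := by
  refine algHom_comp_eq (f := (reflPoly γ).comp (reflPoly α))
    (g := (reflPoly (reflVec γ α)).comp (reflPoly γ)) (fun i => ?_) p
  have h1 : reflVec (reflVec γ α) γ = γ + dot α γ • reflVec γ α := by
    conv_lhs => rw [reflVec]
    rw [dot_comm, dot_reflVec_left γ α hγ]
    simp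
  have h2 : linForm (γ + dot α γ • reflVec γ α) =
      linForm γ + C (dot α γ : ℂ) * linForm (reflVec γ α) := by
    have := linForm_sub_smul γ (reflVec γ α) (-dot α γ)
    simpa using this
  have h3 : (reflVec γ α i : ℂ) = α i - dot α γ * γ i := by
    simp [reflVec]
  simp only [AlgHom.comp_apply, reflPoly_X, map_sub, map_mul, reflPoly_C, reflPoly_linForm, h1, h2,
    h3]
  ring

/-- The operator 1 - σ_α is a twisted derivation and sends x_i to α_i⟨α, ·⟩, so divisibility
propagates from the variables to products. -/
theorem linForm_dvd (α : E N) (p : Poly N) : linForm α ∣ p - reflPoly α p := by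
  induction p using MvPolynomial.induction_on with
  | C a => simp
  | add p q hp hq =>
    have : p + q - reflPoly α (p + q) = (p - reflPoly α p) + (q - reflPoly α q) := by
      rw [map_add]; ring
    rw [this]
    exact dvd_add hp hq
  | mul_X p i hp =>
    have : p * X i - reflPoly α (p * X i) =
        (p - reflPoly α p) * X i + linForm α * (C (α i : ℂ) * reflPoly α p) := by
      rw [map_mul, reflPoly_X]; ring
    rw [this]
    exact dvd_add (hp.mul_right _) (dvd_mul_right _ _)

/-- The difference quotient `(p - p ∘ σ_α) / ⟨α, ·⟩` of a polynomial. -/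
def divDiffFun (α : E N) (p : Poly N) : Poly N := (linForm_dvd α p).choose

theorem linForm_mul_divDiffFun (α : E N) (p : Poly N) :
    linForm α * divDiffFun α p = p - reflPoly α p :=
  (linForm_dvd α p).choose_spec.symm

/-- The difference quotient as a linear operator (for `α ≠ 0`). -/
def divDiff (α : E N) : Poly N →ₗ[ℂ] Poly N :=
  open scoped Classical in
  if h : linForm α = 0 then 0 else
  { toFun := divDiffFun α
    map_add' := fun p q => mul_left_cancel₀ h (by
      simp only [mul_add, linForm_mul_divDiffFun, map_add]; ring)
    map_smul' := fun c p => mul_left_cancel₀ h (by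
      simp only [mul_smul_comm, linForm_mul_divDiffFun, map_smul, RingHom.id_apply, smul_sub]) }

theorem linForm_mul_divDiff (α : E N) (hα : dot α α = 2) (p : Poly N) :
    linForm α * divDiff α p = p - reflPoly α p := by
  rw [divDiff, dif_neg (linForm_ne_zero α hα)]
  exact linForm_mul_divDiffFun α p

theorem divDiff_mul (α : E N) (hα : dot α α = 2) (p q : Poly N) :
    divDiff α (p * q) = divDiff α p * q + reflPoly α p * divDiff α q := by
  apply mul_left_cancel₀ (linForm_ne_zero α hα)
  have hp := linForm_mul_divDiff α hα p
  have hq := linForm_mul_divDiff α hα q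
  rw [linForm_mul_divDiff α hα, map_mul]
  linear_combination -q * hp - reflPoly α p * hq

theorem divDiff_C (α : E N) (hα : dot α α = 2) (c : ℂ) : divDiff α (C c) = 0 := by
  apply mul_left_cancel₀ (linForm_ne_zero α hα)
  rw [linForm_mul_divDiff α hα]
  simp

theorem divDiff_X (α : E N) (hα : dot α α = 2) (i : Fin N) : divDiff α (X i) = C (α i : ℂ) := by
  apply mul_left_cancel₀ (linForm_ne_zero α hα)
  rw [linForm_mul_divDiff α hα, reflPoly_X]
  ring

theorem reflPoly_divDiff (γ α : E N) (hγ : dot γ γ = 2) (hα : dot α α = 2) (p : Poly N) :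
    reflPoly γ (divDiff α p) = divDiff (reflVec γ α) (reflPoly γ p) := by
  have hδ : dot (reflVec γ α) (reflVec γ α) = 2 := by rw [dot_reflVec_reflVec _ _ _ hγ, hα]
  apply mul_left_cancel₀ (linForm_ne_zero _ hδ)
  rw [linForm_mul_divDiff _ hδ, ← reflPoly_linForm, ← map_mul, linForm_mul_divDiff α hα, map_sub,
    reflPoly_conj γ α hγ]

theorem reflPoly_neg (α : E N) (p : Poly N) : reflPoly (-α) p = reflPoly α p := by
  refine algHom_comp_eq (fun i => ?_) p
  simp [linForm_neg]

theorem divDiff_neg (α : E N) (hα : dot α α = 2) (p : Poly N) :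
    divDiff (-α) p = -divDiff α p := by
  have hδ : dot (-α) (-α) = 2 := by rw [← hα]; simp [dot]
  apply mul_left_cancel₀ (linForm_ne_zero _ hδ)
  rw [linForm_mul_divDiff _ hδ, linForm_neg, neg_mul_neg, linForm_mul_divDiff _ hα, reflPoly_neg]

/-- Numerator and denominator both change sign under σ_α. This invariance later turns the twisted
product rule into an untwisted one under a reflection-invariant functional. -/
theorem reflPoly_divDiff_self (α : E N) (hα : dot α α = 2) (p : Poly N) :
    reflPoly α (divDiff α p) = divDiff α p := by
  rw [reflPoly_divDiff α α hα hα, reflVec_self α hα, divDiff_neg α hα]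
  apply mul_left_cancel₀ (linForm_ne_zero _ hα)
  rw [mul_neg, linForm_mul_divDiff _ hα, linForm_mul_divDiff _ hα, reflPoly_reflPoly α hα]
  ring

theorem isHomogeneous_linForm (α : E N) : (linForm α).IsHomogeneous 1 :=
  IsHomogeneous.sum _ _ _ fun j _ => isHomogeneous_C_mul_X _ j

theorem isHomogeneous_reflPoly (α : E N) {n : ℕ} {p : Poly N} (hp : p.IsHomogeneous n) :
    (reflPoly α p).IsHomogeneous n := by
  have := hp.aeval (fun i => X i - C (α i : ℂ) * linForm α) (n := 1) (fun i =>
    (isHomogeneous_X ℂ i).sub ((isHomogeneous_linForm α).C_mul _))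
  simpa [reflPoly] using this

theorem isHomogeneous_divDiff (α : E N) (hα : dot α α = 2) {n : ℕ} {p : Poly N}
    (hp : p.IsHomogeneous n) : (divDiff α p).IsHomogeneous (n - 1) := by
  refine homogeneous_induction (motive := fun n p => (divDiff α p).IsHomogeneous (n - 1))
    (fun c => ?_) (fun n => ?_) (fun n p q hp hq => ?_) (fun n i q hq ih => ?_) hp
  · rw [divDiff_C α hα]
    exact isHomogeneous_zero _ _ _
  · rw [map_zero]
    exact isHomogeneous_zero _ _ _
  · rw [map_add]
    exact hp.add hq
  · rw [mul_comm, divDiff_mul α hα, divDiff_X α hα, Nat.add_sub_cancel]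
    refine IsHomogeneous.add ?_ ?_
    · cases n with
      | zero =>
        rw [← totalDegree_zero_iff_isHomogeneous, totalDegree_eq_zero_iff_eq_C] at hq
        rw [hq, divDiff_C α hα, zero_mul]
        exact isHomogeneous_zero _ _ _
      | succ n => exact ih.mul (isHomogeneous_X ℂ i)
    · rw [mul_comm]
      exact (isHomogeneous_reflPoly α hq).C_mul _

/-! ### Dunkl operators on polynomials -/

/-- The Dunkl operator `T_i` on polynomials. -/
def TPoly (P : Finset (E N)) (k : E N → ℝ) (i : Fin N) : Poly N →ₗ[ℂ] Poly N :=
  (MvPolynomial.pderiv i).toLinearMap + ∑ α ∈ P, ((k α * α i : ℝ) : ℂ) • divDiff α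

theorem TPoly_apply (P : Finset (E N)) (k : E N → ℝ) (i : Fin N) (p : Poly N) :
    TPoly P k i p =
      MvPolynomial.pderiv i p + ∑ α ∈ P, C (k α * α i : ℂ) * divDiff α p := by
  simp [TPoly, LinearMap.sum_apply, smul_eq_C_mul]

/-- `P` is the set of positive roots (of length `√2`) of a reflection group and `k` is an invariant
nonnegative function on it: each reflection permutes `P` up to signs. -/
structure IsPositiveSystem (P : Finset (E N)) (k : E N → ℝ) : Prop where
  dot_self : ∀ α ∈ P, dot α α = 2
  nonneg : ∀ α ∈ P, 0 ≤ k α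
  perm : ∀ γ ∈ P, ∃ τ : E N → E N, (∀ α ∈ P, τ α ∈ P) ∧ (∀ α ∈ P, τ (τ α) = α) ∧
    ∀ α ∈ P, (τ α = reflVec γ α ∨ τ α = -reflVec γ α) ∧ k (τ α) = k α

/-- A reflection permutes the positive roots only up to sign, and evenness of F in the root absorbs
the sign. -/
theorem IsPositiveSystem.prod_reflVec {M : Type*} [CommMonoid M] {P : Finset (E N)} {k : E N → ℝ}
    (hP : IsPositiveSystem P k) {γ : E N} (hγ : γ ∈ P) (F : ℝ → E N → M)
    (hF : ∀ c α, dot α α = 2 → F c (-α) = F c α) :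
    ∏ α ∈ P, F (k α) (reflVec γ α) = ∏ α ∈ P, F (k α) α := by
  obtain ⟨τ, h1, h2, h3⟩ := hP.perm γ hγ
  refine Finset.prod_nbij' τ τ h1 h1 h2 h2 fun α hα => ?_
  rw [(h3 α hα).2]
  rcases (h3 α hα).1 with h | h
  · rw [h]
  · rw [h, hF]
    rw [dot_reflVec_reflVec _ _ _ (hP.dot_self γ hγ), hP.dot_self α hα]

theorem IsPositiveSystem.sum_reflVec {M : Type*} [AddCommMonoid M] {P : Finset (E N)}
    {k : E N → ℝ} (hP : IsPositiveSystem P k) {γ : E N} (hγ : γ ∈ P) (F : ℝ → E N → M)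
    (hF : ∀ c α, dot α α = 2 → F c (-α) = F c α) :
    ∑ α ∈ P, F (k α) (reflVec γ α) = ∑ α ∈ P, F (k α) α :=
  hP.prod_reflVec (M := Multiplicative M) hγ F hF

theorem pderiv_reflPoly (γ : E N) (i : Fin N) (p : Poly N) :
    MvPolynomial.pderiv i (reflPoly γ p) = reflPoly γ (MvPolynomial.pderiv i p -
      C (γ i : ℂ) * ∑ j, C (γ j : ℂ) * MvPolynomial.pderiv j p) := by
  have hl : MvPolynomial.pderiv i (linForm γ) = C (γ i : ℂ) := by
    classical
    simp only [linForm, map_sum, pderiv_C_mul, pderiv_X, Pi.single_apply]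
    simp
  induction p using MvPolynomial.induction_on with
  | C a => simp
  | add p q hp hq =>
    simp only [map_add, hp, hq, mul_add, Finset.sum_add_distrib, map_sub, map_mul]
    ring
  | mul_X p m hp =>
    classical
    have e : ∑ j, C (γ j : ℂ) * MvPolynomial.pderiv j (p * X m) =
        (∑ j, C (γ j : ℂ) * MvPolynomial.pderiv j p) * X m + C (γ m : ℂ) * p := by
      simp only [pderiv_mul, pderiv_X, mul_add, Finset.sum_add_distrib, Finset.sum_mul]
      congr 1
      · exact Finset.sum_congr rfl fun j _ => by ring
      · rw [Finset.sum_eq_single m]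
        · simp
        · intro j _ hj
          simp [hj.symm]
        · simp
    rw [e]
    simp only [map_mul, pderiv_mul, hp, reflPoly_X, map_sub, map_add, reflPoly_C, pderiv_C,
      hl, pderiv_X]
    have e2 : reflPoly γ (Pi.single (M := fun _ => Poly N) i 1 m) =
        Pi.single (M := fun _ => Poly N) i 1 m := by
      by_cases h : m = i
      · subst h; simp
      · simp [h]
    rw [e2]
    ring

theorem sum_C_mul_TPoly (P : Finset (E N)) (k : E N → ℝ) (γ : E N) (p : Poly N) :
    ∑ j, C (γ j : ℂ) * TPoly P k j p = ∑ j, C (γ j : ℂ) * MvPolynomial.pderiv j p +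
      ∑ α ∈ P, C (k α * dot α γ : ℂ) * divDiff α p := by
  simp only [TPoly_apply, mul_add, Finset.sum_add_distrib, Finset.mul_sum]
  rw [Finset.sum_comm]
  congr 1
  refine Finset.sum_congr rfl fun α _ => ?_
  simp only [dot, Complex.ofReal_sum, Finset.mul_sum, map_sum, Finset.sum_mul]
  refine Finset.sum_congr rfl fun j _ => ?_
  simp only [Complex.ofReal_mul, C_mul]
  ring

/-- Equivariance of the Dunkl operators under the reflections. -/
theorem TPoly_reflPoly {P : Finset (E N)} {k : E N → ℝ} (hP : IsPositiveSystem P k) {γ : E N}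
    (hγ : γ ∈ P) (i : Fin N) (p : Poly N) :
    TPoly P k i (reflPoly γ p) =
      reflPoly γ (TPoly P k i p - C (γ i : ℂ) * ∑ j, C (γ j : ℂ) * TPoly P k j p) := by
  have hγ2 := hP.dot_self γ hγ
  have h := hP.sum_reflVec hγ
    (fun c α => C (c * α i : ℂ) * divDiff α (reflPoly γ p)) (fun c α hα => by
      rw [divDiff_neg α hα]; simp)
  rw [sum_C_mul_TPoly, TPoly_apply, TPoly_apply, pderiv_reflPoly, ← h]
  simp only [map_sub, map_add, map_mul, map_sum, reflPoly_C, mul_add, Finset.mul_sum]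
  have e : ∑ α ∈ P, C ((k α : ℂ) * (reflVec γ α i : ℂ)) * divDiff (reflVec γ α) (reflPoly γ p) =
      ∑ α ∈ P, C (k α * α i : ℂ) * reflPoly γ (divDiff α p) -
      ∑ α ∈ P, C (γ i : ℂ) * (C (k α * dot α γ : ℂ) * reflPoly γ (divDiff α p)) := by
    rw [← Finset.sum_sub_distrib]
    refine Finset.sum_congr rfl fun α hα => ?_
    rw [reflPoly_divDiff γ α hγ2 (hP.dot_self α hα)]
    have : (reflVec γ α i : ℂ) = α i - dot α γ * γ i := by simp [reflVec]
    rw [this]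
    simp only [C_mul, C_sub]
    ring
  simp only [C_mul] at e ⊢
  rw [e]
  ring

/-- The reflection terms measure the failure of the Leibniz rule; they come from the twisted product
rule for difference quotients. -/
theorem TPoly_X_mul {P : Finset (E N)} {k : E N → ℝ} (hP : IsPositiveSystem P k) (i j : Fin N)
    (p : Poly N) :
    TPoly P k i (X j * p) = X j * TPoly P k i p + (if i = j then p else 0) +
      ∑ α ∈ P, C (k α * α i : ℂ) * (C (α j : ℂ) * reflPoly α p) := by
  simp only [TPoly_apply]
  have : ∀ α ∈ P, C (k α * α i : ℂ) * divDiff α (X j * p) =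
      X j * (C (k α * α i : ℂ) * divDiff α p) +
        C (k α * α i : ℂ) * (C (α j : ℂ) * reflPoly α p) := by
    intro α hα
    rw [mul_comm (X j) p, divDiff_mul α (hP.dot_self α hα), divDiff_X α (hP.dot_self α hα)]
    ring
  rw [Finset.sum_congr rfl this, Finset.sum_add_distrib, ← Finset.mul_sum, pderiv_mul]
  by_cases h : i = j
  · subst h
    simp
    ring
  · rw [pderiv_X_of_ne (fun h' => h h'.symm), if_neg h]
    ring

theorem isHomogeneous_TPoly {P : Finset (E N)} {k : E N → ℝ} (hP : ∀ α ∈ P, dot α α = 2)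
    (i : Fin N) {n : ℕ} {p : Poly N} (hp : p.IsHomogeneous n) :
    (TPoly P k i p).IsHomogeneous (n - 1) := by
  rw [TPoly_apply]
  refine hp.pderiv.add (IsHomogeneous.sum _ _ _ fun α hα => ?_)
  exact (isHomogeneous_divDiff α (hP α hα) hp).C_mul _

theorem TPoly_C {P : Finset (E N)} {k : E N → ℝ} (hP : ∀ α ∈ P, dot α α = 2)
    (i : Fin N) (c : ℂ) : TPoly P k i (C c) = 0 := by
  rw [TPoly_apply, pderiv_C, zero_add]
  exact Finset.sum_eq_zero fun α hα => by rw [divDiff_C α (hP α hα), mul_zero]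

/-- The operator `n + ∑ k(α) (1 - σ_α)`. -/
def eulerOp (P : Finset (E N)) (k : E N → ℝ) (n : ℕ) (p : Poly N) : Poly N :=
  C (n : ℂ) * p + ∑ α ∈ P, C (k α : ℂ) * (p - reflPoly α p)

/-- The Dunkl form of Euler's identity: ∑ x_i α_i cancels the denominator of the difference
quotient. -/
theorem sum_X_mul_TPoly {P : Finset (E N)} {k : E N → ℝ} (hP : ∀ α ∈ P, dot α α = 2)
    {n : ℕ} {p : Poly N} (hp : p.IsHomogeneous n) :
    ∑ i, X i * TPoly P k i p = eulerOp P k n p := by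
  simp only [TPoly_apply, mul_add, Finset.sum_add_distrib, hp.sum_X_mul_pderiv, eulerOp,
    Finset.mul_sum]
  rw [Finset.sum_comm]
  congr 1
  · simp
  · refine Finset.sum_congr rfl fun α hα => ?_
    rw [← linForm_mul_divDiff α (hP α hα), linForm, Finset.sum_mul, Finset.mul_sum]
    refine Finset.sum_congr rfl fun j _ => ?_
    rw [C_mul]
    ring

/-- The commutator arises because a reflection also rotates the index of T_j. It has the same shape
as the extra term in T_j(∑ x_i u_i), which allows the comparison in `TPoly_eq_of_eulerOp_eq`. -/
theorem TPoly_eulerOp {P : Finset (E N)} {k : E N → ℝ} (hP : IsPositiveSystem P k) (j : Fin N)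
    (n : ℕ) (p : Poly N) :
    TPoly P k j (eulerOp P k n p) = eulerOp P k n (TPoly P k j p) +
      ∑ α ∈ P, C (k α * α j : ℂ) * reflPoly α (∑ i, C (α i : ℂ) * TPoly P k i p) := by
  simp only [eulerOp, ← smul_eq_C_mul, map_add, map_sum, map_smul, map_sub]
  rw [add_assoc, ← Finset.sum_add_distrib]
  congr 1
  refine Finset.sum_congr rfl fun α hα => ?_
  rw [TPoly_reflPoly hP hα]
  simp only [map_sub, map_mul, map_sum, reflPoly_C, smul_eq_C_mul]
  ring

end

section

open MvPolynomial

/-! ### Complex points -/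

/-- The Hermitian space `ℂ^N`. -/
abbrev CE (N : ℕ) := EuclideanSpace ℂ (Fin N)

/-- The reflection `σ_α` on `ℂ^N`. -/
def reflC (α : E N) (z : CE N) : CE N :=
  z - (∑ j, (α j : ℂ) * z j) • WithLp.toLp 2 (toC α)

theorem reflC_apply (α : E N) (z : CE N) (i : Fin N) :
    reflC α z i = z i - (∑ j, (α j : ℂ) * z j) * α i := by
  simp [reflC, toC]

/-- The complexification of a real orthogonal map is unitary. Balls of ℂ^N are therefore stable
under the reflections, as the maximum principle requires. -/
theorem norm_reflC (α : E N) (hα : dot α α = 2) (z : CE N) : ‖reflC α z‖ = ‖z‖ := by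
  have key : ‖reflC α z‖ ^ 2 = ‖z‖ ^ 2 := by
    rw [EuclideanSpace.norm_sq_eq, EuclideanSpace.norm_sq_eq]
    simp only [reflC_apply]
    set c := ∑ j, (α j : ℂ) * z j with hc
    have h1 : ∀ i, ‖z i - c * α i‖ ^ 2 =
        ‖z i‖ ^ 2 - 2 * ((starRingEnd ℂ) c * (α i * z i)).re + ‖c‖ ^ 2 * (α i * α i) := by
      intro i
      rw [Complex.sq_norm, Complex.sq_norm, Complex.sq_norm]
      simp [Complex.normSq_apply]
      ring
    simp only [h1, Finset.sum_add_distrib, Finset.sum_sub_distrib, ← Finset.mul_sum]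
    have h2 : ∑ i, α i * α i = 2 := hα
    rw [h2, ← Complex.re_sum, ← Finset.mul_sum, ← hc, mul_comm _ c, Complex.mul_conj,
      Complex.ofReal_re, Complex.normSq_eq_norm_sq]
    ring
  exact (pow_left_inj₀ (norm_nonneg _) (norm_nonneg _) two_ne_zero).1 key

theorem eval_linForm (α : E N) (z : Fin N → ℂ) :
    MvPolynomial.eval z (linForm α) = ∑ j, (α j : ℂ) * z j := by
  simp [linForm]

theorem eval_reflPoly (α : E N) (z : CE N) (p : Poly N) :
    MvPolynomial.eval z.ofLp (reflPoly α p) = MvPolynomial.eval (reflC α z).ofLp p := by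
  induction p using MvPolynomial.induction_on with
  | C a => simp
  | add p q hp hq => simp only [map_add, hp, hq]
  | mul_X p i hp =>
    simp only [map_mul, hp, reflPoly_X, map_sub, eval_C, eval_X, eval_linForm, reflC_apply]
    ring

theorem continuous_eval_CE (p : Poly N) :
    Continuous fun z : CE N => MvPolynomial.eval z.ofLp p :=
  (MvPolynomial.continuous_eval p).comp (PiLp.continuous_ofLp 2 _)

theorem poly_eq_zero_of_eval_CE {p : Poly N} (h : ∀ z : CE N, MvPolynomial.eval z.ofLp p = 0) :
    p = 0 :=
  MvPolynomial.funext fun z => by simpa using h (WithLp.toLp 2 z)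

/-- A maximum principle for the operators `n + ∑ k(α) (1 - σ_α)`. -/
theorem max_principle {F : Type*} [NormedAddCommGroup F] [NormedSpace ℝ F] {P : Finset (E N)}
    {k : E N → ℝ} (hP : IsPositiveSystem P k) {n : ℝ} {h : CE N → F}
    (hc : Continuous h) (U : E N → F → F) (hU : ∀ α ∈ P, ∀ v, ‖U α v‖ = ‖v‖) {r C : ℝ}
    (hn : 0 ≤ n)
    (hC : ∀ z, ‖z‖ ≤ r → ‖n • h z + ∑ α ∈ P, k α • (h z - U α (h (reflC α z)))‖ ≤ C)
    {z : CE N} (hz : ‖z‖ ≤ r) : n * ‖h z‖ ≤ C := by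
  -- At a maximum point z₀ of ‖h‖ the reflected values are no larger than ‖h z₀‖, so their total, at
  -- most Γ‖h z₀‖, cancels the Γ in n + Γ.
  obtain ⟨z₀, hz₀, hmax⟩ := (isCompact_closedBall (0 : CE N) r).exists_isMaxOn
    ⟨z, by simpa using hz⟩ hc.norm.continuousOn
  have hz₀' : ‖z₀‖ ≤ r := by simpa using hz₀
  have hle : ∀ y, ‖y‖ ≤ r → ‖h y‖ ≤ ‖h z₀‖ := fun y hy => hmax (by simpa using hy)
  set Γ := ∑ α ∈ P, k α
  have hΓ : 0 ≤ Γ := Finset.sum_nonneg hP.nonneg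
  have e : (n + Γ) • h z₀ = (n • h z₀ + ∑ α ∈ P, k α • (h z₀ - U α (h (reflC α z₀)))) +
      ∑ α ∈ P, k α • U α (h (reflC α z₀)) := by
    simp only [smul_sub, Finset.sum_sub_distrib, add_smul, Γ, Finset.sum_smul]
    abel
  have h1 : ‖∑ α ∈ P, k α • U α (h (reflC α z₀))‖ ≤ Γ * ‖h z₀‖ := by
    rw [Finset.sum_mul]
    refine norm_sum_le_of_le _ fun α hα => ?_
    rw [norm_smul, hU α hα, Real.norm_of_nonneg (hP.nonneg α hα)]
    refine mul_le_mul_of_nonneg_left (hle _ ?_) (hP.nonneg α hα)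
    rwa [norm_reflC α (hP.dot_self α hα)]
  have h2 : (n + Γ) * ‖h z₀‖ ≤ C + Γ * ‖h z₀‖ := by
    have : ‖(n + Γ) • h z₀‖ = (n + Γ) * ‖h z₀‖ := by
      rw [norm_smul, Real.norm_of_nonneg (by positivity)]
    rw [← this, e]
    exact (norm_add_le _ _).trans (add_le_add (hC z₀ hz₀') h1)
  calc n * ‖h z‖ ≤ n * ‖h z₀‖ := mul_le_mul_of_nonneg_left (hle z hz) hn
    _ ≤ C := by linarith

theorem eval_eulerOp (P : Finset (E N)) (k : E N → ℝ) (n : ℕ) (p : Poly N) (z : CE N) :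
    MvPolynomial.eval z.ofLp (eulerOp P k n p) = (n : ℝ) • MvPolynomial.eval z.ofLp p +
      ∑ α ∈ P, k α • (MvPolynomial.eval z.ofLp p - MvPolynomial.eval (reflC α z).ofLp p) := by
  simp [eulerOp, eval_reflPoly]

/-! ### Existence of the intertwining operator -/

theorem isHomogeneous_eulerOp (P : Finset (E N)) (k : E N → ℝ) {n : ℕ} {p : Poly N}
    (hp : p.IsHomogeneous n) : (eulerOp P k n p).IsHomogeneous n :=
  (hp.C_mul _).add (IsHomogeneous.sum _ _ _ fun α _ =>
    (hp.sub (isHomogeneous_reflPoly α hp)).C_mul _)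

theorem eulerOp_injective {P : Finset (E N)} {k : E N → ℝ} (hP : IsPositiveSystem P k) {n : ℕ}
    (hn : n ≠ 0) {p : Poly N} (h : eulerOp P k n p = 0) : p = 0 := by
  refine poly_eq_zero_of_eval_CE fun z => ?_
  have := max_principle hP (n := n) (h := fun z : CE N => MvPolynomial.eval z.ofLp p) (C := 0)
    (r := ‖z‖) (continuous_eval_CE p) (fun _ v => v) (fun _ _ _ => rfl) (by positivity)
    (fun y _ => by rw [← eval_eulerOp, h]; simp) le_rfl
  have hn' : (0 : ℝ) < n := by positivity
  have h0 : ‖MvPolynomial.eval z.ofLp p‖ ≤ 0 := by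
    by_contra hcon
    push Not at hcon
    have := mul_pos hn' hcon
    linarith
  simpa using h0

/-- The operator `n + ∑ k(α) (1 - σ_α)` as a linear map. -/
def eulerLin (P : Finset (E N)) (k : E N → ℝ) (n : ℕ) : Poly N →ₗ[ℂ] Poly N where
  toFun := eulerOp P k n
  map_add' p q := by
    simp only [eulerOp, map_add, mul_add, mul_sub, Finset.sum_add_distrib, Finset.sum_sub_distrib]
    ring
  map_smul' c p := by
    simp only [eulerOp, map_smul, mul_smul_comm, ← smul_sub, ← smul_add, ← Finset.smul_sum,
      RingHom.id_apply]

instance finite_homogeneousSubmodule (n : ℕ) :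
    Module.Finite ℂ (homogeneousSubmodule (Fin N) ℂ n) :=
  Module.Finite.iff_fg.2 (homogeneousSubmodule_fg _ _ n)

/-- An injective endomorphism of the finite-dimensional space of degree n is bijective; its inverse
is extended to all polynomials through the projection to degree n. -/
theorem exists_homogeneous_preimage {n : ℕ} (f : Poly N →ₗ[ℂ] Poly N)
    (hf : ∀ p : Poly N, p.IsHomogeneous n → (f p).IsHomogeneous n)
    (hinj : ∀ p : Poly N, p.IsHomogeneous n → f p = 0 → p = 0) :
    ∃ g : Poly N →ₗ[ℂ] Poly N, ∀ p : Poly N, p.IsHomogeneous n →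
      (g p).IsHomogeneous n ∧ f (g p) = p := by
  let f' : homogeneousSubmodule (Fin N) ℂ n →ₗ[ℂ] homogeneousSubmodule (Fin N) ℂ n :=
    f.restrict hf
  have hinj' : Function.Injective f' := by
    rw [injective_iff_map_eq_zero]
    intro p hp
    exact Subtype.ext (hinj p.1 p.2 (congrArg Subtype.val hp))
  let e := LinearEquiv.ofInjectiveEndo f' hinj'
  let π : Poly N →ₗ[ℂ] homogeneousSubmodule (Fin N) ℂ n :=
    (homogeneousComponent n).codRestrict _ fun p => homogeneousComponent_isHomogeneous n p
  refine ⟨(homogeneousSubmodule (Fin N) ℂ n).subtype ∘ₗ e.symm.toLinearMap ∘ₗ π,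
    fun p hp => ⟨(e.symm (π p)).2, ?_⟩⟩
  have h1 : e (e.symm (π p)) = π p := e.apply_symm_apply _
  have h2 : f (e.symm (π p)).1 = (π p).1 := congrArg Subtype.val h1
  have h3 : (π p).1 = p := homogeneousComponent_eq_self hp
  rw [← h3]
  simpa [h3] using h2

theorem exists_eulerOp_inverse {P : Finset (E N)} {k : E N → ℝ} (hP : IsPositiveSystem P k)
    (n : ℕ) : ∃ g : Poly N →ₗ[ℂ] Poly N, ∀ p : Poly N, p.IsHomogeneous (n + 1) →
      (g p).IsHomogeneous (n + 1) ∧ eulerOp P k (n + 1) (g p) = p :=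
  exists_homogeneous_preimage (eulerLin P k (n + 1)) (fun _ hp => isHomogeneous_eulerOp P k hp)
    fun _ _ h => eulerOp_injective hP n.succ_ne_zero h

/-- A family of polynomials `r_j` which satisfies the vector-valued analogue of
`n r + ∑ k(α) (r - σ_α r) = 0` vanishes. -/
theorem vector_eulerOp_injective {P : Finset (E N)} {k : E N → ℝ} (hP : IsPositiveSystem P k)
    {n : ℕ} (hn : n ≠ 0) (r : Fin N → Poly N)
    (h : ∀ j, eulerOp P k n (r j) +
      ∑ α ∈ P, C (k α * α j : ℂ) * reflPoly α (∑ i, C (α i : ℂ) * r i) = 0) (j : Fin N) :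
    r j = 0 := by
  refine poly_eq_zero_of_eval_CE fun z => ?_
  let F : CE N → CE N := fun z => WithLp.toLp 2 fun j => MvPolynomial.eval z.ofLp (r j)
  have hF : Continuous F :=
    (PiLp.continuous_toLp 2 _).comp (continuous_pi fun j => continuous_eval_CE (r j))
  -- For the vector F = (r_j) the system reads nF + ∑ k(α)(F - σ_α F∘σ_α) = 0. Letting σ_α act
  -- isometrically on the values also accounts for the extra sum.
  have := max_principle hP (n := n) (h := F) (C := 0)
    (r := ‖z‖) hF reflC (fun α hα v => norm_reflC α (hP.dot_self α hα) v) (by positivity)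
    (fun y _ => by
      rw [norm_le_zero_iff]
      ext j
      have hj := congrArg (MvPolynomial.eval y.ofLp) (h j)
      rw [map_add, eval_eulerOp, map_sum, map_zero, add_assoc, ← Finset.sum_add_distrib] at hj
      simp only [PiLp.add_apply, PiLp.smul_apply, WithLp.ofLp_sum, Finset.sum_apply,
        PiLp.sub_apply, reflC_apply, PiLp.zero_apply]
      rw [← hj]
      congr 1
      refine Finset.sum_congr rfl fun α _ => ?_
      simp only [F, map_mul, eval_C, eval_reflPoly, map_sum, Complex.real_smul]
      ring) le_rfl
  have hn' : (0 : ℝ) < n := by positivity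
  have h0 : ‖F z‖ ≤ 0 := by
    by_contra hcon
    push Not at hcon
    have := mul_pos hn' hcon
    linarith
  have h1 : F z = 0 := by simpa using h0
  exact congrArg (fun v : CE N => v j) h1

/-- The solution of the system `T_i q = q_i` for a closed family `q_i`. -/
theorem TPoly_eq_of_eulerOp_eq {P : Finset (E N)} {k : E N → ℝ} (hP : IsPositiveSystem P k)
    {n : ℕ} (q : Poly N) (u : Fin N → Poly N)
    (hu : ∀ i, (u i).IsHomogeneous n) (hclosed : ∀ i j, TPoly P k j (u i) = TPoly P k i (u j))
    (h : eulerOp P k (n + 1) q = ∑ i, X i * u i) (j : Fin N) : TPoly P k j q = u j := by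
  -- Closedness turns ∑ x_i T_j u_i into ∑ x_i T_i u_j = E_n u_j, and the term δ_ij of the product
  -- rule raises n to n + 1.
  have h1 : ∀ j, TPoly P k j (∑ i, X i * u i) = eulerOp P k (n + 1) (u j) +
      ∑ α ∈ P, C (k α * α j : ℂ) * reflPoly α (∑ i, C (α i : ℂ) * u i) := by
    intro j
    simp only [map_sum, TPoly_X_mul hP, Finset.sum_add_distrib]
    have e1 : ∑ i, X i * TPoly P k j (u i) = eulerOp P k n (u j) := by
      rw [← sum_X_mul_TPoly hP.dot_self (hu j)]
      exact Finset.sum_congr rfl fun i _ => by rw [hclosed]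
    have e2 : ∑ i, (if j = i then u i else 0) = u j := by simp
    rw [e1, e2, Finset.sum_comm]
    congr 1
    · simp only [eulerOp, Nat.cast_add, Nat.cast_one, C_add, C_1]
      ring
    · refine Finset.sum_congr rfl fun α _ => ?_
      rw [← Finset.mul_sum]
      simp [map_mul]
  -- The families T_j q and u_j satisfy the same inhomogeneous vector system, so their difference
  -- solves the homogeneous one.
  have h2 : ∀ j, TPoly P k j q - u j = 0 := by
    refine vector_eulerOp_injective hP n.succ_ne_zero _ fun j => ?_
    have h3 := TPoly_eulerOp hP j (n + 1) q
    rw [h, h1] at h3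
    have e1 : eulerOp P k (n + 1) (TPoly P k j q - u j) =
        eulerOp P k (n + 1) (TPoly P k j q) - eulerOp P k (n + 1) (u j) :=
      (eulerLin P k (n + 1)).map_sub _ _
    rw [e1]
    simp only [mul_sub, Finset.sum_sub_distrib, map_sub]
    linear_combination -h3
  exact sub_eq_zero.1 (h2 j)

theorem pderiv_comm (i j : Fin N) (p : Poly N) :
    MvPolynomial.pderiv i (MvPolynomial.pderiv j p) =
      MvPolynomial.pderiv j (MvPolynomial.pderiv i p) := by
  ext m
  simp only [coeff_pderiv, add_right_comm m]
  by_cases h : i = j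
  · subst h; rfl
  · simp [h, Ne.symm h]
    ring

/-- The restriction of the intertwining operator to homogeneous polynomials of degree `n`. -/
theorem exists_intertwiner_components {P : Finset (E N)} {k : E N → ℝ}
    (hP : IsPositiveSystem P k) : ∃ W : ℕ → Poly N →ₗ[ℂ] Poly N, (∀ c, W 0 (C c) = C c) ∧
      (∀ n p, p.IsHomogeneous n → (W n p).IsHomogeneous n) ∧
      ∀ n p, p.IsHomogeneous (n + 1) → ∀ i,
        TPoly P k i (W (n + 1) p) = W n (MvPolynomial.pderiv i p) := by
  choose B hB using exists_eulerOp_inverse hP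
  -- The recursion is forced: the intertwining property gives E_{n+1} W p = ∑ x_i T_i W p = ∑ x_i W
  -- ∂_i p, and B n inverts E_{n+1}.
  obtain ⟨W, hW0, hW⟩ : ∃ W : ℕ → Poly N →ₗ[ℂ] Poly N, W 0 = LinearMap.id ∧
      ∀ n p, W (n + 1) p = B n (∑ i, X i * W n (MvPolynomial.pderiv i p)) :=
    ⟨fun n => Nat.rec LinearMap.id (fun n Wn => B n ∘ₗ ∑ i, LinearMap.mulLeft ℂ (X i) ∘ₗ Wn ∘ₗ
      (MvPolynomial.pderiv i).toLinearMap) n, rfl, fun n p => by simp⟩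
  have hhom : ∀ n p, p.IsHomogeneous n → (W n p).IsHomogeneous n := by
    intro n
    induction n with
    | zero => intro p hp; simpa [hW0] using hp
    | succ n ih =>
      intro p hp
      rw [hW]
      refine (hB n _ (IsHomogeneous.sum _ _ _ fun i _ => ?_)).1
      rw [add_comm]
      exact (isHomogeneous_X ℂ i).mul (ih _ hp.pderiv)
  refine ⟨W, fun c => by rw [hW0]; rfl, hhom, fun n => ?_⟩
  induction n with
  | zero =>
    intro p hp i
    have hp' : ∀ i, (W 0 (MvPolynomial.pderiv i p)).IsHomogeneous 0 := fun i =>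
      hhom 0 _ hp.pderiv
    refine TPoly_eq_of_eulerOp_eq hP _ (fun i => W 0 (MvPolynomial.pderiv i p)) hp'
      (fun i j => ?_) ?_ i
    · have h0 : ∀ i j, TPoly P k j (W 0 (MvPolynomial.pderiv i p)) = 0 := fun i j => by
        have := hp' i
        rw [← totalDegree_zero_iff_isHomogeneous, totalDegree_eq_zero_iff_eq_C] at this
        rw [this, TPoly_C hP.dot_self]
      rw [h0, h0]
    · rw [hW]
      refine (hB 0 _ (IsHomogeneous.sum _ _ _ fun i _ => ?_)).2
      rw [mul_comm]
      exact (hp' i).mul (isHomogeneous_X ℂ i)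
  | succ n ih =>
    intro p hp i
    have hp' : ∀ i, (W (n + 1) (MvPolynomial.pderiv i p)).IsHomogeneous (n + 1) := fun i =>
      hhom (n + 1) _ hp.pderiv
    refine TPoly_eq_of_eulerOp_eq hP _ (fun i => W (n + 1) (MvPolynomial.pderiv i p)) hp'
      (fun i j => ?_) ?_ i
    -- Closedness follows from the previous degree and ∂_i∂_j = ∂_j∂_i; commutativity of the Dunkl
    -- operators is not needed.
    · have h1 := ih (MvPolynomial.pderiv i p) hp.pderiv j
      have h2 := ih (MvPolynomial.pderiv j p) hp.pderiv i
      rw [pderiv_comm i j] at h2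
      exact h1.trans h2.symm
    · rw [hW]
      refine (hB (n + 1) _ (IsHomogeneous.sum _ _ _ fun i _ => ?_)).2
      rw [mul_comm]
      exact (hp' i).mul (isHomogeneous_X ℂ i)

end

section

open MvPolynomial

/-! ### Polynomial functions -/

/-- A real vector as a vector of the Hermitian space `ℂ^N`. -/
def toCE (x : E N) : CE N := WithLp.toLp 2 (toC x)

theorem norm_toCE (x : E N) : ‖toCE x‖ = ‖x‖ := by
  rw [EuclideanSpace.norm_eq, EuclideanSpace.norm_eq]
  simp [toCE, toC]

theorem inner_eq_dot (α x : E N) : ⟪α, x⟫ = dot α x := by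
  simp [PiLp.inner_apply, dot, mul_comm]

theorem norm_sq_eq_dot (α : E N) : ‖α‖ ^ 2 = dot α α := by
  rw [← inner_eq_dot, real_inner_self_eq_norm_sq]

theorem refl_apply (α x : E N) (hα : dot α α = 2) : refl α x = reflVec α x := by
  rw [refl, Submodule.reflection_orthogonal_apply, Submodule.reflection_singleton_apply,
    inner_eq_dot]
  have : ((‖α‖ : ℝ) ^ 2) = 2 := by rw [norm_sq_eq_dot, hα]
  simp only [RCLike.ofReal_real_eq_id, id_eq, this, reflVec, dot_comm x α]
  module

theorem toCE_reflVec (α x : E N) : toCE (reflVec α x) = reflC α (toCE x) := by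
  ext i
  simp [toCE, toC, reflC_apply, reflVec, dot, mul_comm]

theorem polyFun_apply (p : Poly N) (x : E N) :
    polyFun p x = MvPolynomial.eval (toCE x).ofLp p := rfl

theorem polyFun_reflPoly (α : E N) (p : Poly N) (x : E N) :
    polyFun (reflPoly α p) x = polyFun p (reflVec α x) := by
  rw [polyFun_apply, polyFun_apply, eval_reflPoly, toCE_reflVec]

theorem polyFun_injective {p q : Poly N} (h : polyFun p = polyFun q) : p = q := by
  refine MvPolynomial.funext_set (s := fun _ => Set.range ((↑) : ℝ → ℂ))
    (fun i => Set.infinite_range_of_injective Complex.ofReal_injective) fun x hx => ?_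
  choose y hy using fun i => hx i (Set.mem_univ i)
  have := congrFun h (WithLp.toLp 2 y)
  have e : toC (WithLp.toLp 2 y) = x := funext fun i => by simp [toC, hy i]
  simpa [polyFun, e] using this

/-- The derivative of the coordinate functions. -/
def coordC (i : Fin N) : E N →L[ℝ] ℂ := Complex.ofRealCLM ∘L EuclideanSpace.proj i

theorem coordC_apply (i : Fin N) (v : E N) : coordC i v = v i := rfl

theorem hasFDerivAt_polyFun (p : Poly N) (x : E N) :
    HasFDerivAt (polyFun p) (∑ i, polyFun (MvPolynomial.pderiv i p) x • coordC i) x := by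
  induction p using MvPolynomial.induction_on with
  | C a =>
    have : polyFun (C a : Poly N) = fun _ => a := by ext; simp [polyFun]
    rw [this]
    refine (hasFDerivAt_const a x).congr_fderiv ?_
    simp only [polyFun, pderiv_C, map_zero]
    exact (Finset.sum_eq_zero fun i _ => zero_smul ℂ (coordC i)).symm
  | add p q hp hq =>
    have : polyFun (p + q) = fun x => polyFun p x + polyFun q x := by ext; simp [polyFun]
    rw [this]
    refine (hp.add hq).congr_fderiv ?_
    rw [← Finset.sum_add_distrib]
    exact Finset.sum_congr rfl fun i _ => by rw [← add_smul]; simp [polyFun]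
  | mul_X p m hp =>
    have : polyFun (p * X m) = fun x => polyFun p x * coordC m x := by
      ext; simp [polyFun, coordC_apply, toC]
    rw [this]
    refine (hp.mul (coordC m).hasFDerivAt).congr_fderiv ?_
    ext v
    classical
    simp only [add_apply, smul_apply,
      sum_apply, coordC_apply, smul_eq_mul, polyFun, pderiv_mul, pderiv_X,
      map_add, map_mul, eval_X, add_mul, Finset.sum_add_distrib, Finset.mul_sum]
    rw [add_comm]
    congr 1
    · exact Finset.sum_congr rfl fun j _ => by simp only [toC]; ring
    · rw [Finset.sum_eq_single m]
      · simp
      · intro j _ hj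
        simp [hj.symm]
      · simp

theorem fderiv_polyFun (p : Poly N) (x v : E N) :
    fderiv ℝ (polyFun p) x v = ∑ i, (v i : ℂ) * polyFun (MvPolynomial.pderiv i p) x := by
  rw [(hasFDerivAt_polyFun p x).fderiv]
  simp [coordC_apply, mul_comm]

theorem pderiv_polyFun (i : Fin N) (p : Poly N) :
    pderiv i (polyFun p) = polyFun (MvPolynomial.pderiv i p) := by
  ext x
  rw [pderiv, fderiv_polyFun, Finset.sum_eq_single i] <;> simp +contextual

/-- On its hyperplane the difference quotient is a directional derivative. -/
theorem eval_divDiff_of_eq_zero (α : E N) (hα : dot α α = 2) (p : Poly N) (z : CE N)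
    (hz : ∑ j, (α j : ℂ) * z j = 0) :
    MvPolynomial.eval z.ofLp (divDiff α p) =
      ∑ i, (α i : ℂ) * MvPolynomial.eval z.ofLp (MvPolynomial.pderiv i p) := by
  have hσ : reflC α z = z := by simp [reflC, hz]
  have h2 : ∑ i, (α i : ℂ) * α i = 2 := by exact_mod_cast congrArg ((↑) : ℝ → ℂ) hα
  have h : ∀ i, MvPolynomial.eval z.ofLp (MvPolynomial.pderiv i (linForm α * divDiff α p)) =
      α i * MvPolynomial.eval z.ofLp (divDiff α p) := by
    intro i
    have hl : MvPolynomial.pderiv i (linForm α) = C (α i : ℂ) := by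
      classical
      simp only [linForm, map_sum, pderiv_C_mul, pderiv_X, Pi.single_apply]
      simp
    rw [pderiv_mul, hl, map_add, map_mul, map_mul, eval_linForm, hz, eval_C]
    ring
  have h' : ∀ i, (α i : ℂ) * MvPolynomial.eval z.ofLp (divDiff α p) =
      α i * ∑ j, (α j : ℂ) * MvPolynomial.eval z.ofLp (MvPolynomial.pderiv j p) := by
    intro i
    -- Differentiate ⟨α, ·⟩ · (difference quotient) = p - p∘σ_α at the fixed point z of σ_α.
    -- Contracting the result with α then leaves the common factor |α|² = 2.
    rw [← h, linForm_mul_divDiff α hα, map_sub, pderiv_reflPoly, map_sub, eval_reflPoly, hσ]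
    simp
  have h3 : ∑ i, (α i : ℂ) * (α i * MvPolynomial.eval z.ofLp (divDiff α p)) =
      ∑ i, (α i : ℂ) *
        (α i * ∑ j, (α j : ℂ) * MvPolynomial.eval z.ofLp (MvPolynomial.pderiv j p)) :=
    Finset.sum_congr rfl fun i _ => by rw [h']
  simp only [← mul_assoc, ← Finset.sum_mul, h2] at h3
  exact mul_left_cancel₀ two_ne_zero h3

theorem inner_eq_sum_toCE (α x : E N) : ((⟪α, x⟫ : ℝ) : ℂ) = ∑ j, (α j : ℂ) * toCE x j := by
  rw [inner_eq_dot]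
  simp [dot, toCE, toC]

theorem diffQuot_polyFun (α : E N) (hα : dot α α = 2) (p : Poly N) :
    diffQuot α (polyFun p) = polyFun (divDiff α p) := by
  ext x
  rw [diffQuot]
  split_ifs with h
  · rw [fderiv_polyFun, polyFun_apply, eval_divDiff_of_eq_zero α hα p _
      (by rw [← inner_eq_sum_toCE, h]; simp)]
    rfl
  · have h' : ((⟪α, x⟫ : ℝ) : ℂ) ≠ 0 := by exact_mod_cast h
    rw [div_eq_iff h', refl_apply α x hα, ← polyFun_reflPoly]
    have := congrArg (fun q => polyFun q x) (linForm_mul_divDiff α hα p)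
    simp only [polyFun_apply, map_mul, map_sub, eval_linForm] at this ⊢
    rw [inner_eq_sum_toCE, ← this, mul_comm]

theorem T_polyFun {P : Finset (E N)} (hP : ∀ α ∈ P, dot α α = 2) (k : E N → ℝ) (i : Fin N)
    (p : Poly N) : T P k i (polyFun p) = polyFun (TPoly P k i p) := by
  ext x
  rw [T, TPoly_apply, pderiv_polyFun, Finset.sum_congr rfl fun α hα => by
    rw [diffQuot_polyFun α (hP α hα)]]
  simp [polyFun]

/-! ### Entire series of homogeneous polynomials -/

/-- A series of homogeneous polynomials that converges normally on bounded subsets of `ℂ^N`. -/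
structure IsEntireSeries (Q : ℕ → Poly N) : Prop where
  homogeneous : ∀ n, (Q n).IsHomogeneous n
  bound : ∀ r : ℝ, ∃ B : ℕ → ℝ, Summable B ∧
    ∀ n (z : CE N), ‖z‖ ≤ r → ‖MvPolynomial.eval z.ofLp (Q n)‖ ≤ B n

/-- The sum of a series of polynomials as a function on `ℝ^N`. -/
def seriesFun (Q : ℕ → Poly N) : E N → ℂ := fun x => ∑' n, polyFun (Q n) x

/-! ### Cauchy estimates and the termwise action of the Dunkl operators. -/

theorem hasDerivAt_eval_line (p : Poly N) (z v : CE N) (ζ : ℂ) :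
    HasDerivAt (fun ζ : ℂ => MvPolynomial.eval (z + ζ • v).ofLp p)
      (∑ i, v i * MvPolynomial.eval (z + ζ • v).ofLp (MvPolynomial.pderiv i p)) ζ := by
  induction p using MvPolynomial.induction_on with
  | C a => simpa using hasDerivAt_const ζ a
  | add p q hp hq => 
    refine ((hp.add hq).congr_deriv ?_).congr_of_eventuallyEq
      (Filter.Eventually.of_forall fun ζ => ?_)
    · simp [mul_add, Finset.sum_add_distrib]
    · simp
  | mul_X p m hp =>
    have h1 : HasDerivAt (fun ζ : ℂ => z m + ζ * v m) (v m) ζ := by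
      simpa using ((hasDerivAt_id ζ).mul_const (v m)).const_add (z m)
    have := hp.mul h1
    refine (this.congr_deriv ?_).congr_of_eventuallyEq (Filter.Eventually.of_forall fun ζ => ?_)
    · classical
      simp only [pderiv_mul, pderiv_X, map_add, map_mul, eval_X, mul_add (v _),
        Finset.sum_add_distrib]
      congr 1
      · rw [Finset.sum_mul]
        exact Finset.sum_congr rfl fun j _ => by
          simp only [PiLp.add_apply, PiLp.smul_apply, smul_eq_mul]
          ring
      · rw [Finset.sum_eq_single m]
        · simp; ring
        · intro j _ hj
          simp [hj.symm]
        · simp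
    · simp

/-- Cauchy's estimate on the complex line ζ ↦ z + ζv. The circle of radius 1/‖v‖ corresponds to
displacements of norm one, which is why the radius grows by exactly 1. -/
theorem norm_sum_pderiv_le {p : Poly N} {r B : ℝ}
    (h : ∀ z : CE N, ‖z‖ ≤ r + 1 → ‖MvPolynomial.eval z.ofLp p‖ ≤ B) {z : CE N} (hz : ‖z‖ ≤ r)
    (v : CE N) :
    ‖∑ i, v i * MvPolynomial.eval z.ofLp (MvPolynomial.pderiv i p)‖ ≤ B * ‖v‖ := by
  rcases eq_or_ne v 0 with rfl | hv
  · simp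
  have hv' : 0 < ‖v‖ := norm_pos_iff.2 hv
  have hd := hasDerivAt_eval_line p z v
  have := Complex.norm_deriv_le_of_forall_mem_sphere_norm_le (c := (0 : ℂ)) (R := ‖v‖⁻¹) (C := B)
    (f := fun ζ : ℂ => MvPolynomial.eval (z + ζ • v).ofLp p) (by positivity)
    (Differentiable.diffContOnCl fun ζ => (hd ζ).differentiableAt)
    (fun ζ hζ => h _ (by
      refine (norm_add_le _ _).trans (add_le_add hz ?_)
      rw [norm_smul, mem_sphere_zero_iff_norm.1 hζ, inv_mul_cancel₀ hv'.ne']))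
  rw [(hd 0).deriv] at this
  simpa using this

theorem norm_eval_pderiv_le {p : Poly N} {r B : ℝ}
    (h : ∀ z : CE N, ‖z‖ ≤ r + 1 → ‖MvPolynomial.eval z.ofLp p‖ ≤ B) {z : CE N} (hz : ‖z‖ ≤ r)
    (i : Fin N) : ‖MvPolynomial.eval z.ofLp (MvPolynomial.pderiv i p)‖ ≤ B := by
  have := norm_sum_pderiv_le h hz (EuclideanSpace.single i 1)
  rw [Finset.sum_eq_single i] at this
  · simpa using this
  · intro j _ hj
    simp [hj]
  · simp

theorem norm_toCE_of_dot (α : E N) (hα : dot α α = 2) : ‖toCE α‖ ≤ 2 := by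
  rw [norm_toCE]
  have : ‖α‖ ^ 2 = 2 := by rw [norm_sq_eq_dot, hα]
  nlinarith [norm_nonneg α]

/-- Off the hyperplane the mean value inequality applies on the segment from z to σ_α z, which stays
in the ball by convexity. On the hyperplane the quotient is itself a directional derivative. The
factor 2 bounds ‖α‖ = √2. -/
theorem norm_eval_divDiff_le (α : E N) (hα : dot α α = 2) {p : Poly N} {r B : ℝ}
    (h : ∀ z : CE N, ‖z‖ ≤ r + 1 → ‖MvPolynomial.eval z.ofLp p‖ ≤ B) {z : CE N} (hz : ‖z‖ ≤ r) :
    ‖MvPolynomial.eval z.ofLp (divDiff α p)‖ ≤ 2 * B := by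
  have hB : 0 ≤ B := (norm_nonneg _).trans (h z (by linarith))
  have hder : ∀ y : CE N, ‖y‖ ≤ r →
      ‖∑ i, toCE α i * MvPolynomial.eval y.ofLp (MvPolynomial.pderiv i p)‖ ≤ 2 * B := by
    intro y hy
    refine (norm_sum_pderiv_le h hy _).trans ?_
    rw [mul_comm 2]
    exact mul_le_mul_of_nonneg_left (norm_toCE_of_dot α hα) hB
  set c := ∑ j, (α j : ℂ) * z j with hc
  by_cases h0 : c = 0
  · rw [eval_divDiff_of_eq_zero α hα p z (by rw [← hc, h0])]
    exact hder z hz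
  have hmv : ‖MvPolynomial.eval (z + (-c) • toCE α).ofLp p -
      MvPolynomial.eval (z + (0 : ℂ) • toCE α).ofLp p‖ ≤ 2 * B * ‖-c - 0‖ := by
    refine (convex_segment (𝕜 := ℝ) (0 : ℂ) (-c)).norm_image_sub_le_of_norm_hasDerivWithin_le
      (f := fun ζ : ℂ => MvPolynomial.eval (z + ζ • toCE α).ofLp p)
      (fun ζ _ => (hasDerivAt_eval_line p z (toCE α) ζ).hasDerivWithinAt) (fun ζ hζ => ?_)
      (left_mem_segment ℝ _ _) (right_mem_segment ℝ _ _)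
    refine hder _ ?_
    obtain ⟨a, b, ha, hb, hab, rfl⟩ := hζ
    have e : z + (a • (0 : ℂ) + b • -c) • toCE α = (a : ℂ) • z + (b : ℂ) • reflC α z := by
      have : (a : ℂ) = 1 - b := by rw [eq_sub_iff_add_eq]; exact_mod_cast hab
      rw [reflC, ← hc, this]
      simp only [smul_zero, zero_add, smul_sub, sub_smul, one_smul, Complex.real_smul, mul_neg,
        neg_smul, mul_smul, toCE]
      abel
    rw [e]
    refine (norm_add_le _ _).trans ?_
    rw [norm_smul, norm_smul, norm_reflC α hα, Complex.norm_real, Complex.norm_real,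
      Real.norm_of_nonneg ha, Real.norm_of_nonneg hb, ← add_mul, hab, one_mul]
    exact hz
  have hq := congrArg (MvPolynomial.eval z.ofLp) (linForm_mul_divDiff α hα p)
  rw [map_mul, map_sub, eval_linForm, eval_reflPoly, ← hc] at hq
  have e1 : z + (-c) • toCE α = reflC α z := by
    rw [reflC, ← hc, neg_smul, sub_eq_add_neg]; rfl
  rw [e1, zero_smul, add_zero, sub_zero, norm_neg, norm_sub_rev, ← hq, norm_mul,
    mul_comm] at hmv
  exact le_of_mul_le_mul_right hmv (norm_pos_iff.2 h0)

theorem norm_eval_TPoly_le {P : Finset (E N)} (hP : ∀ α ∈ P, dot α α = 2) (k : E N → ℝ)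
    (i : Fin N) {p : Poly N} {r B : ℝ}
    (h : ∀ z : CE N, ‖z‖ ≤ r + 1 → ‖MvPolynomial.eval z.ofLp p‖ ≤ B) {z : CE N} (hz : ‖z‖ ≤ r) :
    ‖MvPolynomial.eval z.ofLp (TPoly P k i p)‖ ≤ (1 + ∑ α ∈ P, |k α * α i| * 2) * B := by
  rw [TPoly_apply, map_add, map_sum, add_mul, one_mul, Finset.sum_mul]
  refine (norm_add_le _ _).trans (add_le_add (norm_eval_pderiv_le h hz i)
    (norm_sum_le_of_le _ fun α hα => ?_))
  rw [map_mul, eval_C, norm_mul, mul_assoc, ← Complex.ofReal_mul, Complex.norm_real,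
    Real.norm_eq_abs]
  exact mul_le_mul_of_nonneg_left (norm_eval_divDiff_le α (hP α hα) h hz) (abs_nonneg _)

theorem IsEntireSeries.summable {Q : ℕ → Poly N} (hQ : IsEntireSeries Q) (x : E N) :
    Summable fun n => ‖polyFun (Q n) x‖ := by
  obtain ⟨B, hB, h⟩ := hQ.bound ‖x‖
  exact Summable.of_nonneg_of_le (fun _ => norm_nonneg _)
    (fun n => h n (toCE x) (norm_toCE x).le) hB

/-- The shift restores the convention that the n-th term has degree n. The term lost, T_i Q_0, is
zero. -/
theorem IsEntireSeries.TPoly_succ {Q : ℕ → Poly N} (hQ : IsEntireSeries Q) {P : Finset (E N)}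
    (hP : ∀ α ∈ P, dot α α = 2) (k : E N → ℝ) (i : Fin N) :
    IsEntireSeries fun n => TPoly P k i (Q (n + 1)) where
  homogeneous n := isHomogeneous_TPoly hP i (hQ.homogeneous (n + 1))
  bound r := by
    obtain ⟨B, hB, h⟩ := hQ.bound (r + 1)
    exact ⟨fun n => (1 + ∑ α ∈ P, |k α * α i| * 2) * B (n + 1),
      ((summable_nat_add_iff 1).2 hB).mul_left _,
      fun n z hz => norm_eval_TPoly_le hP k i (h (n + 1)) hz⟩

theorem IsEntireSeries.hasFDerivAt {Q : ℕ → Poly N} (hQ : IsEntireSeries Q) (x : E N) :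
    HasFDerivAt (seriesFun Q)
      (∑' n, ∑ i, polyFun (MvPolynomial.pderiv i (Q n)) x • coordC i : E N →L[ℝ] ℂ) x ∧
    Summable fun n => (∑ i, polyFun (MvPolynomial.pderiv i (Q n)) x • coordC i : E N →L[ℝ] ℂ) := by
  set r := ‖x‖ + 1
  obtain ⟨B, hB, h⟩ := hQ.bound (r + 1)
  have hbd : ∀ n, ∀ y ∈ Metric.ball (0 : E N) r,
      ‖(∑ i, polyFun (MvPolynomial.pderiv i (Q n)) y • coordC i : E N →L[ℝ] ℂ)‖ ≤ B n := by
    intro n y hy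
    have hy' : ‖toCE y‖ ≤ r := by rw [norm_toCE]; exact (mem_ball_zero_iff.1 hy).le
    refine ContinuousLinearMap.opNorm_le_bound _
      ((norm_nonneg _).trans (h n (toCE y) (by linarith))) fun v => ?_
    have := norm_sum_pderiv_le (h n) hy' (toCE v)
    rw [norm_toCE] at this
    refine le_trans (le_of_eq ?_) this
    congr 1
    simp only [sum_apply, smul_apply, coordC_apply,
      smul_eq_mul, polyFun_apply]
    exact Finset.sum_congr rfl fun i _ => mul_comm _ _
  have hx : x ∈ Metric.ball (0 : E N) r := by simp [r]
  exact ⟨hasFDerivAt_tsum_of_isPreconnected hB Metric.isOpen_ball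
    (convex_ball (0 : E N) r).isPreconnected (fun n y _ => hasFDerivAt_polyFun (Q n) y) hbd hx
    (hQ.summable x).of_norm hx, Summable.of_norm_bounded hB fun n => hbd n x hx⟩

theorem IsEntireSeries.hasSum_fderiv {Q : ℕ → Poly N} (hQ : IsEntireSeries Q) (x v : E N) :
    HasSum (fun n => ∑ i, (v i : ℂ) * polyFun (MvPolynomial.pderiv i (Q n)) x)
      (fderiv ℝ (seriesFun Q) x v) := by
  obtain ⟨h1, h2⟩ := hQ.hasFDerivAt x
  rw [h1.fderiv]
  have := (ContinuousLinearMap.apply ℝ ℂ v).hasSum h2.hasSum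
  simpa [coordC_apply, mul_comm] using this

theorem IsEntireSeries.hasSum_diffQuot {Q : ℕ → Poly N} (hQ : IsEntireSeries Q) (α : E N)
    (hα : dot α α = 2) (x : E N) :
    HasSum (fun n => polyFun (divDiff α (Q n)) x) (diffQuot α (seriesFun Q) x) := by
  simp only [← diffQuot_polyFun α hα]
  rw [diffQuot]
  by_cases h : ⟪α, x⟫ = 0
  · simp only [diffQuot, if_pos h, fderiv_polyFun]
    exact hQ.hasSum_fderiv x α
  · simp only [diffQuot, if_neg h]
    exact ((hQ.summable x).of_norm.hasSum.sub (hQ.summable (refl α x)).of_norm.hasSum).div_const _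

theorem IsEntireSeries.T_seriesFun {Q : ℕ → Poly N} (hQ : IsEntireSeries Q) {P : Finset (E N)}
    (hP : ∀ α ∈ P, dot α α = 2) (k : E N → ℝ) (i : Fin N) :
    T P k i (seriesFun Q) = seriesFun fun n => TPoly P k i (Q (n + 1)) := by
  ext x
  have h1 : HasSum (fun n => polyFun (TPoly P k i (Q n)) x) (T P k i (seriesFun Q) x) := by
    simp only [← T_polyFun hP k i]
    refine HasSum.add ?_ (hasSum_sum fun α hα => HasSum.mul_left _ ?_)
    · simp only [pderiv, fderiv_polyFun]
      exact hQ.hasSum_fderiv x _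
    · simp only [diffQuot_polyFun α (hP α hα)]
      exact hQ.hasSum_diffQuot α (hP α hα) x
  rw [← h1.tsum_eq, h1.summable.tsum_eq_zero_add, seriesFun]
  have h0 : TPoly P k i (Q 0) = 0 := by
    have := hQ.homogeneous 0
    rw [← totalDegree_zero_iff_isHomogeneous, totalDegree_eq_zero_iff_eq_C] at this
    rw [this, TPoly_C hP]
  simp [h0, polyFun]

theorem IsEntireSeries.mul {Q Q' : ℕ → Poly N} (hQ : IsEntireSeries Q) (hQ' : IsEntireSeries Q') :
    IsEntireSeries fun n => ∑ ab ∈ Finset.HasAntidiagonal.antidiagonal n, Q ab.1 * Q' ab.2 where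
  homogeneous n := IsHomogeneous.sum _ _ _ fun ab hab => by
    rw [← Finset.HasAntidiagonal.mem_antidiagonal.1 hab]
    exact (hQ.homogeneous _).mul (hQ'.homogeneous _)
  bound r := by
    obtain ⟨B, hB, h⟩ := hQ.bound r
    obtain ⟨B', hB', h'⟩ := hQ'.bound r
    refine ⟨fun n => ∑ ab ∈ Finset.HasAntidiagonal.antidiagonal n, ‖B ab.1‖ * ‖B' ab.2‖, ?_, fun n z hz => ?_⟩
    · have := summable_norm_sum_mul_antidiagonal_of_summable_norm (f := fun n => ‖B n‖)
        (g := fun n => ‖B' n‖) (by simpa using hB.norm) (by simpa using hB'.norm)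
      exact this.of_norm
    · rw [map_sum]
      refine norm_sum_le_of_le _ fun ab _ => ?_
      rw [map_mul, norm_mul]
      exact mul_le_mul ((h _ z hz).trans (le_abs_self _)) ((h' _ z hz).trans (le_abs_self _))
        (norm_nonneg _) (norm_nonneg _)

theorem seriesFun_mul {Q Q' : ℕ → Poly N} (hQ : IsEntireSeries Q) (hQ' : IsEntireSeries Q') :
    seriesFun (fun n => ∑ ab ∈ Finset.HasAntidiagonal.antidiagonal n, Q ab.1 * Q' ab.2) =
      fun x => seriesFun Q x * seriesFun Q' x := by
  ext x
  simp only [seriesFun]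
  rw [tsum_mul_tsum_eq_tsum_sum_antidiagonal_of_summable_norm (hQ.summable x) (hQ'.summable x)]
  simp [polyFun]

end

section

open MvPolynomial

/-! ### The intertwining operator -/

theorem poly_linearMap_eq {f g : Poly N →ₗ[ℂ] Poly N}
    (h : ∀ n p, p.IsHomogeneous n → f p = g p) (p : Poly N) : f p = g p := by
  rw [← sum_homogeneousComponent p, map_sum, map_sum]
  exact Finset.sum_congr rfl fun n _ => h n _ (homogeneousComponent_isHomogeneous n p)

theorem exists_isIntertwiner {P : Finset (E N)} {k : E N → ℝ} (hP : IsPositiveSystem P k) :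
    ∃ V, IsIntertwiner P k V := by
  obtain ⟨W, h0, hhom, hT⟩ := exists_intertwiner_components hP
  let V : Poly N →ₗ[ℂ] Poly N :=
    (basisMonomials (Fin N) ℂ).constr ℂ fun m => W m.degree (monomial m 1)
  have hVmon : ∀ m c, V (monomial m c) = W m.degree (monomial m c) := by
    intro m c
    have h1 : V (monomial m 1) = W m.degree (monomial m 1) := by
      have := (basisMonomials (Fin N) ℂ).constr_basis ℂ
        (fun m => W m.degree (monomial m 1)) m
      simpa [coe_basisMonomials] using this
    have h2 : (monomial m c : Poly N) = c • monomial m 1 := by simp [smul_monomial]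
    rw [h2, map_smul, map_smul, h1]
  have hV : ∀ n p, p.IsHomogeneous n → V p = W n p := by
    intro n p hp
    rw [p.as_sum, map_sum, map_sum]
    refine Finset.sum_congr rfl fun m hm => ?_
    rw [hVmon]
    congr 1
    by_contra hne
    exact (mem_support_iff.1 hm) (hp.coeff_eq_zero fun h => hne (by rw [h]))
  have hVhom : ∀ n p, p.IsHomogeneous n → (V p).IsHomogeneous n := fun n p hp => by
    rw [hV n p hp]; exact hhom n p hp
  have hVC : ∀ c, V (C c) = C c := fun c => by rw [hV 0 _ (isHomogeneous_C _ c), h0]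
  have hVT : ∀ i p, TPoly P k i (V p) = V (MvPolynomial.pderiv i p) := by
    intro i p
    refine poly_linearMap_eq (f := TPoly P k i ∘ₗ V)
      (g := V ∘ₗ (MvPolynomial.pderiv i).toLinearMap) (fun n p hp => ?_) p
    change TPoly P k i (V p) = V (MvPolynomial.pderiv i p)
    cases n with
    | zero =>
      rw [← totalDegree_zero_iff_isHomogeneous, totalDegree_eq_zero_iff_eq_C] at hp
      rw [hp, hVC, TPoly_C hP.dot_self, pderiv_C, map_zero]
    | succ n => rw [hV _ p hp, hT n p hp i, ← hV n _ hp.pderiv]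
  -- If V p = 0, then V kills every ∂_i p, so these vanish by induction and Euler's identity gives p
  -- = 0. In finite dimension this upgrades V(𝒫_n) ⊆ 𝒫_n to equality.
  have hinj : ∀ n p, p.IsHomogeneous n → V p = 0 → p = 0 := by
    intro n
    induction n with
    | zero =>
      intro p hp h
      rw [← totalDegree_zero_iff_isHomogeneous, totalDegree_eq_zero_iff_eq_C] at hp
      rw [hp, hVC] at h
      rw [hp, h]
    | succ n ih =>
      intro p hp h
      have h1 : ∀ i, MvPolynomial.pderiv i p = 0 := fun i =>
        ih _ hp.pderiv (by rw [← hVT, h, map_zero])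
      have h2 := hp.sum_X_mul_pderiv
      simp only [h1, mul_zero, Finset.sum_const_zero] at h2
      exact (smul_eq_zero.1 h2.symm).resolve_left n.succ_ne_zero
  refine ⟨V, fun n => le_antisymm ?_ ?_, hVC, fun i p => ?_⟩
  · rintro _ ⟨p, hp, rfl⟩
    exact hVhom n p hp
  · intro p hp
    obtain ⟨g, hg⟩ := exists_homogeneous_preimage V (hVhom n) (hinj n)
    exact ⟨g p, (hg p hp).1, (hg p hp).2⟩
  · rw [T_polyFun hP.dot_self, hVT]

section kernel

variable {P : Finset (E N)} {k : E N → ℝ}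

/-- Everything used about `V` follows from these properties, so existence suffices and uniqueness
plays no role. -/
theorem isIntertwiner_V (hP : IsPositiveSystem P k) : IsIntertwiner P k (V P k) :=
  Classical.epsilon_spec (exists_isIntertwiner hP)

theorem isHomogeneous_V (hP : IsPositiveSystem P k) {n : ℕ} {p : Poly N}
    (hp : p.IsHomogeneous n) : (V P k p).IsHomogeneous n := by
  have := (isIntertwiner_V hP).map_homogeneous n
  exact this.le ⟨p, hp, rfl⟩

theorem V_C (hP : IsPositiveSystem P k) (c : ℂ) : V P k (C c) = C c :=
  (isIntertwiner_V hP).map_const c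

theorem TPoly_V (hP : IsPositiveSystem P k) (i : Fin N) (p : Poly N) :
    TPoly P k i (V P k p) = V P k (MvPolynomial.pderiv i p) := by
  apply polyFun_injective
  rw [← T_polyFun hP.dot_self, (isIntertwiner_V hP).intertwines]

theorem V_C_mul (P : Finset (E N)) (k : E N → ℝ) (c : ℂ) (p : Poly N) :
    V P k (C c * p) = C c * V P k p := by
  rw [← smul_eq_C_mul, map_smul, smul_eq_C_mul]

/-! ### The homogeneous components of the Dunkl kernel -/

theorem expComponent_zero (w : Fin N → ℂ) : expComponent w 0 = 1 := by
  simp [expComponent]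

theorem isHomogeneous_expComponent (w : Fin N → ℂ) (n : ℕ) :
    (expComponent w n).IsHomogeneous n := by
  have h : (∑ i, C (w i) * X i : Poly N).IsHomogeneous 1 :=
    IsHomogeneous.sum _ _ _ fun i _ => isHomogeneous_C_mul_X _ i
  simpa [expComponent] using (h.pow n).C_mul _

theorem pderiv_expComponent_succ (w : Fin N → ℂ) (n : ℕ) (i : Fin N) :
    MvPolynomial.pderiv i (expComponent w (n + 1)) = C (w i) * expComponent w n := by
  have hl : MvPolynomial.pderiv i (∑ j, C (w j) * X j : Poly N) = C (w i) := by
    classical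
    simp only [map_sum, pderiv_C_mul, pderiv_X, Pi.single_apply]
    simp
  rw [expComponent, pderiv_C_mul, pderiv_pow, hl, expComponent, Nat.add_sub_cancel]
  have : (C ((((n + 1)! : ℕ) : ℂ)⁻¹) * ((n + 1 : ℕ) : Poly N)) = C ((n ! : ℂ)⁻¹) := by
    rw [← map_natCast (C : ℂ →+* Poly N), ← C_mul, Nat.factorial_succ]
    congr 1
    have h1 : ((n + 1 : ℕ) : ℂ) ≠ 0 := by exact_mod_cast n.succ_ne_zero
    have h2 : (n ! : ℂ) ≠ 0 := by exact_mod_cast n.factorial_ne_zero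
    push_cast at h1 ⊢
    field_simp
  rw [← this]
  ring

/-- The component of degree `n` of the Dunkl kernel `K(·, w)`. -/
def kerComp (P : Finset (E N)) (k : E N → ℝ) (w : Fin N → ℂ) (n : ℕ) : Poly N :=
  V P k (expComponent w n)

theorem isHomogeneous_kerComp (hP : IsPositiveSystem P k) (w : Fin N → ℂ) (n : ℕ) :
    (kerComp P k w n).IsHomogeneous n :=
  isHomogeneous_V hP (isHomogeneous_expComponent w n)

theorem kerComp_zero (hP : IsPositiveSystem P k) (w : Fin N → ℂ) : kerComp P k w 0 = 1 := by
  rw [kerComp, expComponent_zero, ← C_1, V_C hP]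

theorem TPoly_kerComp_succ (hP : IsPositiveSystem P k) (w : Fin N → ℂ) (n : ℕ) (i : Fin N) :
    TPoly P k i (kerComp P k w (n + 1)) = C (w i) * kerComp P k w n := by
  rw [kerComp, TPoly_V hP, pderiv_expComponent_succ, V_C_mul, kerComp]

/-- This recursion determines K_{n+1} from K_n. Together with the maximum principle it gives the
bound, the invariance and the symmetry of the kernel. -/
theorem eulerOp_kerComp_succ (hP : IsPositiveSystem P k) (w : Fin N → ℂ) (n : ℕ) :
    eulerOp P k (n + 1) (kerComp P k w (n + 1)) =
      (∑ i, C (w i) * X i) * kerComp P k w n := by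
  rw [← sum_X_mul_TPoly hP.dot_self (isHomogeneous_kerComp hP w (n + 1)), Finset.sum_mul]
  exact Finset.sum_congr rfl fun i _ => by rw [TPoly_kerComp_succ hP]; ring

/-! ### Growth, invariance and symmetry of the Dunkl kernel. -/

theorem norm_sum_mul_le (z w : CE N) : ‖∑ i, w i * z i‖ ≤ ‖w‖ * ‖z‖ := by
  have h := norm_inner_le_norm (𝕜 := ℂ) (WithLp.toLp 2 fun i => (starRingEnd ℂ) (w i) : CE N) z
  have h1 : ‖(WithLp.toLp 2 fun i => (starRingEnd ℂ) (w i) : CE N)‖ = ‖w‖ := by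
    rw [EuclideanSpace.norm_eq, EuclideanSpace.norm_eq]
    simp
  rw [h1] at h
  refine le_trans (le_of_eq ?_) h
  simp [PiLp.inner_apply, mul_comm]

/-- The components of the Dunkl kernel satisfy the same bound as those of the exponential. -/
theorem norm_eval_kerComp_le (hP : IsPositiveSystem P k) (w : CE N) {r : ℝ} (hr : 0 ≤ r) (n : ℕ)
    {z : CE N} (hz : ‖z‖ ≤ r) :
    ‖MvPolynomial.eval z.ofLp (kerComp P k w.ofLp n)‖ ≤ (r * ‖w‖) ^ n / n ! := by
  induction n generalizing z with
  | zero => simp [kerComp_zero hP]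
  | succ n ih =>
    -- E_{n+1} K_{n+1} = ⟨z,w⟩ K_n is at most r‖w‖ times the previous bound; the factor n + 1 of the
    -- maximum principle supplies the factorial.
    have h := max_principle hP (n := ((n + 1 : ℕ) : ℝ))
      (h := fun z : CE N => MvPolynomial.eval z.ofLp (kerComp P k w.ofLp (n + 1)))
      (C := r * ‖w‖ * ((r * ‖w‖) ^ n / n !)) (r := r) (continuous_eval_CE _) (fun _ v => v)
      (fun _ _ _ => rfl) (by positivity) (fun y hy => by
        rw [← eval_eulerOp, eulerOp_kerComp_succ hP, map_mul, norm_mul]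
        refine mul_le_mul ?_ (ih hy) (norm_nonneg _) (by positivity)
        rw [map_sum]
        simp only [map_mul, eval_C, eval_X]
        refine (norm_sum_mul_le y w).trans ?_
        rw [mul_comm]
        exact mul_le_mul_of_nonneg_right hy (norm_nonneg _)) hz
    have h1 : (0 : ℝ) < ((n + 1 : ℕ) : ℝ) := by positivity
    rw [mul_comm, ← le_div_iff₀ h1] at h
    refine h.trans (le_of_eq ?_)
    rw [Nat.factorial_succ, pow_succ]
    push_cast
    field_simp

theorem isEntireSeries_kerComp (hP : IsPositiveSystem P k) (w : Fin N → ℂ) :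
    IsEntireSeries (kerComp P k w) where
  homogeneous := isHomogeneous_kerComp hP w
  bound r := ⟨fun n => (|r| * ‖(WithLp.toLp 2 w : CE N)‖) ^ n / n !,
    Real.summable_pow_div_factorial _, fun n _ hz =>
      norm_eval_kerComp_le hP (WithLp.toLp 2 w) (abs_nonneg r) n (hz.trans (le_abs_self r))⟩

theorem K_eq_seriesFun (w : Fin N → ℂ) (x : E N) :
    K P k (toC x) w = seriesFun (kerComp P k w) x := rfl

theorem eulerOp_reflPoly (hP : IsPositiveSystem P k) {γ : E N} (hγ : γ ∈ P) (n : ℕ)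
    (p : Poly N) : eulerOp P k n (reflPoly γ p) = reflPoly γ (eulerOp P k n p) := by
  have h := hP.sum_reflVec hγ
    (fun c α => C (c : ℂ) * (reflPoly γ p - reflPoly α (reflPoly γ p)))
    (fun c α _ => by rw [reflPoly_neg])
  simp only [eulerOp, map_add, map_mul, reflPoly_C, map_sum, map_sub]
  refine congrArg (C (n : ℂ) * reflPoly γ p + ·) (h.symm.trans (Finset.sum_congr rfl fun α _ => ?_))
  rw [reflPoly_conj γ α (hP.dot_self γ hγ)]

theorem eulerOp_sub (P : Finset (E N)) (k : E N → ℝ) (n : ℕ) (p q : Poly N) :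
    eulerOp P k n (p - q) = eulerOp P k n p - eulerOp P k n q :=
  (eulerLin P k n).map_sub p q

theorem reflC_reflC (γ : E N) (hγ : dot γ γ = 2) (z : CE N) : reflC γ (reflC γ z) = z := by
  have h2 : ∑ i, (γ i : ℂ) * γ i = 2 := by exact_mod_cast congrArg ((↑) : ℝ → ℂ) hγ
  ext i
  rw [reflC_apply, reflC_apply]
  simp only [reflC_apply, mul_sub, Finset.sum_sub_distrib]
  have : ∑ j, (γ j : ℂ) * ((∑ l, (γ l : ℂ) * z l) * γ j) = 2 * ∑ l, (γ l : ℂ) * z l := by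
    rw [← h2, Finset.sum_mul]
    exact Finset.sum_congr rfl fun j _ => by ring
  rw [this]
  ring

/-- Invariance of the Dunkl kernel under simultaneous reflection of both arguments. -/
theorem reflPoly_kerComp (hP : IsPositiveSystem P k) {γ : E N} (hγ : γ ∈ P) (w : CE N) (n : ℕ) :
    reflPoly γ (kerComp P k (reflC γ w).ofLp n) = kerComp P k w.ofLp n := by
  induction n with
  | zero => simp [kerComp_zero hP]
  | succ n ih =>
    -- Both sides solve the same equation for E_{n+1}, since E_{n+1} commutes with reflections and
    -- the bilinear form is invariant.
    rw [← sub_eq_zero]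
    refine eulerOp_injective hP n.succ_ne_zero ?_
    have hl : reflPoly γ (∑ i, C ((reflC γ w).ofLp i) * X i) = ∑ i, C (w i) * X i := by
      have h2 : ∑ i, (γ i : ℂ) * γ i = 2 := by
        exact_mod_cast congrArg ((↑) : ℝ → ℂ) (hP.dot_self γ hγ)
      refine MvPolynomial.funext fun z => ?_
      have := eval_reflPoly γ (WithLp.toLp 2 z) (∑ i, C ((reflC γ w).ofLp i) * X i)
      simp only at this
      rw [this]
      simp only [map_sum, map_mul, eval_C, eval_X, reflC_apply]
      set c := ∑ j, (γ j : ℂ) * w j with hc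
      set d := ∑ j, (γ j : ℂ) * z j with hd
      have e : ∀ i, (w i - c * γ i) * (z i - d * γ i) =
          w i * z i - d * (γ i * w i) - c * (γ i * z i) + c * d * (γ i * γ i) := fun i => by ring
      simp only [e, Finset.sum_add_distrib, Finset.sum_sub_distrib, ← Finset.mul_sum, h2, ← hc,
        ← hd]
      ring
    rw [eulerOp_sub, eulerOp_reflPoly hP hγ, eulerOp_kerComp_succ hP, eulerOp_kerComp_succ hP,
      map_mul, ih, hl, sub_self]

theorem eval_kerComp_reflC (hP : IsPositiveSystem P k) {γ : E N} (hγ : γ ∈ P) (z w : CE N)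
    (n : ℕ) : MvPolynomial.eval z.ofLp (kerComp P k (reflC γ w).ofLp n) =
      MvPolynomial.eval (reflC γ z).ofLp (kerComp P k w.ofLp n) := by
  rw [← reflPoly_kerComp hP hγ w, eval_reflPoly, reflC_reflC γ (hP.dot_self γ hγ)]

/-- The monomial `x^κ`. -/
def monoX (κ : Fin N → ℕ) : Poly N := ∏ i, X i ^ κ i

/-- The multinomial expansion exposes the polynomial dependence on w, used for continuity in w and
for extracting coefficients of w^κ. -/
theorem expComponent_eq_sum (w : Fin N → ℂ) (n : ℕ) :
    expComponent w n = ∑ κ ∈ Finset.piAntidiag Finset.univ n,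
      C ((fact κ : ℂ)⁻¹ * ∏ i, w i ^ κ i) * monoX κ := by
  classical
  rw [expComponent, Finset.sum_pow_eq_sum_piAntidiag, Finset.mul_sum]
  refine Finset.sum_congr rfl fun κ hκ => ?_
  simp only [mul_pow, Finset.prod_mul_distrib, monoX]
  rw [← map_natCast (C : ℂ →+* Poly N)]
  simp only [← map_pow, ← map_prod]
  rw [← mul_assoc, ← mul_assoc, ← C_mul, ← C_mul]
  congr 3
  have hs : ∑ i, κ i = n := (Finset.mem_piAntidiag.1 hκ).1
  have h1 := Nat.multinomial_spec Finset.univ κ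
  rw [hs] at h1
  have h2 : (fact κ : ℂ) ≠ 0 := by
    exact_mod_cast Finset.prod_ne_zero_iff.2 fun i _ => (κ i).factorial_ne_zero
  have h3 : (n ! : ℂ) ≠ 0 := by exact_mod_cast n.factorial_ne_zero
  have h4 : (fact κ : ℂ) * Nat.multinomial Finset.univ κ = n ! := by exact_mod_cast h1
  rw [← h4] at h3 ⊢
  rw [mul_inv, mul_assoc, inv_mul_cancel₀ (right_ne_zero_of_mul h3), mul_one]

theorem kerComp_eq_sum (w : Fin N → ℂ) (n : ℕ) :
    kerComp P k w n = ∑ κ ∈ Finset.piAntidiag Finset.univ n,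
      C ((fact κ : ℂ)⁻¹ * ∏ i, w i ^ κ i) * V P k (monoX κ) := by
  rw [kerComp, expComponent_eq_sum, map_sum]
  exact Finset.sum_congr rfl fun κ _ => V_C_mul _ _ _ _

/-- The Euler operator in z annihilates K_{n+1}(z,w) - K_{n+1}(w,z), by the recursion and symmetry
in degree n; the maximum principle then forces this difference to vanish. -/
theorem eval_kerComp_symm (hP : IsPositiveSystem P k) (z w : CE N) (n : ℕ) :
    MvPolynomial.eval z.ofLp (kerComp P k w.ofLp n) =
      MvPolynomial.eval w.ofLp (kerComp P k z.ofLp n) := by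
  induction n generalizing z w with
  | zero => simp [kerComp_zero hP]
  | succ n ih =>
    have hc : Continuous fun z : CE N => MvPolynomial.eval w.ofLp (kerComp P k z.ofLp (n + 1)) := by
      simp only [kerComp_eq_sum, map_sum, map_mul, eval_C]
      fun_prop
    have hlin : ∀ a b : CE N, MvPolynomial.eval a.ofLp (∑ i, C (b i) * X i : Poly N) =
        ∑ i, b i * a i := fun a b => by simp
    have key := max_principle hP (n := ((n + 1 : ℕ) : ℝ)) (C := 0) (r := ‖z‖)
      (h := fun z : CE N => MvPolynomial.eval z.ofLp (kerComp P k w.ofLp (n + 1)) -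
        MvPolynomial.eval w.ofLp (kerComp P k z.ofLp (n + 1)))
      ((continuous_eval_CE _).sub hc) (fun _ v => v) (fun _ _ _ => rfl) (by positivity)
      (fun y _ => by
        have h1 := congrArg (MvPolynomial.eval y.ofLp) (eulerOp_kerComp_succ hP w.ofLp n)
        have h2 := congrArg (MvPolynomial.eval w.ofLp) (eulerOp_kerComp_succ hP y.ofLp n)
        rw [eval_eulerOp, map_mul, hlin, ih] at h1
        rw [eval_eulerOp, map_mul, hlin] at h2
        -- Invariance trades a reflection of w for one of y, so the recursion in w becomes an
        -- equation in y.
        have h3 : ∑ α ∈ P, k α • (MvPolynomial.eval w.ofLp (kerComp P k y.ofLp (n + 1)) -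
            MvPolynomial.eval (reflC α w).ofLp (kerComp P k y.ofLp (n + 1))) =
          ∑ α ∈ P, k α • (MvPolynomial.eval w.ofLp (kerComp P k y.ofLp (n + 1)) -
            MvPolynomial.eval w.ofLp (kerComp P k (reflC α y).ofLp (n + 1))) :=
          Finset.sum_congr rfl fun α hα => by rw [eval_kerComp_reflC hP hα]
        rw [h3] at h2
        have h4 : ∑ i, w i * y i = ∑ i, y i * w i := Finset.sum_congr rfl fun i _ => mul_comm _ _
        rw [h4, ← h2] at h1
        rw [norm_le_zero_iff]
        simp only [smul_sub, Finset.sum_sub_distrib] at h1 ⊢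
        linear_combination h1) le_rfl
    have hn' : (0 : ℝ) < ((n + 1 : ℕ) : ℝ) := by positivity
    have h0 := nonpos_of_mul_nonpos_right key hn'
    exact sub_eq_zero.1 (norm_le_zero_iff.1 h0)

end kernel

end

section

/-! ### The positive roots form a positive system -/

theorem IsNormalizedRootSystem.neg_mem {R : Finset (E N)} (hR : IsNormalizedRootSystem R)
    {α : E N} (hα : α ∈ R) : -α ∈ R := by
  have h := hR.inter_line α hα
  have : -α ∈ (R : Set (E N)) ∩ (ℝ ∙ α : Submodule ℝ (E N)) := by rw [h]; simp
  exact this.1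

theorem IsNormalizedRootSystem.dot_self {R : Finset (E N)} (hR : IsNormalizedRootSystem R)
    {α : E N} (hα : α ∈ R) : dot α α = 2 := by
  rw [← norm_sq_eq_dot, hR.norm_eq α hα, Real.sq_sqrt zero_le_two]

theorem isPositiveSystem_positiveRoots {R : Finset (E N)} (hR : IsNormalizedRootSystem R)
    {β : E N} (hβ : ∀ α ∈ R, ⟪α, β⟫ ≠ 0) {k : E N → ℝ} (hk : ∀ α ∈ R, 0 ≤ k α)
    (hinv : ∀ g ∈ reflectionGroup R, ∀ α ∈ R, k (g α) = k α) :
    IsPositiveSystem (positiveRoots R β) k := by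
  classical
  have hmem : ∀ α, α ∈ positiveRoots R β ↔ α ∈ R ∧ 0 < ⟪α, β⟫ := fun α => by
    simp [positiveRoots]
  have hk2 : ∀ γ ∈ R, ∀ α ∈ R, reflVec γ α ∈ R ∧ k (reflVec γ α) = k α := by
    intro γ hγ α hα
    rw [← refl_apply γ α (hR.dot_self hγ)]
    refine ⟨?_, hinv _ (Subgroup.subset_closure ⟨γ, hγ, rfl⟩) α hα⟩
    have : refl γ α ∈ refl γ '' (R : Set (E N)) := ⟨α, hα, rfl⟩
    rw [hR.refl_image γ hγ] at this
    exact this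
  have hkneg : ∀ α ∈ R, k (-α) = k α := fun α hα => by
    rw [← reflVec_self α (hR.dot_self hα)]
    exact (hk2 α hα α hα).2
  refine ⟨fun α hα => hR.dot_self ((hmem α).1 hα).1, fun α hα => hk α ((hmem α).1 hα).1,
    fun γ hγ => ?_⟩
  have hγR := ((hmem γ).1 hγ).1
  have hγ2 := hR.dot_self hγR
  -- The permutation picks whichever of ±σ_γ α is positive; exactly one is, because β is orthogonal
  -- to no root.
  refine ⟨fun α => if 0 < ⟪reflVec γ α, β⟫ then reflVec γ α else -reflVec γ α, ?_, ?_, ?_⟩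
  · intro α hα
    have h := hk2 γ hγR α ((hmem α).1 hα).1
    rw [hmem]
    dsimp only
    split_ifs with h'
    · exact ⟨h.1, h'⟩
    · refine ⟨hR.neg_mem h.1, ?_⟩
      rw [inner_neg_left]
      have := hβ _ h.1
      exact neg_pos.2 (lt_of_le_of_ne (not_lt.1 h') this)
  · intro α hα
    have hα' := ((hmem α).1 hα).2
    have hneg : reflVec γ (-reflVec γ α) = -α := by
      have := reflVec_reflVec γ α hγ2
      rw [← refl_apply _ _ hγ2] at this ⊢
      rw [map_neg, this]
    dsimp only
    split_ifs with h1 h2 h2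
    · exact reflVec_reflVec γ α hγ2
    · rw [reflVec_reflVec γ α hγ2] at h2
      exact absurd hα' h2
    · rw [hneg, inner_neg_left] at h2
      linarith
    · rw [hneg, neg_neg]
  · intro α hα
    have h := hk2 γ hγR α ((hmem α).1 hα).1
    dsimp only
    split_ifs
    · exact ⟨Or.inl rfl, h.2⟩
    · exact ⟨Or.inr rfl, (hkneg _ h.1).trans h.2⟩

/-! ### Functions of sub-Gaussian growth -/

/-- The function grows more slowly than every Gaussian. -/
def SubGaussian (f : E N → ℂ) : Prop :=
  ∀ δ : ℝ, 0 < δ → ∃ C, ∀ y, ‖f y‖ ≤ C * Real.exp (δ * ‖y‖ ^ 2)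

theorem SubGaussian.mono {f g : E N → ℂ} (hg : SubGaussian g) (h : ∀ y, ‖f y‖ ≤ ‖g y‖) :
    SubGaussian f := fun δ hδ => by
  obtain ⟨C, hC⟩ := hg δ hδ
  exact ⟨C, fun y => (h y).trans (hC y)⟩

theorem SubGaussian.add {f g : E N → ℂ} (hf : SubGaussian f) (hg : SubGaussian g) :
    SubGaussian fun y => f y + g y := fun δ hδ => by
  obtain ⟨C, hC⟩ := hf δ hδ
  obtain ⟨D, hD⟩ := hg δ hδ
  refine ⟨C + D, fun y => (norm_add_le _ _).trans ?_⟩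
  rw [add_mul]
  exact add_le_add (hC y) (hD y)

theorem SubGaussian.mul {f g : E N → ℂ} (hf : SubGaussian f) (hg : SubGaussian g) :
    SubGaussian fun y => f y * g y := fun δ hδ => by
  obtain ⟨C, hC⟩ := hf (δ / 2) (by positivity)
  obtain ⟨D, hD⟩ := hg (δ / 2) (by positivity)
  refine ⟨C * D, fun y => ?_⟩
  have : C * D * Real.exp (δ * ‖y‖ ^ 2) =
      C * Real.exp (δ / 2 * ‖y‖ ^ 2) * (D * Real.exp (δ / 2 * ‖y‖ ^ 2)) := by
    rw [mul_mul_mul_comm, ← Real.exp_add]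
    congr 2
    ring
  rw [norm_mul, this]
  exact mul_le_mul (hC y) (hD y) (norm_nonneg _) ((norm_nonneg _).trans (hC y))

theorem subGaussian_const (c : ℂ) : SubGaussian fun _ : E N => c := fun δ hδ =>
  ⟨‖c‖, fun y => le_mul_of_one_le_right (norm_nonneg _) (Real.one_le_exp (by positivity))⟩

theorem subGaussian_norm : SubGaussian fun y : E N => ((‖y‖ : ℝ) : ℂ) := fun δ hδ => by
  refine ⟨δ⁻¹ + 1, fun y => ?_⟩
  rw [Complex.norm_real, norm_norm]
  have h1 := Real.add_one_le_exp (δ * ‖y‖ ^ 2)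
  have h2 : δ⁻¹ * δ = 1 := inv_mul_cancel₀ hδ.ne'
  have h3 : 0 < δ⁻¹ := by positivity
  have h4 : ‖y‖ ≤ ‖y‖ ^ 2 + 1 := by nlinarith [sq_nonneg (‖y‖ - 1), sq_nonneg ‖y‖]
  have h5 : δ⁻¹ * (δ * ‖y‖ ^ 2) = ‖y‖ ^ 2 := by rw [← mul_assoc, h2, one_mul]
  nlinarith [mul_le_mul_of_nonneg_left h1 h3.le, Real.one_le_exp (x := δ * ‖y‖ ^ 2) (by positivity)]

theorem subGaussian_polyFun (p : Poly N) : SubGaussian (polyFun p) := by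
  induction p using MvPolynomial.induction_on with
  | C a => exact (subGaussian_const a).mono fun y => by simp [polyFun]
  | add p q hp hq => exact (hp.add hq).mono fun y => by simp [polyFun]
  | mul_X p m hp =>
    have hm : SubGaussian fun y : E N => ((y m : ℝ) : ℂ) := by
      refine subGaussian_norm.mono fun y => ?_
      rw [Complex.norm_real, Complex.norm_real, norm_norm]
      exact PiLp.norm_apply_le y m
    exact (hp.mul hm).mono fun y => by simp [polyFun, toC]

theorem subGaussian_finset_prod {ι : Type*} (s : Finset ι) (f : ι → E N → ℂ)
    (h : ∀ i ∈ s, SubGaussian (f i)) : SubGaussian fun y => ∏ i ∈ s, f i y := by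
  classical
  induction s using Finset.induction_on with
  | empty => simpa using subGaussian_const 1
  | insert a s ha ih =>
    simp only [Finset.prod_insert ha]
    exact (h a (Finset.mem_insert_self _ _)).mul
      (ih fun i hi => h i (Finset.mem_insert_of_mem hi))

theorem SubGaussian.rpow {f : E N → ℝ} (hf : SubGaussian fun y => (f y : ℂ)) (h0 : ∀ y, 0 ≤ f y)
    {c : ℝ} (hc : 0 ≤ c) : SubGaussian fun y => ((f y ^ c : ℝ) : ℂ) := fun δ hδ => by
  -- Dividing by c + 1 instead of c also covers c = 0.
  obtain ⟨C, hC⟩ := hf (δ / (c + 1)) (by positivity)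
  refine ⟨|C| ^ c, fun y => ?_⟩
  have h1 : f y ≤ |C| * Real.exp (δ / (c + 1) * ‖y‖ ^ 2) := by
    have := hC y
    rw [Complex.norm_real, Real.norm_of_nonneg (h0 y)] at this
    exact this.trans (mul_le_mul_of_nonneg_right (le_abs_self C) (Real.exp_pos _).le)
  rw [Complex.norm_real, Real.norm_of_nonneg (Real.rpow_nonneg (h0 y) c)]
  refine (Real.rpow_le_rpow (h0 y) h1 hc).trans ?_
  rw [Real.mul_rpow (abs_nonneg _) (Real.exp_pos _).le, ← Real.exp_mul]
  refine mul_le_mul_of_nonneg_left (Real.exp_le_exp.2 ?_) (by positivity)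
  have : δ / (c + 1) * ‖y‖ ^ 2 * c = δ * ‖y‖ ^ 2 * (c / (c + 1)) := by ring
  rw [this]
  refine mul_le_of_le_one_right (by positivity) ?_
  rw [div_le_one (by positivity)]
  linarith

theorem integrable_exp_neg_mul_norm_sq {b : ℝ} (hb : 0 < b) :
    Integrable fun y : E N => Real.exp (-b * ‖y‖ ^ 2) := by
  have h := GaussianFourier.integrable_cexp_neg_mul_sq_norm_add (V := E N) (b := b)
    (by simpa using hb) 0 0
  refine h.re.congr (Filter.Eventually.of_forall fun y => ?_)
  simp only [zero_mul, add_zero]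
  rw [← Complex.exp_ofReal_re]
  push_cast
  rfl

theorem SubGaussian.integrable {f : E N → ℂ} (hf : SubGaussian f) (hc : Continuous f) {b : ℝ}
    (hb : 0 < b) : Integrable fun y => f y * (Real.exp (-b * ‖y‖ ^ 2) : ℂ) := by
  obtain ⟨C, hC⟩ := hf (b / 2) (by positivity)
  have hb2 : 0 < b / 2 := by positivity
  refine ((integrable_exp_neg_mul_norm_sq hb2).const_mul C).mono'
    (by fun_prop) (Filter.Eventually.of_forall fun y => ?_)
  rw [norm_mul, Complex.norm_real, Real.norm_of_nonneg (Real.exp_pos _).le]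
  have : C * Real.exp (-(b / 2) * ‖y‖ ^ 2) =
      C * Real.exp (b / 2 * ‖y‖ ^ 2) * Real.exp (-b * ‖y‖ ^ 2) := by
    rw [mul_assoc, ← Real.exp_add]
    congr 2
    ring
  rw [this]
  exact mul_le_mul_of_nonneg_right (hC y) (Real.exp_pos _).le

end

section

open MvPolynomial Filter Topology

/-! ### The regularized weight -/

section weight

variable {P : Finset (E N)} {k : E N → ℝ}

/-- The regularization `∏ (⟨α, y⟩² + ε)^k(α)` of the weight `w_k`. -/
def regWeight (P : Finset (E N)) (k : E N → ℝ) (ε : ℝ) (y : E N) : ℝ :=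
  ∏ α ∈ P, (⟪α, y⟫ ^ 2 + ε) ^ k α

theorem regWeight_zero (P : Finset (E N)) (k : E N → ℝ) : regWeight P k 0 = weight P k := by
  ext y
  refine Finset.prod_congr rfl fun α _ => ?_
  rw [add_zero, Real.rpow_mul (abs_nonneg _), Real.rpow_two, sq_abs]

theorem regWeight_nonneg (P : Finset (E N)) (k : E N → ℝ) {ε : ℝ} (hε : 0 ≤ ε) (y : E N) :
    0 ≤ regWeight P k ε y :=
  Finset.prod_nonneg fun α _ => Real.rpow_nonneg (by positivity) _

theorem regWeight_mono (hk : ∀ α ∈ P, 0 ≤ k α) {ε ε' : ℝ} (hε : 0 ≤ ε) (h : ε ≤ ε') (y : E N) :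
    regWeight P k ε y ≤ regWeight P k ε' y :=
  Finset.prod_le_prod (fun α _ => Real.rpow_nonneg (by positivity) _) fun α hα =>
    Real.rpow_le_rpow (by positivity) (by linarith) (hk α hα)

theorem continuous_regWeight (hk : ∀ α ∈ P, 0 ≤ k α) (ε : ℝ) : Continuous (regWeight P k ε) :=
  continuous_finsetProd _ fun α hα =>
    Continuous.rpow_const (by fun_prop) fun _ => Or.inr (hk α hα)

theorem inner_reflVec (γ α y : E N) : ⟪α, reflVec γ y⟫ = ⟪reflVec γ α, y⟫ := by
  rw [inner_eq_dot, inner_eq_dot, dot_comm, reflVec, reflVec, dot_sub_smul_left, dot_sub_smul_left,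
    dot_comm γ α, dot_comm γ y, dot_comm y α]
  ring

theorem regWeight_reflVec (hP : IsPositiveSystem P k) {γ : E N} (hγ : γ ∈ P) (ε : ℝ) (y : E N) :
    regWeight P k ε (reflVec γ y) = regWeight P k ε y := by
  have := hP.prod_reflVec hγ (fun c α => (⟪α, y⟫ ^ 2 + ε) ^ c) (fun c α _ => by
    rw [inner_neg_left, neg_sq])
  simpa only [regWeight, inner_reflVec] using this

theorem polyFun_linForm (α y : E N) : polyFun (linForm α) y = (⟪α, y⟫ : ℝ) := by
  rw [inner_eq_sum_toCE, polyFun_apply, eval_linForm]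

theorem subGaussian_regWeight (hk : ∀ α ∈ P, 0 ≤ k α) {ε : ℝ} (hε : 0 ≤ ε) :
    SubGaussian fun y => (regWeight P k ε y : ℂ) := by
  simp only [regWeight, Complex.ofReal_prod]
  refine subGaussian_finset_prod _ _ fun α hα => SubGaussian.rpow ?_ (fun y => by positivity)
    (hk α hα)
  have h1 := subGaussian_polyFun (linForm α)
  refine ((h1.mul h1).add (subGaussian_const (ε : ℂ))).mono fun y => ?_
  rw [polyFun_linForm]
  exact le_of_eq (by push_cast; ring_nf)

/-- The regularized Gaussian density. -/
def regGauss (P : Finset (E N)) (k : E N → ℝ) (b ε : ℝ) (y : E N) : ℝ :=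
  Real.exp (-b * ‖y‖ ^ 2) * regWeight P k ε y

theorem regGauss_reflVec (hP : IsPositiveSystem P k) {γ : E N} (hγ : γ ∈ P) (b ε : ℝ) (y : E N) :
    regGauss P k b ε (reflVec γ y) = regGauss P k b ε y := by
  rw [regGauss, regGauss, regWeight_reflVec hP hγ, ← refl_apply γ y (hP.dot_self γ hγ),
    LinearIsometryEquiv.norm_map]

theorem integrable_mul_regGauss (hk : ∀ α ∈ P, 0 ≤ k α) {b ε : ℝ} (hb : 0 < b) (hε : 0 ≤ ε)
    {f : E N → ℂ} (hf : SubGaussian f) (hc : Continuous f) :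
    Integrable fun y => f y * (regGauss P k b ε y : ℂ) := by
  have := (hf.mul (subGaussian_regWeight hk hε)).integrable
    (hc.mul (Complex.continuous_ofReal.comp (continuous_regWeight hk ε))) hb
  refine this.congr (Eventually.of_forall fun y => ?_)
  simp only [regGauss, Complex.ofReal_mul]
  ring

theorem continuous_polyFun (p : Poly N) : Continuous (polyFun p) :=
  continuous_iff_continuousAt.2 fun x => (hasFDerivAt_polyFun p x).continuousAt

/-! ### Regularized integration by parts. -/

theorem integral_comp_reflVec (γ : E N) (hγ : dot γ γ = 2) (f : E N → ℂ) :
    ∫ y, f (reflVec γ y) = ∫ y, f y := by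
  have h := (refl γ).measurePreserving.integral_comp (refl γ).toHomeomorph.measurableEmbedding f
  simpa only [refl_apply γ _ hγ] using h

/-- The factor `⟨α, y⟩ / (⟨α, y⟩² + ε)`, a regularization of `1 / ⟨α, y⟩`. -/
def regInv (ε : ℝ) (α y : E N) : ℝ := ⟪α, y⟫ / (⟪α, y⟫ ^ 2 + ε)

theorem continuous_regInv {ε : ℝ} (hε : 0 < ε) (α : E N) : Continuous (regInv ε α) := by
  unfold regInv
  exact Continuous.div (by fun_prop) (by fun_prop) fun y => by positivity

theorem subGaussian_regInv {ε : ℝ} (hε : 0 < ε) (α : E N) :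
    SubGaussian fun y => (regInv ε α y : ℂ) := by
  refine ((subGaussian_polyFun (linForm α)).mul (subGaussian_const ((ε : ℂ)⁻¹))).mono fun y => ?_
  rw [polyFun_linForm, norm_mul, norm_inv, Complex.norm_real, Complex.norm_real, Complex.norm_real,
    regInv, norm_div, Real.norm_of_nonneg hε.le, ← div_eq_mul_inv]
  refine div_le_div_of_nonneg_left (norm_nonneg _) hε ?_
  rw [Real.norm_of_nonneg (by positivity)]
  nlinarith [sq_nonneg ⟪α, y⟫]

theorem hasFDerivAt_regGauss (b : ℝ) {ε : ℝ} (hε : 0 < ε) (y : E N) :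
    ∃ D : E N →L[ℝ] ℝ, HasFDerivAt (regGauss P k b ε) D y ∧
      ∀ v, D v = regGauss P k b ε y * (-(2 * b) * ⟪y, v⟫ +
        ∑ α ∈ P, 2 * k α * ⟪α, v⟫ * regInv ε α y) := by
  have hpos : ∀ α y : E N, 0 < ⟪α, y⟫ ^ 2 + ε := fun α y => by positivity
  -- For ε > 0 all factors are positive, so the density is an exponential and its derivative is
  -- itself times a logarithmic derivative.
  have e : regGauss P k b ε = fun y =>
      Real.exp (-b * ‖y‖ ^ 2 + ∑ α ∈ P, k α * Real.log (⟪α, y⟫ ^ 2 + ε)) := by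
    ext y
    rw [regGauss, Real.exp_add, Real.exp_sum]
    congr 1
    exact Finset.prod_congr rfl fun α _ => by rw [Real.rpow_def_of_pos (hpos α y), mul_comm]
  have h1 : HasFDerivAt (fun y : E N => -b * ‖y‖ ^ 2) (-b • (2 • innerSL ℝ y)) y :=
    (hasStrictFDerivAt_norm_sq y).hasFDerivAt.const_mul (-b)
  have h2 : ∀ α ∈ P, HasFDerivAt (fun y : E N => k α * Real.log (⟪α, y⟫ ^ 2 + ε))
      (k α • ((⟪α, y⟫ ^ 2 + ε)⁻¹ • ((2 * ⟪α, y⟫) • innerSL ℝ α))) y := fun α _ => by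
    have h3 : HasFDerivAt (fun y : E N => ⟪α, y⟫) (innerSL ℝ α) y := (innerSL ℝ α).hasFDerivAt
    have h4 : HasFDerivAt (fun y : E N => ⟪α, y⟫ ^ 2 + ε) ((2 * ⟪α, y⟫) • innerSL ℝ α) y := by
      have := (h3.pow 2).add_const ε
      simpa using this
    exact (h4.log (hpos α y).ne').const_mul _
  have h5 := (h1.add (HasFDerivAt.fun_sum h2)).exp
  refine ⟨_, by rw [e]; exact h5, fun v => ?_⟩
  have e2 := congrFun e y
  rw [e2]
  simp only [regInv]
  simp only [smul_apply, add_apply, sum_apply, innerSL_apply_apply, smul_eq_mul, nsmul_eq_mul]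
  congr 1
  congr 1
  · push_cast
    ring
  · refine Finset.sum_congr rfl fun α _ => ?_
    ring

/-- Integration by parts on all of ℝ^N, without boundary terms because the products involved are
integrable. The regularized poles come from the logarithmic derivative of the weight. -/
theorem integral_polyFun_pderiv_mul_regGauss (hk : ∀ α ∈ P, 0 ≤ k α) {b ε : ℝ} (hb : 0 < b)
    (hε : 0 < ε) (i : Fin N) (p : Poly N) :
    ∫ y, polyFun (MvPolynomial.pderiv i p) y * (regGauss P k b ε y : ℂ) =
      2 * b * (∫ y, polyFun (X i * p) y * (regGauss P k b ε y : ℂ)) -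
      ∑ α ∈ P, 2 * (k α * α i : ℂ) *
        ∫ y, (polyFun p y * regInv ε α y) * (regGauss P k b ε y : ℂ) := by
  have hI1 : Integrable fun y => polyFun (X i * p) y * (regGauss P k b ε y : ℂ) :=
    integrable_mul_regGauss hk hb hε.le (subGaussian_polyFun _) (continuous_polyFun _)
  have hI2 : ∀ α ∈ P,
      Integrable fun y => (polyFun p y * regInv ε α y) * (regGauss P k b ε y : ℂ) := fun α _ =>
    integrable_mul_regGauss hk hb hε.le ((subGaussian_polyFun p).mul (subGaussian_regInv hε α))
      ((continuous_polyFun p).mul (Complex.continuous_ofReal.comp (continuous_regInv hε α)))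
  choose D hD hDv using fun y => hasFDerivAt_regGauss (P := P) (k := k) b hε y
  have hDC : ∀ y, HasFDerivAt (fun y => (regGauss P k b ε y : ℂ)) (Complex.ofRealCLM ∘L D y) y :=
    fun y => Complex.ofRealCLM.hasFDerivAt.comp y (hD y)
  have hpt : ∀ y, polyFun p y * fderiv ℝ (fun y => (regGauss P k b ε y : ℂ)) y
      (EuclideanSpace.single i 1) = -(2 * b) * (polyFun (X i * p) y * (regGauss P k b ε y : ℂ)) +
        ∑ α ∈ P, 2 * (k α * α i : ℂ) *
          ((polyFun p y * regInv ε α y) * (regGauss P k b ε y : ℂ)) := by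
    intro y
    have e1 : polyFun (X i * p) y = (y i : ℂ) * polyFun p y := by simp [polyFun, toC]
    have e2 : ∀ z : E N, ⟪z, EuclideanSpace.single i (1 : ℝ)⟫ = z i := fun z => by
      simp [EuclideanSpace.inner_single_right]
    rw [(hDC y).fderiv, ContinuousLinearMap.comp_apply, hDv, e1, e2]
    simp only [e2, Complex.ofRealCLM_apply]
    push_cast
    rw [mul_add, mul_add, Finset.mul_sum, Finset.mul_sum]
    congr 1
    · ring
    · exact Finset.sum_congr rfl fun α _ => by ring
  have hI3 : Integrable fun y => -(2 * b) * (polyFun (X i * p) y * (regGauss P k b ε y : ℂ)) +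
        ∑ α ∈ P, 2 * (k α * α i : ℂ) *
          ((polyFun p y * regInv ε α y) * (regGauss P k b ε y : ℂ)) :=
    (hI1.const_mul _).add (integrable_finsetSum _ fun α hα => (hI2 α hα).const_mul _)
  have hder : ∀ y, fderiv ℝ (polyFun p) y (EuclideanSpace.single i 1) =
      polyFun (MvPolynomial.pderiv i p) y := fun y => congrFun (pderiv_polyFun i p) y
  have key := integral_mul_fderiv_eq_neg_fderiv_mul_of_integrable (μ := (volume : Measure (E N)))
    (f := polyFun p) (g := fun y => (regGauss P k b ε y : ℂ)) (v := EuclideanSpace.single i 1)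
    (by simp only [hder]
        exact integrable_mul_regGauss hk hb hε.le (subGaussian_polyFun _) (continuous_polyFun _))
    (by simp only [hpt]; exact hI3)
    (integrable_mul_regGauss hk hb hε.le (subGaussian_polyFun _) (continuous_polyFun _))
    (fun y _ => (hasFDerivAt_polyFun p y).differentiableAt)
    (fun y _ => (hDC y).differentiableAt)
  simp only [hpt, hder] at key
  rw [integral_add (hI1.const_mul _) (integrable_finsetSum _ fun α hα => (hI2 α hα).const_mul _),
    integral_finsetSum _ fun α hα => (hI2 α hα).const_mul _, integral_const_mul] at key
  simp only [integral_const_mul] at key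
  linear_combination key

/-- `regInv` is odd under σ_α and the density is even, so only the antisymmetric part of p
contributes; that part is divisible by ⟨α, ·⟩, which removes the pole. -/
theorem integral_mul_regInv_mul_regGauss (hP : IsPositiveSystem P k) {b ε : ℝ} (hb : 0 < b)
    (hε : 0 < ε) {α : E N} (hα : α ∈ P) (p : Poly N) :
    2 * ∫ y, (polyFun p y * regInv ε α y) * (regGauss P k b ε y : ℂ) =
      ∫ y, (polyFun (divDiff α p) y * (⟪α, y⟫ * regInv ε α y : ℝ)) *
        (regGauss P k b ε y : ℂ) := by
  have hα2 := hP.dot_self α hα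
  have hI : ∀ p : Poly N,
      Integrable fun y => (polyFun p y * regInv ε α y) * (regGauss P k b ε y : ℂ) := fun p =>
    integrable_mul_regGauss hP.nonneg hb hε.le
      ((subGaussian_polyFun p).mul (subGaussian_regInv hε α))
      ((continuous_polyFun p).mul (Complex.continuous_ofReal.comp (continuous_regInv hε α)))
  have h1 : ∫ y, (polyFun (reflPoly α p) y * regInv ε α y) * (regGauss P k b ε y : ℂ) =
      -∫ y, (polyFun p y * regInv ε α y) * (regGauss P k b ε y : ℂ) := by
    rw [← integral_neg, ← integral_comp_reflVec α hα2]
    congr 1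
    ext y
    have : regInv ε α (reflVec α y) = -regInv ε α y := by
      rw [regInv, inner_reflVec, reflVec_self α hα2, inner_neg_left, regInv, neg_sq, neg_div]
    rw [regGauss_reflVec hP hα, this, polyFun_reflPoly, reflVec_reflVec α y hα2]
    push_cast
    ring
  calc _ = ∫ y, ((polyFun p y * regInv ε α y) * (regGauss P k b ε y : ℂ) -
        (polyFun (reflPoly α p) y * regInv ε α y) * (regGauss P k b ε y : ℂ)) := by
        rw [integral_sub (hI p) (hI _), h1]
        ring
    _ = _ := by
        congr 1
        ext y
        have : polyFun p y - polyFun (reflPoly α p) y = ⟪α, y⟫ * polyFun (divDiff α p) y := by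
          rw [← polyFun_linForm]
          simp only [polyFun, ← map_mul, ← map_sub, linForm_mul_divDiff α hα2]
        rw [← sub_mul, ← sub_mul, this]
        push_cast
        ring

/-- The regularized form of the identity `∫ (T_i p) e^{-b|y|²} w_k = 2b ∫ y_i p e^{-b|y|²} w_k`. -/
theorem integral_regularized (hP : IsPositiveSystem P k) {b ε : ℝ} (hb : 0 < b) (hε : 0 < ε)
    (i : Fin N) (p : Poly N) :
    ∫ y, (polyFun (MvPolynomial.pderiv i p) y - 2 * b * polyFun (X i * p) y +
      ∑ α ∈ P, (k α * α i : ℂ) * (polyFun (divDiff α p) y * (⟪α, y⟫ * regInv ε α y : ℝ))) *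
        (regGauss P k b ε y : ℂ) = 0 := by
  have hI : ∀ p : Poly N, Integrable fun y => polyFun p y * (regGauss P k b ε y : ℂ) := fun p =>
    integrable_mul_regGauss hP.nonneg hb hε.le (subGaussian_polyFun _) (continuous_polyFun _)
  have hI2 : ∀ α ∈ P, Integrable fun y => (polyFun (divDiff α p) y *
      (⟪α, y⟫ * regInv ε α y : ℝ)) * (regGauss P k b ε y : ℂ) := fun α _ => by
    have := integrable_mul_regGauss hP.nonneg hb hε.le
      ((subGaussian_polyFun (divDiff α p * linForm α)).mul (subGaussian_regInv hε α))
      ((continuous_polyFun _).mul (Complex.continuous_ofReal.comp (continuous_regInv hε α)))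
    refine this.congr (Eventually.of_forall fun y => ?_)
    have : polyFun (divDiff α p * linForm α) y = polyFun (divDiff α p) y * ⟪α, y⟫ := by
      rw [← polyFun_linForm]; simp [polyFun]
    simp only [this]
    push_cast
    ring
  simp only [add_mul, sub_mul, Finset.sum_mul, mul_assoc (_ * _ : ℂ) _ (regGauss P k b ε _ : ℂ)]
  have h12 : Integrable fun y => polyFun (MvPolynomial.pderiv i p) y * (regGauss P k b ε y : ℂ) -
      2 * b * (polyFun (X i * p) y * (regGauss P k b ε y : ℂ)) :=
    (hI _).sub ((hI _).const_mul _)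
  rw [integral_add h12
    (integrable_finsetSum _ fun α hα => (hI2 α hα).const_mul _),
    integral_sub (hI _) ((hI _).const_mul _),
    integral_finsetSum _ fun α hα => (hI2 α hα).const_mul _]
  simp only [integral_const_mul]
  have : ∀ α ∈ P, (k α * α i : ℂ) * ∫ y, (polyFun (divDiff α p) y *
      (⟪α, y⟫ * regInv ε α y : ℝ)) * (regGauss P k b ε y : ℂ) = 2 * (k α * α i : ℂ) *
      ∫ y, (polyFun p y * regInv ε α y) * (regGauss P k b ε y : ℂ) := fun α hα => by
    rw [← integral_mul_regInv_mul_regGauss hP hb hε hα p]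
    ring
  rw [integral_polyFun_pderiv_mul_regGauss hP.nonneg hb hε, Finset.sum_congr rfl this]
  ring

theorem tendsto_regGauss (hk : ∀ α ∈ P, 0 ≤ k α) (b : ℝ) (y : E N) :
    Tendsto (fun n : ℕ => regGauss P k b (1 / ((n : ℝ) + 1)) y) atTop
      (𝓝 (regGauss P k b 0 y)) := by
  refine Tendsto.const_mul _ (tendsto_finsetProd _ fun α hα => ?_)
  refine Tendsto.rpow_const ?_ (Or.inr (hk α hα))
  exact tendsto_const_nhds.add tendsto_one_div_add_atTop_nhds_zero_nat

theorem inner_mul_regInv_nonneg {ε : ℝ} (hε : 0 < ε) (α y : E N) : 0 ≤ ⟪α, y⟫ * regInv ε α y := by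
  rw [regInv, ← mul_div_assoc, ← sq]
  positivity

theorem inner_mul_regInv_le_one {ε : ℝ} (hε : 0 < ε) (α y : E N) :
    ⟪α, y⟫ * regInv ε α y ≤ 1 := by
  rw [regInv, ← mul_div_assoc, ← sq, div_le_one (by positivity)]
  linarith

/-- Off the hyperplane the regularizing factor tends to 1. On it the factor is constantly 0, but
then k(α) = 0 or the limiting weight vanishes, so keeping k(α) and the weight in the product makes
the limit valid at every point. -/
theorem tendsto_regularized (hk : ∀ α ∈ P, 0 ≤ k α) (b : ℝ) {α : E N} (hα : α ∈ P) (y : E N) :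
    Tendsto (fun n : ℕ => k α * (⟪α, y⟫ * regInv (1 / ((n : ℝ) + 1)) α y) *
      regGauss P k b (1 / ((n : ℝ) + 1)) y) atTop (𝓝 (k α * 1 * regGauss P k b 0 y)) := by
  have hε := tendsto_one_div_add_atTop_nhds_zero_nat (𝕜 := ℝ)
  by_cases h : ⟪α, y⟫ = 0
  · have h0 : k α * 1 * regGauss P k b 0 y = 0 := by
      by_cases h1 : k α = 0
      · simp [h1]
      · have : regWeight P k 0 y = 0 :=
          Finset.prod_eq_zero hα (by rw [h]; simp [Real.zero_rpow h1])
        rw [regGauss, this]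
        simp
    rw [h0]
    simp only [h, zero_mul, mul_zero]
    exact tendsto_const_nhds
  · refine (Tendsto.const_mul _ ?_).mul (tendsto_regGauss hk b y)
    have h2 : ⟪α, y⟫ ^ 2 + 0 ≠ 0 := by simpa using h
    have := (tendsto_const_nhds (x := ⟪α, y⟫)).mul
      ((tendsto_const_nhds (x := ⟪α, y⟫)).div (tendsto_const_nhds.add hε) h2)
    have e : ⟪α, y⟫ * (⟪α, y⟫ / (⟪α, y⟫ ^ 2 + 0)) = 1 := by
      rw [add_zero]; field_simp
    rw [e] at this
    exact this

/-- Antisymmetry of the Dunkl operators, tested against the Gaussian. -/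
theorem integral_TPoly_mul_regGauss (hP : IsPositiveSystem P k) {b : ℝ} (hb : 0 < b) (i : Fin N)
    (p : Poly N) :
    ∫ y, polyFun (TPoly P k i p) y * (regGauss P k b 0 y : ℂ) =
      2 * b * ∫ y, polyFun (X i * p) y * (regGauss P k b 0 y : ℂ) := by
  have hI : ∀ ε, 0 ≤ ε → ∀ p : Poly N,
      Integrable fun y => polyFun p y * (regGauss P k b ε y : ℂ) := fun ε hε p =>
    integrable_mul_regGauss hP.nonneg hb hε (subGaussian_polyFun _) (continuous_polyFun _)
  let F : ℕ → E N → ℂ := fun n y => (polyFun (MvPolynomial.pderiv i p) y -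
      2 * b * polyFun (X i * p) y + ∑ α ∈ P, (k α * α i : ℂ) * (polyFun (divDiff α p) y *
        (⟪α, y⟫ * regInv (1 / ((n : ℝ) + 1)) α y : ℝ))) *
        (regGauss P k b (1 / ((n : ℝ) + 1)) y : ℂ)
  let G : E N → ℂ := fun y => (polyFun (TPoly P k i p) y - 2 * b * polyFun (X i * p) y) *
    (regGauss P k b 0 y : ℂ)
  have hε : ∀ n : ℕ, (0 : ℝ) < 1 / ((n : ℝ) + 1) := fun n => by positivity
  have hε1 : ∀ n : ℕ, 1 / ((n : ℝ) + 1) ≤ 1 := fun n => by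
    rw [div_le_one (by positivity)]
    have : (0 : ℝ) ≤ n := n.cast_nonneg
    linarith
  have hF0 : ∀ n, ∫ y, F n y = 0 := fun n => integral_regularized hP hb (hε n) i p
  -- Dominated convergence with the density at ε = 1: the weight increases with ε, and the
  -- regularizing factors lie in [0, 1].
  have hlim : Tendsto (fun n => ∫ y, F n y) atTop (𝓝 (∫ y, G y)) := by
    let bound : E N → ℝ := fun y => (‖polyFun (MvPolynomial.pderiv i p) y‖ +
      ‖2 * (b : ℂ)‖ * ‖polyFun (X i * p) y‖ +
        ∑ α ∈ P, ‖(k α * α i : ℂ)‖ * ‖polyFun (divDiff α p) y‖) * regGauss P k b 1 y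
    have hreg : ∀ ε, 0 ≤ ε → ∀ y, 0 ≤ regGauss P k b ε y := fun ε hε y =>
      mul_nonneg (Real.exp_pos _).le (regWeight_nonneg P k hε y)
    have hIn : ∀ p : Poly N, Integrable fun y => ‖polyFun p y‖ * regGauss P k b 1 y := fun p => by
      refine (hI 1 zero_le_one p).norm.congr (Eventually.of_forall fun y => ?_)
      simp only [norm_mul, Complex.norm_real, Real.norm_of_nonneg (hreg 1 zero_le_one y)]
    refine tendsto_integral_of_dominated_convergence bound (fun n => ?_) ?_
      (fun n => Eventually.of_forall fun y => ?_) (Eventually.of_forall fun y => ?_)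
    · refine Continuous.aestronglyMeasurable ?_
      refine Continuous.mul ?_ (Complex.continuous_ofReal.comp ?_)
      · refine ((continuous_polyFun _).sub (continuous_const.mul (continuous_polyFun _))).add
          (continuous_finsetSum _ fun α _ => continuous_const.mul
            ((continuous_polyFun _).mul (Complex.continuous_ofReal.comp ?_)))
        exact Continuous.mul (by fun_prop) (continuous_regInv (hε n) α)
      · exact Continuous.mul (by fun_prop) (continuous_regWeight hP.nonneg _)
    · simp only [bound, add_mul, Finset.sum_mul, mul_assoc]
      exact ((hIn _).add ((hIn _).const_mul _)).add
        (integrable_finsetSum _ fun α _ => (hIn _).const_mul _)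
    · simp only [F, bound, norm_mul (_ + _ : ℂ), Complex.norm_real,
        Real.norm_of_nonneg (hreg _ (hε n).le y)]
      refine mul_le_mul ?_ (mul_le_mul_of_nonneg_left
        (regWeight_mono hP.nonneg (hε n).le (hε1 n) y) (Real.exp_pos _).le) (hreg _ (hε n).le y)
        (by positivity)
      refine (norm_add_le _ _).trans (add_le_add ((norm_sub_le _ _).trans
        (add_le_add le_rfl (norm_mul_le _ _))) (norm_sum_le_of_le _ fun α _ => ?_))
      rw [norm_mul]
      refine mul_le_mul_of_nonneg_left ?_ (norm_nonneg _)
      rw [norm_mul, Complex.norm_real, Real.norm_of_nonneg (inner_mul_regInv_nonneg (hε n) α y)]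
      exact mul_le_of_le_one_right (norm_nonneg _) (inner_mul_regInv_le_one (hε n) α y)
    · have hG : G y = (polyFun (MvPolynomial.pderiv i p) y - 2 * b * polyFun (X i * p) y) *
          (regGauss P k b 0 y : ℂ) + ∑ α ∈ P, (α i * polyFun (divDiff α p) y) *
            ((k α * 1 * regGauss P k b 0 y : ℝ) : ℂ) := by
        have : polyFun (TPoly P k i p) y = polyFun (MvPolynomial.pderiv i p) y +
            ∑ α ∈ P, (k α * α i : ℂ) * polyFun (divDiff α p) y := by
          rw [TPoly_apply]; simp [polyFun]
        simp only [G, this]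
        rw [add_sub_right_comm, add_mul, Finset.sum_mul]
        congr 1
        exact Finset.sum_congr rfl fun α _ => by push_cast; ring
      have hFn : ∀ n, F n y = (polyFun (MvPolynomial.pderiv i p) y -
          2 * b * polyFun (X i * p) y) * (regGauss P k b (1 / ((n : ℝ) + 1)) y : ℂ) +
          ∑ α ∈ P, (α i * polyFun (divDiff α p) y) *
            ((k α * (⟪α, y⟫ * regInv (1 / ((n : ℝ) + 1)) α y) *
              regGauss P k b (1 / ((n : ℝ) + 1)) y : ℝ) : ℂ) := by
        intro n
        simp only [F]
        rw [add_mul, Finset.sum_mul]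
        congr 1
        exact Finset.sum_congr rfl fun α _ => by
          rw [Complex.ofReal_mul (k α * _), Complex.ofReal_mul (k α)]; ring
      rw [hG]
      simp only [hFn]
      refine Tendsto.add (Tendsto.const_mul _ ?_) (tendsto_finsetSum _ fun α hα =>
        Tendsto.const_mul _ ?_)
      · exact (Complex.continuous_ofReal.tendsto _).comp (tendsto_regGauss hP.nonneg b y)
      · exact (Complex.continuous_ofReal.tendsto _).comp (tendsto_regularized hP.nonneg b hα y)
  simp only [hF0] at hlim
  have h0 : ∫ y, G y = 0 := tendsto_nhds_unique hlim tendsto_const_nhds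
  simp only [G, sub_mul, mul_assoc (_ * _ : ℂ) _ (regGauss P k b 0 _ : ℂ)] at h0
  rw [integral_sub (hI 0 le_rfl _) ((hI 0 le_rfl _).const_mul _), integral_const_mul] at h0
  exact sub_eq_zero.1 h0

end weight

end

section

open MvPolynomial Filter Topology

/-! ### Integration of polynomials against the Gaussian measure -/

section gaussian

variable {P : Finset (E N)} {k : E N → ℝ}

theorem eval_zero_of_isHomogeneous {n : ℕ} (hn : n ≠ 0) {p : Poly N} (hp : p.IsHomogeneous n) :
    MvPolynomial.eval 0 p = 0 := by
  have h := hp.coeff_eq_zero (d := 0) (by simpa using hn.symm)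
  rwa [← constantCoeff_eq, ← eval_zero] at h

/-- Components of positive degree vanish at the origin. The density of P_t(0, ·) is therefore
explicit, and positivity of K elsewhere is not needed. -/
theorem K_zero_left (hP : IsPositiveSystem P k) (w : Fin N → ℂ) : K P k 0 w = 1 := by
  change ∑' n, MvPolynomial.eval 0 (kerComp P k w n) = 1
  rw [tsum_eq_single 0 fun n hn => eval_zero_of_isHomogeneous hn (isHomogeneous_kerComp hP w n),
    kerComp_zero hP, map_one]

theorem weight_nonneg (P : Finset (E N)) (k : E N → ℝ) (y : E N) : 0 ≤ weight P k y := by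
  rw [← regWeight_zero]; exact regWeight_nonneg P k le_rfl y

/-- The normalization constant of the Gaussian measure. -/
def gaussConst (P : Finset (E N)) (k : E N → ℝ) (t : ℝ) : ℝ :=
  ck P k / (4 * t) ^ (gam P k + N / 2)

theorem gaussConst_nonneg (P : Finset (E N)) (k : E N → ℝ) {t : ℝ} (ht : 0 < t) :
    0 ≤ gaussConst P k t :=
  div_nonneg (inv_nonneg.2 (integral_nonneg fun y =>
    mul_nonneg (Real.exp_pos _).le (weight_nonneg P k y))) (by positivity)

theorem heatKernel_zero_mul_weight (hP : IsPositiveSystem P k) (t : ℝ) (y : E N) :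
    heatKernel P k 0 y t * weight P k y = gaussConst P k t * regGauss P k (4 * t)⁻¹ 0 y := by
  have h0 : toC ((√(2 * t))⁻¹ • (0 : E N)) = 0 := by ext; simp [toC]
  rw [heatKernel, h0, K_zero_left hP, regGauss, regWeight_zero, gaussConst]
  have : -(‖(0 : E N)‖ ^ 2 + ‖y‖ ^ 2) / (4 * t) = -(4 * t)⁻¹ * ‖y‖ ^ 2 := by
    rw [norm_zero]; ring
  rw [this, Complex.one_re]
  ring

theorem regGauss_nonneg (P : Finset (E N)) (k : E N → ℝ) (b : ℝ) {ε : ℝ} (hε : 0 ≤ ε) (y : E N) :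
    0 ≤ regGauss P k b ε y :=
  mul_nonneg (Real.exp_pos _).le (regWeight_nonneg P k hε y)

theorem continuous_regGauss (hk : ∀ α ∈ P, 0 ≤ k α) (b ε : ℝ) :
    Continuous (regGauss P k b ε) :=
  Continuous.mul (by fun_prop) (continuous_regWeight hk ε)

theorem gaussian_zero_eq (hP : IsPositiveSystem P k) (t : ℝ) :
    gaussian P k t 0 = volume.withDensity fun y =>
      ENNReal.ofReal (gaussConst P k t * regGauss P k (4 * t)⁻¹ 0 y) := by
  simp only [gaussian, heatKernel_zero_mul_weight hP]

theorem measurable_gaussDensity (hP : IsPositiveSystem P k) (t : ℝ) : Measurable fun y =>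
    ENNReal.ofReal (gaussConst P k t * regGauss P k (4 * t)⁻¹ 0 y) :=
  ENNReal.measurable_ofReal.comp
    (continuous_const.mul (continuous_regGauss hP.nonneg _ 0)).measurable

theorem toReal_gaussDensity {t : ℝ} (ht : 0 < t) (y : E N) :
    (ENNReal.ofReal (gaussConst P k t * regGauss P k (4 * t)⁻¹ 0 y)).toReal =
      gaussConst P k t * regGauss P k (4 * t)⁻¹ 0 y :=
  ENNReal.toReal_ofReal (mul_nonneg (gaussConst_nonneg P k ht) (regGauss_nonneg P k _ le_rfl y))

theorem integrable_polyFun_gaussian (hP : IsPositiveSystem P k) {t : ℝ} (ht : 0 < t)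
    (p : Poly N) : Integrable (polyFun p) (gaussian P k t 0) := by
  rw [gaussian_zero_eq hP, integrable_withDensity_iff_integrable_smul'
    (measurable_gaussDensity hP t) (Eventually.of_forall fun y => ENNReal.ofReal_lt_top)]
  refine ((integrable_mul_regGauss hP.nonneg (b := (4 * t)⁻¹) (by positivity) le_rfl
    (subGaussian_polyFun p) (continuous_polyFun p)).const_mul (gaussConst P k t : ℂ)).congr
    (Eventually.of_forall fun y => ?_)
  simp only [toReal_gaussDensity ht, Complex.real_smul]
  push_cast
  ring

theorem integral_polyFun_gaussian (hP : IsPositiveSystem P k) {t : ℝ} (ht : 0 < t)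
    (p : Poly N) : ∫ y, polyFun p y ∂(gaussian P k t 0) =
      gaussConst P k t * ∫ y, polyFun p y * (regGauss P k (4 * t)⁻¹ 0 y : ℂ) := by
  rw [gaussian_zero_eq hP, integral_withDensity_eq_integral_toReal_smul
    (measurable_gaussDensity hP t) (Eventually.of_forall fun y => ENNReal.ofReal_lt_top),
    ← integral_const_mul]
  congr 1
  ext y
  simp only [toReal_gaussDensity ht, Complex.real_smul]
  push_cast
  ring

theorem weight_smul (P : Finset (E N)) (k : E N → ℝ) {r : ℝ} (hr : 0 < r) (y : E N) :
    weight P k (r • y) = r ^ (2 * gam P k) * weight P k y := by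
  rw [weight, weight, gam, Finset.mul_sum, Real.rpow_sum_of_pos hr, ← Finset.prod_mul_distrib]
  refine Finset.prod_congr rfl fun α _ => ?_
  rw [inner_smul_right, abs_mul, abs_of_pos hr, Real.mul_rpow hr.le (abs_nonneg _)]

/-- Substitute y = √(4t) x: the weight is homogeneous of degree 2γ and Lebesgue measure contributes
N. -/
theorem integral_regGauss (P : Finset (E N)) (k : E N → ℝ) {t : ℝ} (ht : 0 < t) :
    ∫ y : E N, regGauss P k (4 * t)⁻¹ 0 y =
      (4 * t) ^ (gam P k + N / 2) * ∫ x : E N, Real.exp (-‖x‖ ^ 2) * weight P k x := by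
  set r := √(4 * t)
  have hr : 0 < r := Real.sqrt_pos.2 (by positivity)
  have hr2 : r ^ 2 = 4 * t := Real.sq_sqrt (by positivity)
  have h := Measure.integral_comp_smul (volume : Measure (E N)) (regGauss P k (4 * t)⁻¹ 0) r
  have h1 : ∀ x : E N, regGauss P k (4 * t)⁻¹ 0 (r • x) =
      r ^ (2 * gam P k) * (Real.exp (-‖x‖ ^ 2) * weight P k x) := by
    intro x
    have : -(4 * t)⁻¹ * ‖r • x‖ ^ 2 = -‖x‖ ^ 2 := by
      rw [norm_smul, mul_pow, Real.norm_of_nonneg hr.le, hr2]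
      field_simp
    rw [regGauss, regWeight_zero, weight_smul P k hr, this]
    ring
  simp only [h1] at h
  rw [integral_const_mul, finrank_euclideanSpace, Fintype.card_fin, smul_eq_mul,
    abs_of_pos (by positivity)] at h
  have h2 : (4 * t) ^ (gam P k + N / 2) = r ^ N * r ^ (2 * gam P k) := by
    rw [← hr2, ← Real.rpow_natCast r 2, ← Real.rpow_natCast r N, ← Real.rpow_mul hr.le,
      ← Real.rpow_add hr]
    congr 1
    push_cast
    ring
  rw [h2, mul_assoc, h, ← mul_assoc, mul_inv_cancel₀ (by positivity), one_mul]

/-- The properties of the functional `p ↦ ∫ p dP_t(0, ·)` that characterize it algebraically. -/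
structure IsGaussianFunctional (P : Finset (E N)) (k : E N → ℝ) (t : ℝ)
    (L : Poly N →ₗ[ℂ] ℂ) : Prop where
  apply_one : L 1 = 1
  apply_refl : ∀ α ∈ P, ∀ p, L (reflPoly α p) = L p
  apply_TPoly : ∀ i p, 2 * t * L (TPoly P k i p) = L (X i * p)

/-- Integration of polynomials against the Gaussian measure `P_t(0, ·)`. -/
def gaussLin (hP : IsPositiveSystem P k) {t : ℝ} (ht : 0 < t) : Poly N →ₗ[ℂ] ℂ where
  toFun p := ∫ y, polyFun p y ∂(gaussian P k t 0)
  map_add' p q := by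
    rw [← integral_add (integrable_polyFun_gaussian hP ht p) (integrable_polyFun_gaussian hP ht q)]
    simp [polyFun]
  map_smul' c p := by
    rw [RingHom.id_apply, smul_eq_mul, ← integral_const_mul]
    simp [polyFun, smul_eq_C_mul]

theorem isGaussianFunctional_gaussLin (hP : IsPositiveSystem P k) {β : E N}
    (hβ : ∀ α ∈ P, ⟪α, β⟫ ≠ 0) {t : ℝ} (ht : 0 < t) :
    IsGaussianFunctional P k t (gaussLin hP ht) where
  apply_one := by
    change ∫ y, polyFun 1 y ∂(gaussian P k t 0) = 1
    rw [integral_polyFun_gaussian hP ht]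
    have h1 : ∀ y : E N, polyFun 1 y * (regGauss P k (4 * t)⁻¹ 0 y : ℂ) =
        (regGauss P k (4 * t)⁻¹ 0 y : ℂ) := fun y => by simp [polyFun]
    simp only [h1]
    rw [integral_complex_ofReal, integral_regGauss P k ht, ← Complex.ofReal_mul, gaussConst,
      ck]
    have hpos : 0 < ∫ x : E N, Real.exp (-‖x‖ ^ 2) * weight P k x := by
      have hw : ∀ x : E N, Real.exp (-‖x‖ ^ 2) * weight P k x = regGauss P k 1 0 x := fun x => by
        rw [regGauss, regWeight_zero, neg_mul, one_mul]
      simp only [hw]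
      -- The point β lies on no root hyperplane, so the weight is nonzero there.
      refine integral_pos_of_integrable_nonneg_nonzero (x := β)
        (continuous_regGauss hP.nonneg 1 0) ?_ (regGauss_nonneg P k 1 le_rfl) ?_
      · have := (integrable_mul_regGauss hP.nonneg (b := 1) one_pos le_rfl
          (subGaussian_const 1) continuous_const).re
        simpa using this
      · refine mul_ne_zero (Real.exp_pos _).ne' (Finset.prod_ne_zero_iff.2 fun α hα => ?_)
        rw [add_zero]
        have := hβ α hα
        positivity
    have h4 : (0 : ℝ) < (4 * t) ^ (gam P k + N / 2) := by positivity
    rw [← Complex.ofReal_one]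
    congr 1
    field_simp
  apply_refl α hα p := by
    change ∫ y, polyFun _ y ∂(gaussian P k t 0) = ∫ y, polyFun _ y ∂(gaussian P k t 0)
    rw [integral_polyFun_gaussian hP ht, integral_polyFun_gaussian hP ht,
      ← integral_comp_reflVec α (hP.dot_self α hα)
        fun y => polyFun p y * (regGauss P k (4 * t)⁻¹ 0 y : ℂ)]
    simp only [polyFun_reflPoly, regGauss_reflVec hP hα]
  apply_TPoly i p := by
    change 2 * t * ∫ y, polyFun _ y ∂(gaussian P k t 0) = ∫ y, polyFun _ y ∂(gaussian P k t 0)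
    -- With b = 1/(4t) the constants cancel: 2t · 2b = 1.
    rw [integral_polyFun_gaussian hP ht, integral_polyFun_gaussian hP ht,
      integral_TPoly_mul_regGauss hP (by positivity)]
    have : (t : ℂ) ≠ 0 := by exact_mod_cast ht.ne'
    push_cast
    field_simp
    ring

end gaussian

end

section

open MvPolynomial

/-! ### Generating function of the Appell characters -/

/-- The coefficients of the power series `e^{s X²}`. -/
def gaussCoeff (s : ℂ) (b : ℕ) : ℂ := if Even b then s ^ (b / 2) / (b / 2)! else 0

theorem gaussCoeff_zero (s : ℂ) : gaussCoeff s 0 = 1 := by simp [gaussCoeff]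

theorem gaussCoeff_one (s : ℂ) : gaussCoeff s 1 = 0 := by simp [gaussCoeff]

theorem gaussCoeff_add_two (s : ℂ) (b : ℕ) :
    (b + 2) * gaussCoeff s (b + 2) = 2 * s * gaussCoeff s b := by
  rcases Nat.even_or_odd' b with ⟨c, rfl | rfl⟩
  · have h1 : (2 * c + 2) / 2 = c + 1 := by omega
    have h2 : 2 * c / 2 = c := by omega
    have h3 : Even (2 * c + 2) := ⟨c + 1, by ring⟩
    have h4 : Even (2 * c) := ⟨c, by ring⟩
    rw [gaussCoeff, gaussCoeff, if_pos h3, if_pos h4, h1, h2, Nat.factorial_succ]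
    have h5 : (c ! : ℂ) ≠ 0 := by exact_mod_cast c.factorial_ne_zero
    have h6 : (c + 1 : ℂ) ≠ 0 := by exact_mod_cast c.succ_ne_zero
    push_cast
    field_simp
    ring
  · have h3 : ¬ Even (2 * c + 1 + 2) := by
      rw [Nat.not_even_iff_odd]; exact ⟨c + 1, by ring⟩
    have h4 : ¬ Even (2 * c + 1) := by
      rw [Nat.not_even_iff_odd]; exact ⟨c, by ring⟩
    rw [gaussCoeff, gaussCoeff, if_neg h3, if_neg h4, mul_zero, mul_zero]

theorem gaussCoeff_sq_mul (c s : ℂ) (b : ℕ) :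
    gaussCoeff (c ^ 2 * s) b = c ^ b * gaussCoeff s b := by
  unfold gaussCoeff
  split_ifs with h
  · obtain ⟨d, rfl⟩ := h
    have : (d + d) / 2 = d := by omega
    rw [this, mul_pow, ← pow_mul, two_mul, mul_div_assoc]
  · simp

theorem eq_gaussCoeff {s : ℂ} {c : ℕ → ℂ} (h0 : c 0 = 1) (h1 : c 1 = 0)
    (h2 : ∀ a : ℕ, ((a : ℂ) + 2) * c (a + 2) = 2 * s * c a) (a : ℕ) : c a = gaussCoeff s a := by
  have : c a = gaussCoeff s a ∧ c (a + 1) = gaussCoeff s (a + 1) := by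
    induction a with
    | zero => exact ⟨by rw [h0, gaussCoeff_zero], by rw [zero_add, h1, gaussCoeff_one]⟩
    | succ a ih =>
      refine ⟨ih.2, ?_⟩
      have ha : (a : ℂ) + 2 ≠ 0 := by exact_mod_cast (a + 1).succ_ne_zero
      exact mul_left_cancel₀ ha (by rw [h2, gaussCoeff_add_two, ih.1])
  exact this.1

/-- The coefficient form of e^{sX²} e^{-sX²} = 1: the formal derivative of the product is zero. -/
theorem sum_gaussCoeff_mul (s : ℂ) (n : ℕ) :
    ∑ ab ∈ Finset.HasAntidiagonal.antidiagonal (n + 1),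
      gaussCoeff s ab.1 * gaussCoeff (-s) ab.2 = 0 := by
  have hd : ∀ s, PowerSeries.derivative ℂ (PowerSeries.mk (gaussCoeff s)) =
      PowerSeries.C (2 * s) * (PowerSeries.X * PowerSeries.mk (gaussCoeff s)) := by
    intro s
    ext m
    rw [PowerSeries.coeff_derivative, PowerSeries.coeff_C_mul]
    cases m with
    | zero => simp [gaussCoeff_one]
    | succ m =>
      rw [PowerSeries.coeff_succ_X_mul, PowerSeries.coeff_mk, PowerSeries.coeff_mk,
        ← gaussCoeff_add_two]
      push_cast
      ring
  have h : PowerSeries.derivative ℂ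
      (PowerSeries.mk (gaussCoeff s) * PowerSeries.mk (gaussCoeff (-s))) = 0 := by
    rw [Derivation.leibniz, hd, hd, smul_eq_mul, smul_eq_mul, mul_neg, map_neg]
    ring
  have h2 := congrArg (PowerSeries.coeff n) h
  rw [PowerSeries.coeff_derivative, map_zero,
    PowerSeries.coeff_mul] at h2
  have hn : (n : ℂ) + 1 ≠ 0 := by exact_mod_cast n.succ_ne_zero
  simpa using (mul_eq_zero.1 h2).resolve_right hn

section appell

variable {P : Finset (E N)} {k : E N → ℝ} {t : ℝ}

/-- The component of degree `n` in `w` of `e^{-t ⟨w, w⟩} K(·, w)`. -/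
def appellGen (P : Finset (E N)) (k : E N → ℝ) (t : ℝ) (w : Fin N → ℂ) (n : ℕ) : Poly N :=
  ∑ ab ∈ Finset.HasAntidiagonal.antidiagonal n,
    C (gaussCoeff (-(t * ∑ i, w i ^ 2)) ab.2) * kerComp P k w ab.1

theorem appellGen_zero (hP : IsPositiveSystem P k) (t : ℝ) (w : Fin N → ℂ) :
    appellGen P k t w 0 = 1 := by
  simp [appellGen, gaussCoeff_zero, kerComp_zero hP]

theorem TPoly_C_mul (P : Finset (E N)) (k : E N → ℝ) (i : Fin N) (c : ℂ) (p : Poly N) :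
    TPoly P k i (C c * p) = C c * TPoly P k i p := by
  rw [← smul_eq_C_mul, map_smul, smul_eq_C_mul]

/-- The Gaussian factor depends on w alone, so the eigenfunction property of K carries over. -/
theorem TPoly_appellGen_succ (hP : IsPositiveSystem P k) (t : ℝ) (w : Fin N → ℂ) (n : ℕ)
    (i : Fin N) :
    TPoly P k i (appellGen P k t w (n + 1)) = C (w i) * appellGen P k t w n := by
  have h0 : TPoly P k i (kerComp P k w 0) = 0 := by
    rw [kerComp_zero hP, ← C_1, TPoly_C hP.dot_self]
  rw [appellGen, map_sum, Finset.Nat.sum_antidiagonal_succ, TPoly_C_mul, h0, mul_zero, zero_add,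
    appellGen, Finset.mul_sum _ _ (C (w i))]
  refine Finset.sum_congr rfl fun ab _ => ?_
  rw [TPoly_C_mul, TPoly_kerComp_succ hP, mul_left_comm]

/-! ### Pairing the generating function with the Gaussian functional. -/

variable {L : Poly N →ₗ[ℂ] ℂ}

theorem map_C_mul_poly (L : Poly N →ₗ[ℂ] ℂ) (c : ℂ) (p : Poly N) : L (C c * p) = c * L p := by
  rw [← smul_eq_C_mul, map_smul, smul_eq_mul]

/-- Apply L to the recursion for K_{a+1}: reflection invariance removes the terms 1 - σ_α, and
multiplication by x_i becomes 2t T_i. -/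
theorem IsGaussianFunctional.kerComp_rec (hP : IsPositiveSystem P k)
    (hL : IsGaussianFunctional P k t L) (w : Fin N → ℂ) (a : ℕ) :
    ((a : ℂ) + 1) * L (kerComp P k w (a + 1)) =
      ∑ i, w i * (2 * t * L (TPoly P k i (kerComp P k w a))) := by
  have h := congrArg L (eulerOp_kerComp_succ hP w a)
  simp only [eulerOp, map_add, map_sum, map_C_mul_poly, map_sub] at h
  have h0 : ∑ α ∈ P, (k α : ℂ) * (L (kerComp P k w (a + 1)) -
      L (reflPoly α (kerComp P k w (a + 1)))) = 0 :=
    Finset.sum_eq_zero fun α hα => by rw [hL.apply_refl α hα, sub_self, mul_zero]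
  rw [h0, add_zero, Finset.sum_mul, map_sum] at h
  push_cast at h
  rw [h]
  refine Finset.sum_congr rfl fun i _ => ?_
  rw [mul_assoc, map_C_mul_poly, hL.apply_TPoly]

/-- Degree by degree this is L(K(·, w)) = e^{t⟨w,w⟩}. Using T_i K_{a+1} = w_i K_a once more gives a
two-step recursion that characterizes the coefficients of the Gaussian. -/
theorem IsGaussianFunctional.map_kerComp (hP : IsPositiveSystem P k)
    (hL : IsGaussianFunctional P k t L) (w : Fin N → ℂ) (a : ℕ) :
    L (kerComp P k w a) = gaussCoeff (t * ∑ i, w i ^ 2) a := by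
  refine eq_gaussCoeff (c := fun a => L (kerComp P k w a)) ?_ ?_ (fun a => ?_) a
  · simp only [kerComp_zero hP, hL.apply_one]
  · have h := hL.kerComp_rec hP w 0
    have h0 : ∀ i, TPoly P k i (kerComp P k w 0) = 0 := fun i => by
      rw [kerComp_zero hP, ← C_1, TPoly_C hP.dot_self]
    simpa [h0] using h
  · have h := hL.kerComp_rec hP w (a + 1)
    simp only [TPoly_kerComp_succ hP, map_C_mul_poly] at h
    push_cast at h
    have e : (a : ℂ) + 2 = a + 1 + 1 := by ring
    simp only [e]
    rw [h, Finset.mul_sum, Finset.mul_sum, Finset.sum_mul]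
    exact Finset.sum_congr rfl fun i _ => by ring

theorem IsGaussianFunctional.map_appellGen_succ (hP : IsPositiveSystem P k)
    (hL : IsGaussianFunctional P k t L) (w : Fin N → ℂ) (n : ℕ) :
    L (appellGen P k t w (n + 1)) = 0 := by
  rw [appellGen, map_sum, ← sum_gaussCoeff_mul (t * ∑ i, w i ^ 2) n]
  exact Finset.sum_congr rfl fun ab _ => by
    rw [map_C_mul_poly, hL.map_kerComp hP, mul_comm]

/-- The Leibniz rule holds under L: the twist σ_α p · Δ_α q has the same value as p · Δ_α q, because
L and the difference quotient Δ_α q are σ_α-invariant. -/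
theorem IsGaussianFunctional.map_X_mul_mul (hP : IsPositiveSystem P k)
    (hL : IsGaussianFunctional P k t L) (i : Fin N) (p q : Poly N) :
    L (X i * (p * q)) = 2 * t * (L (TPoly P k i p * q) + L (p * TPoly P k i q)) := by
  rw [← hL.apply_TPoly, ← map_add]
  congr 1
  have h : ∀ α ∈ P, L (C (k α * α i : ℂ) * divDiff α (p * q)) =
      L (C (k α * α i : ℂ) * (divDiff α p * q + p * divDiff α q)) := by
    intro α hα
    have hα2 := hP.dot_self α hα
    rw [map_C_mul_poly, map_C_mul_poly, divDiff_mul α hα2, map_add, map_add,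
      ← hL.apply_refl α hα (p * divDiff α q), map_mul (reflPoly α), reflPoly_divDiff_self α hα2]
  simp only [TPoly_apply, map_add, map_sum, add_mul, mul_add, Finset.sum_mul, Finset.mul_sum]
  rw [Finset.sum_congr rfl h, pderiv_mul, map_add]
  simp only [mul_add, map_add, Finset.sum_add_distrib]
  have e1 : ∀ α ∈ P, L (C (k α * α i : ℂ) * divDiff α p * q) =
      L (C (k α * α i : ℂ) * (divDiff α p * q)) := fun α _ => by rw [mul_assoc]
  have e2 : ∀ α ∈ P, L (p * (C (k α * α i : ℂ) * divDiff α q)) =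
      L (C (k α * α i : ℂ) * (p * divDiff α q)) := fun α _ => by rw [mul_left_comm]
  rw [Finset.sum_congr rfl e1, Finset.sum_congr rfl e2]
  ring

/-- The generating function of the Appell characters reproduces polynomials. -/
theorem IsGaussianFunctional.map_mul_appellGen (hP : IsPositiveSystem P k)
    (hL : IsGaussianFunctional P k t L) (w : Fin N → ℂ) (m : ℕ) {q : Poly N}
    (hq : q.IsHomogeneous m) {n : ℕ} (hmn : m ≤ n) :
    L (q * appellGen P k t w n) = if m = n then (2 * t) ^ n * MvPolynomial.eval w q else 0 := by
  induction m using Nat.strong_induction_on generalizing q n with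
  | _ m IH =>
  -- The outer strong induction is needed because T_i q drops in degree: its pairing with A_n
  -- vanishes by the case of smaller degree. The bound j ≤ m makes that case available.
  refine homogeneous_induction (motive := fun j q => j ≤ m → ∀ n, j ≤ n →
    L (q * appellGen P k t w n) = if j = n then (2 * t) ^ n * MvPolynomial.eval w q else 0)
    (fun c _ n _ => ?_) (fun j _ n _ => ?_) (fun j p q hp hq hj n hn => ?_)
    (fun j i q hq ih hj n hn => ?_) hq le_rfl n hmn
  · rw [map_C_mul_poly]
    cases n with
    | zero => simp [appellGen_zero hP, hL.apply_one]
    | succ n => simp [hL.map_appellGen_succ hP]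
  · simp
  · rw [add_mul, map_add, hp hj n hn, hq hj n hn]
    split_ifs
    · rw [map_add]; ring
    · simp
  · obtain ⟨l, rfl⟩ : ∃ l, n = l + 1 := ⟨n - 1, by omega⟩
    rw [mul_assoc, hL.map_X_mul_mul hP, TPoly_appellGen_succ hP, mul_left_comm q, map_C_mul_poly,
      ih (by omega) l (by omega),
      IH (j - 1) (by omega) (isHomogeneous_TPoly hP.dot_self i hq) (by omega),
      if_neg (by omega)]
    by_cases h : j = l
    · rw [if_pos h, if_pos (by omega), map_mul, eval_X]
      ring
    · rw [if_neg h, if_neg (by omega)]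
      ring

end appell

end

section

open MvPolynomial

/-! ### Powers of families of operators -/

theorem opPow_eq_foldr {F : Type*} (A : Fin N → F → F) (ν : Fin N → ℕ) :
    opPow A ν = ((List.finRange N).map fun i => (A i)^[ν i]).foldr (· ∘ ·) id := by
  rw [opPow, List.ofFn_eq_map]

/-- Transfers operator monomials between two descriptions: functions and series, or Dunkl operators
on V p and partial derivatives on p. -/
theorem opPow_rel {F G : Type*} {A : Fin N → F → F} {B : Fin N → G → G} (r : F → G → Prop)
    (h : ∀ i f g, r f g → r (A i f) (B i g)) (ν : Fin N → ℕ) {f : F} {g : G} (hfg : r f g) :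
    r (opPow A ν f) (opPow B ν g) := by
  rw [opPow_eq_foldr, opPow_eq_foldr]
  induction List.finRange N with
  | nil => exact hfg
  | cons i l ih =>
    simp only [List.map_cons, List.foldr_cons, Function.comp_apply]
    induction ν i with
    | zero => exact ih
    | succ m ihm =>
      rw [Function.iterate_succ_apply', Function.iterate_succ_apply']
      exact h i _ _ ihm

/-- Each operator lowers the degree by one and hence shifts a sequence indexed by degree; the shifts
add up to |ν|. -/
theorem opPow_shift {G : Type*} (B : Fin N → G → G) (ν : Fin N → ℕ) (Q : ℕ → G) (n : ℕ) :
    opPow (fun i (Q : ℕ → G) n => B i (Q (n + 1))) ν Q n = opPow B ν (Q (n + deg ν)) := by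
  have hdeg : deg ν = ((List.finRange N).map ν).sum := by
    rw [deg, ← List.sum_ofFn, List.ofFn_eq_map]
  rw [opPow_eq_foldr, opPow_eq_foldr, hdeg]
  have hit : ∀ i m (Q : ℕ → G) n, (fun (Q : ℕ → G) n => B i (Q (n + 1)))^[m] Q n =
      (B i)^[m] (Q (n + m)) := by
    intro i m
    induction m with
    | zero => intro Q n; rfl
    | succ m ih =>
      intro Q n
      rw [Function.iterate_succ_apply', ih, Function.iterate_succ_apply']
      congr 3
      ring
  induction List.finRange N generalizing n with
  | nil => rfl
  | cons i l ih =>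
    simp only [List.map_cons, List.foldr_cons, Function.comp_apply, List.sum_cons]
    rw [hit, ih, add_assoc]

theorem exists_linearMap_opPow (B : Fin N → Poly N →ₗ[ℂ] Poly N) (ν : Fin N → ℕ) :
    ∃ Λ : Poly N →ₗ[ℂ] Poly N, ∀ p, opPow (fun i => B i) ν p = Λ p := by
  rw [opPow_eq_foldr]
  induction List.finRange N with
  | nil => exact ⟨LinearMap.id, fun p => rfl⟩
  | cons i l ih =>
    obtain ⟨Λ, hΛ⟩ := ih
    refine ⟨(B i ^ ν i) ∘ₗ Λ, fun p => ?_⟩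
    simp only [List.map_cons, List.foldr_cons, Function.comp_apply, hΛ, LinearMap.comp_apply,
      Module.End.pow_apply]

/-- The multi-index `κ` as a finitely supported function. -/
def toFinsupp (κ : Fin N → ℕ) : Fin N →₀ ℕ := Finsupp.equivFunOnFinite.symm κ

@[simp]
theorem toFinsupp_apply (κ : Fin N → ℕ) (i : Fin N) : toFinsupp κ i = κ i := rfl

theorem degree_toFinsupp (κ : Fin N → ℕ) : (toFinsupp κ).degree = deg κ := by
  rw [Finsupp.degree_eq_sum]; rfl

theorem eval_zero_opPow_pderiv (ν : Fin N → ℕ) (p : Poly N) :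
    MvPolynomial.eval 0 (opPow (fun i p => MvPolynomial.pderiv i p) ν p) =
      fact ν * coeff (toFinsupp ν) p := by
  -- Starting from exponent 0 in x_i, the factors produced by m derivatives are 1, …, m.
  have hit : ∀ i m (p : Poly N) (κ : Fin N →₀ ℕ), κ i = 0 →
      coeff κ ((fun p => MvPolynomial.pderiv i p)^[m] p) =
        m ! * coeff (κ + Finsupp.single i m) p := by
    intro i m
    induction m with
    | zero => intro p κ _; simp
    | succ m ih =>
      intro p κ hκ
      rw [Function.iterate_succ_apply, ih _ _ hκ, coeff_pderiv, add_assoc, ← Finsupp.single_add,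
        Nat.factorial_succ]
      simp [hκ]
      ring
  have key : ∀ l : List (Fin N), l.Nodup → ∀ κ : Fin N →₀ ℕ, (∀ i ∈ l, κ i = 0) →
      coeff κ (((l.map fun i => (fun p : Poly N => MvPolynomial.pderiv i p)^[ν i]).foldr
        (· ∘ ·) id) p) = (l.map fun i => ((ν i)! : ℂ)).prod *
          coeff (κ + (l.map fun i => Finsupp.single i (ν i)).sum) p := by
    intro l
    induction l with
    | nil => intro _ κ _; simp
    | cons i l ih =>
      intro hl κ hκ
      rw [List.nodup_cons] at hl
      simp only [List.map_cons, List.foldr_cons, Function.comp_apply, List.prod_cons,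
        List.sum_cons]
      rw [hit i _ _ _ (hκ i (by simp)), ih hl.2, add_assoc, mul_assoc]
      intro j hj
      have hji : j ≠ i := fun h => hl.1 (h ▸ hj)
      simp [hκ j (by simp [hj]), hji]
  have h := key (List.finRange N) (List.nodup_finRange N) 0 (fun _ _ => rfl)
  rw [← opPow_eq_foldr, zero_add, ← List.ofFn_eq_map, List.prod_ofFn, ← List.ofFn_eq_map,
    List.sum_ofFn] at h
  have e : ∑ i, Finsupp.single i (ν i) = toFinsupp ν := by
    ext j
    simp [Finsupp.finsetSum_apply, Finsupp.single_apply]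
  rw [e] at h
  rw [eval_zero, constantCoeff_eq, h, fact]
  push_cast
  rfl

section

variable {P : Finset (E N)} {k : E N → ℝ} {t : ℝ}

/-- Only one homogeneous component contributes to `T^ν f` at the origin. -/
theorem opPow_T_seriesFun_zero (hP : ∀ α ∈ P, dot α α = 2) (k : E N → ℝ) {Q : ℕ → Poly N}
    (hQ : IsEntireSeries Q) (ν : Fin N → ℕ) :
    opPow (T P k) ν (seriesFun Q) 0 =
      MvPolynomial.eval 0 (opPow (fun i => TPoly P k i) ν (Q (deg ν))) := by
  have h := opPow_rel (A := T P k)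
    (B := fun i (Q : ℕ → Poly N) n => TPoly P k i (Q (n + 1)))
    (fun f Q => f = seriesFun Q ∧ IsEntireSeries Q)
    (fun i f Q hf => ⟨by rw [hf.1, hf.2.T_seriesFun hP], hf.2.TPoly_succ hP k i⟩) ν
    (f := seriesFun Q) (g := Q) ⟨rfl, hQ⟩
  rw [h.1]
  have h0 : toC (0 : E N) = 0 := by ext; simp [toC]
  rw [seriesFun, tsum_eq_single 0 fun n hn => by
    rw [polyFun, h0]
    exact eval_zero_of_isHomogeneous hn (h.2.homogeneous n)]
  rw [opPow_shift (fun i => TPoly P k i), zero_add, polyFun, h0]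

theorem opPow_pderiv_seriesFun_zero {Q : ℕ → Poly N} (hQ : IsEntireSeries Q) (ν : Fin N → ℕ) :
    opPow pderiv ν (seriesFun Q) 0 = fact ν * coeff (toFinsupp ν) (Q (deg ν)) := by
  -- Partial derivatives are the Dunkl operators of the empty root system.
  have e : (pderiv : Fin N → (E N → ℂ) → E N → ℂ) = T ∅ 0 := by
    ext i f x
    simp [T]
  have e2 : (fun (i : Fin N) => ⇑(TPoly ∅ 0 i)) = fun i (p : Poly N) => MvPolynomial.pderiv i p := by
    ext i p : 2
    simp [TPoly_apply]
  rw [e, opPow_T_seriesFun_zero (by simp) _ hQ, e2, eval_zero_opPow_pderiv]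

theorem monoX_eq_monomial (κ : Fin N → ℕ) : monoX κ = monomial (toFinsupp κ) 1 := by
  rw [monomial_eq, C_1, one_mul, Finsupp.prod_fintype _ _ fun _ => pow_zero _]
  rfl

theorem isHomogeneous_monoX (κ : Fin N → ℕ) : (monoX κ).IsHomogeneous (deg κ) := by
  rw [monoX_eq_monomial]
  exact isHomogeneous_monomial _ (degree_toFinsupp κ)

theorem coeff_monoX (κ ν : Fin N → ℕ) :
    coeff (toFinsupp ν) (monoX κ) = if κ = ν then 1 else 0 := by
  rw [monoX_eq_monomial, coeff_monomial]
  simp only [toFinsupp, EmbeddingLike.apply_eq_iff_eq]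

theorem mem_piAntidiag_univ {κ : Fin N → ℕ} {n : ℕ} :
    κ ∈ Finset.piAntidiag Finset.univ n ↔ deg κ = n := by
  simp [Finset.mem_piAntidiag, deg]

theorem homogeneous_eq_sum {n : ℕ} {u : Poly N} (hu : u.IsHomogeneous n) :
    u = ∑ κ ∈ Finset.piAntidiag Finset.univ n, C (coeff (toFinsupp κ) u) * monoX κ := by
  ext m
  obtain ⟨ν, rfl⟩ : ∃ ν, m = toFinsupp ν := ⟨m, by ext; rfl⟩
  simp only [coeff_sum, coeff_C_mul, coeff_monoX]
  by_cases h : deg ν = n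
  · rw [Finset.sum_eq_single ν]
    · simp
    · intro κ _ hκ
      simp [hκ]
    · intro hν
      exact absurd (mem_piAntidiag_univ.2 h) hν
  · rw [hu.coeff_eq_zero (by rwa [degree_toFinsupp]), Finset.sum_eq_zero]
    intro κ hκ
    have : κ ≠ ν := fun h' => h (h' ▸ mem_piAntidiag_univ.1 hκ)
    simp [this]

theorem eval_smul_of_isHomogeneous {n : ℕ} {p : Poly N} (hp : p.IsHomogeneous n) (c : ℂ)
    (z : Fin N → ℂ) :
    MvPolynomial.eval (fun i => c * z i) p = c ^ n * MvPolynomial.eval z p := by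
  refine homogeneous_induction (motive := fun n p => MvPolynomial.eval (fun i => c * z i) p =
    c ^ n * MvPolynomial.eval z p) (by simp) (by simp) (fun n p q hp hq => ?_)
    (fun n i q _ ih => ?_) hp
  · rw [map_add, map_add, hp, hq, mul_add]
  · rw [map_mul, map_mul, eval_X, eval_X, ih, pow_succ]
    ring

/-! ### The Gaussian as a series of polynomials -/

/-- The component of degree `b` of `e^{c |x|²}`. -/
def gaussPoly (c : ℂ) (b : ℕ) : Poly N :=
  if Even b then C (c ^ (b / 2) / (b / 2)!) * (∑ i, X i ^ 2) ^ (b / 2) else 0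

theorem eval_gaussPoly (c : ℂ) (b : ℕ) (w : Fin N → ℂ) :
    MvPolynomial.eval w (gaussPoly c b) = gaussCoeff (c * ∑ i, w i ^ 2) b := by
  unfold gaussPoly gaussCoeff
  split_ifs
  · simp [mul_pow]
    ring
  · simp

theorem isHomogeneous_gaussPoly (c : ℂ) (b : ℕ) : (gaussPoly c b : Poly N).IsHomogeneous b := by
  unfold gaussPoly
  split_ifs with h
  · have h2 : (∑ i, X i ^ 2 : Poly N).IsHomogeneous 2 :=
      IsHomogeneous.sum _ _ _ fun i _ => isHomogeneous_X_pow i 2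
    have := (h2.pow (b / 2)).C_mul (c ^ (b / 2) / (b / 2)!)
    rwa [Nat.two_mul_div_two_of_even h] at this
  · exact isHomogeneous_zero _ _ _

theorem hasSum_gaussCoeff (s : ℂ) : HasSum (gaussCoeff s) (Complex.exp s) := by
  have h1 : HasSum (fun n : ℕ => s ^ n / n !) (Complex.exp s) := by
    rw [Complex.exp_eq_exp_ℂ]
    exact NormedSpace.expSeries_div_hasSum_exp s
  have hinj : Function.Injective fun n : ℕ => 2 * n := fun a b h => by
    simpa using h
  rw [← hinj.hasSum_iff]
  · have e : (gaussCoeff s ∘ fun n : ℕ => 2 * n) = fun n : ℕ => s ^ n / n ! := by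
      ext n
      simp [gaussCoeff]
    rw [e]
    exact h1
  · intro b hb
    have : ¬ Even b := fun ⟨c, hc⟩ => hb ⟨c, by simp [hc, two_mul]⟩
    simp [gaussCoeff, this]

theorem norm_gaussCoeff_le {s : ℂ} {R : ℝ} (h : ‖s‖ ≤ R) (b : ℕ) :
    ‖gaussCoeff s b‖ ≤ ‖gaussCoeff R b‖ := by
  unfold gaussCoeff
  split_ifs
  · rw [norm_div, norm_div, norm_pow, norm_pow, Complex.norm_real,
      Real.norm_of_nonneg ((norm_nonneg s).trans h)]
    gcongr
  · exact le_rfl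

theorem isEntireSeries_gaussPoly (c : ℂ) : IsEntireSeries (gaussPoly c : ℕ → Poly N) where
  homogeneous := isHomogeneous_gaussPoly c
  bound r := by
    refine ⟨fun b => ‖gaussCoeff ((‖c‖ * r ^ 2 : ℝ) : ℂ) b‖,
      (hasSum_gaussCoeff _).summable.norm, fun b z hz => ?_⟩
    rw [eval_gaussPoly]
    refine norm_gaussCoeff_le ?_ b
    rw [norm_mul]
    refine mul_le_mul_of_nonneg_left ?_ (norm_nonneg c)
    have := norm_sum_mul_le z z
    simp only [← sq] at this
    exact this.trans (pow_le_pow_left₀ (norm_nonneg z) hz 2)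

theorem seriesFun_gaussPoly (c : ℝ) :
    seriesFun (gaussPoly (c : ℂ)) = fun x : E N => (Real.exp (c * ‖x‖ ^ 2) : ℂ) := by
  ext x
  have : (∑ i, toC x i ^ 2 : ℂ) = ((‖x‖ ^ 2 : ℝ) : ℂ) := by
    rw [EuclideanSpace.norm_sq_eq]
    simp [toC]
  simp only [seriesFun, polyFun, eval_gaussPoly, this]
  rw [(hasSum_gaussCoeff _).tsum_eq]
  push_cast
  rfl

end

end

section

open MvPolynomial

/-! ### Appell polynomials -/

section

variable {P : Finset (E N)} {k : E N → ℝ} {t : ℝ}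

/-- The homogeneous polynomial `w ↦ Φ(A_n(·, w))` where `A_n(·, w)` is the component of degree `n`
in `w` of `e^{-t |w|²} K(·, w)`. -/
def appellTheta (P : Finset (E N)) (k : E N → ℝ) (t : ℝ) (n : ℕ) (Φ : Poly N →ₗ[ℂ] ℂ) : Poly N :=
  ∑ ab ∈ Finset.HasAntidiagonal.antidiagonal n, gaussPoly (-t : ℂ) ab.2 *
    ∑ κ ∈ Finset.piAntidiag Finset.univ ab.1, C ((fact κ : ℂ)⁻¹ * Φ (V P k (monoX κ))) * monoX κ

theorem eval_monoX (w : Fin N → ℂ) (κ : Fin N → ℕ) :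
    MvPolynomial.eval w (monoX κ) = ∏ i, w i ^ κ i := by
  simp [monoX]

theorem eval_appellTheta (n : ℕ) (Φ : Poly N →ₗ[ℂ] ℂ) (w : Fin N → ℂ) :
    MvPolynomial.eval w (appellTheta P k t n Φ) = Φ (appellGen P k t w n) := by
  simp only [appellTheta, appellGen, map_sum, map_mul, map_C_mul_poly, kerComp_eq_sum,
    eval_gaussPoly, neg_mul, eval_C, eval_monoX]
  refine Finset.sum_congr rfl fun ab _ => congrArg (_ * ·) (Finset.sum_congr rfl fun κ _ => ?_)
  rw [← C_mul, map_C_mul_poly]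
  ring

theorem isHomogeneous_appellTheta (n : ℕ) (Φ : Poly N →ₗ[ℂ] ℂ) :
    (appellTheta P k t n Φ).IsHomogeneous n := by
  refine IsHomogeneous.sum _ _ _ fun ab hab => ?_
  rw [← Finset.HasAntidiagonal.mem_antidiagonal.1 hab, add_comm]
  refine (isHomogeneous_gaussPoly _ _).mul (IsHomogeneous.sum _ _ _ fun κ hκ => ?_)
  rw [← mem_piAntidiag_univ.1 hκ]
  exact (isHomogeneous_monoX κ).C_mul _

/-- The coefficient of `w^κ` in `e^{-t |w|²} K(·, w)`. -/
def appellPoly (P : Finset (E N)) (k : E N → ℝ) (t : ℝ) (κ : Fin N → ℕ) : Poly N :=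
  ∑ ab ∈ Finset.HasAntidiagonal.antidiagonal (deg κ), ∑ κ' ∈ Finset.piAntidiag Finset.univ ab.1,
    C ((fact κ' : ℂ)⁻¹ * coeff (toFinsupp κ) (gaussPoly (-t : ℂ) ab.2 * monoX κ')) *
      V P k (monoX κ')

/-- Keeping the functional Φ arbitrary allows coefficients of w^κ to be read off without polynomials
in two sets of variables. -/
theorem coeff_appellTheta (κ : Fin N → ℕ) (Φ : Poly N →ₗ[ℂ] ℂ) :
    coeff (toFinsupp κ) (appellTheta P k t (deg κ) Φ) = Φ (appellPoly P k t κ) := by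
  simp only [appellTheta, appellPoly, map_sum, map_C_mul_poly, coeff_sum, Finset.mul_sum,
    mul_left_comm _ (C _), coeff_C_mul]
  refine Finset.sum_congr rfl fun ab _ => Finset.sum_congr rfl fun κ' _ => ?_
  ring

theorem appellTheta_eq_sum (n : ℕ) (Φ : Poly N →ₗ[ℂ] ℂ) :
    appellTheta P k t n Φ = ∑ κ ∈ Finset.piAntidiag Finset.univ n,
      C (Φ (appellPoly P k t κ)) * monoX κ := by
  refine (homogeneous_eq_sum (isHomogeneous_appellTheta n Φ)).trans
    (Finset.sum_congr rfl fun κ hκ => ?_)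
  rw [← mem_piAntidiag_univ.1 hκ, coeff_appellTheta]

theorem totalDegree_appellPoly_le (hP : IsPositiveSystem P k) (κ : Fin N → ℕ) :
    (appellPoly P k t κ).totalDegree ≤ deg κ := by
  refine totalDegree_finsetSum_le fun ab hab => totalDegree_finsetSum_le fun κ' hκ' => ?_
  have h := ((isHomogeneous_V hP (isHomogeneous_monoX κ')).C_mul
    ((fact κ' : ℂ)⁻¹ * coeff (toFinsupp κ) (gaussPoly (-t : ℂ) ab.2 * monoX κ'))).totalDegree_le
  rw [mem_piAntidiag_univ.1 hκ'] at h
  exact h.trans (Finset.HasAntidiagonal.mem_antidiagonal.1 hab ▸ Nat.le_add_right _ _)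

/-- Every Gaussian term of positive degree in w lowers the degree in y, so only the constant term 1
reaches the top degree. -/
theorem homogeneousComponent_appellPoly (hP : IsPositiveSystem P k) (κ : Fin N → ℕ) :
    homogeneousComponent (deg κ) (appellPoly P k t κ) =
      C (fact κ : ℂ)⁻¹ * V P k (monoX κ) := by
  have hhom : ∀ κ' (c : ℂ), homogeneousComponent (deg κ) (C c * V P k (monoX κ')) =
      if deg κ = deg κ' then C c * V P k (monoX κ') else 0 := fun κ' c =>
    homogeneousComponent_of_mem ((isHomogeneous_V hP (isHomogeneous_monoX κ')).C_mul c)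
  rw [appellPoly, map_sum, Finset.sum_eq_single (deg κ, 0)]
  · rw [map_sum, Finset.sum_eq_single κ]
    · rw [hhom, if_pos rfl]
      simp [gaussPoly, coeff_monoX]
    · intro κ' _ hκ'
      simp [gaussPoly, coeff_monoX, hκ']
    · intro h
      exact absurd (mem_piAntidiag_univ.2 rfl) h
  · intro ab hab hne
    rw [map_sum]
    refine Finset.sum_eq_zero fun κ' hκ' => ?_
    rw [hhom, if_neg]
    intro h
    have h1 := Finset.HasAntidiagonal.mem_antidiagonal.1 hab
    rw [h, mem_piAntidiag_univ.1 hκ'] at h1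
    refine hne (Prod.ext ?_ ?_)
    · rw [h, mem_piAntidiag_univ.1 hκ']
    · simpa using h1
  · intro h
    exact absurd (Finset.HasAntidiagonal.mem_antidiagonal.2 (add_zero _)) h

/-- The reproducing property of the Appell polynomials. -/
theorem IsGaussianFunctional.appellTheta_mulLeft (hP : IsPositiveSystem P k)
    {L : Poly N →ₗ[ℂ] ℂ} (hL : IsGaussianFunctional P k t L) {m n : ℕ} (hmn : m ≤ n) {p : Poly N}
    (hp : p.IsHomogeneous m) :
    appellTheta P k t n (L ∘ₗ LinearMap.mulLeft ℂ p) =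
      if m = n then C ((2 * t : ℂ) ^ n) * p else 0 := by
  refine MvPolynomial.funext fun w => ?_
  rw [eval_appellTheta, LinearMap.comp_apply, LinearMap.mulLeft_apply,
    hL.map_mul_appellGen hP w m hp hmn]
  split_ifs <;> simp

/-- The Dunkl-dual Appell polynomial attached to a linear functional `Λ` on polynomials. -/
def appellDual (P : Finset (E N)) (k : E N → ℝ) (t : ℝ) (n : ℕ) (Λ : Poly N →ₗ[ℂ] ℂ) : Poly N :=
  ∑ κ ∈ Finset.piAntidiag Finset.univ n,
    C (((2 * t : ℂ)⁻¹) ^ n * Λ (monoX κ)) * appellPoly P k t κ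

/-- In the kernel A_n(y, w), Φ acts on y and Λ on w, so they can be applied in either order. -/
theorem map_appellDual (n : ℕ) (Λ Φ : Poly N →ₗ[ℂ] ℂ) :
    Φ (appellDual P k t n Λ) = ((2 * t : ℂ)⁻¹) ^ n * Λ (appellTheta P k t n Φ) := by
  rw [appellDual, appellTheta_eq_sum, map_sum, map_sum, Finset.mul_sum]
  refine Finset.sum_congr rfl fun κ _ => ?_
  rw [map_C_mul_poly, map_C_mul_poly]
  ring

theorem totalDegree_appellDual_le (hP : IsPositiveSystem P k) (n : ℕ) (Λ : Poly N →ₗ[ℂ] ℂ) :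
    (appellDual P k t n Λ).totalDegree ≤ n := by
  refine totalDegree_finsetSum_le fun κ hκ => ?_
  refine (totalDegree_mul _ _).trans ?_
  rw [totalDegree_C, zero_add, ← mem_piAntidiag_univ.1 hκ]
  exact totalDegree_appellPoly_le hP κ

/-- By the reproducing property only the component of p of degree n survives, with a factor (2t)^n
that the normalization of `appellDual` cancels. -/
theorem IsGaussianFunctional.map_mul_appellDual (hP : IsPositiveSystem P k) (ht : t ≠ 0)
    {L : Poly N →ₗ[ℂ] ℂ} (hL : IsGaussianFunctional P k t L) (n : ℕ) (Λ : Poly N →ₗ[ℂ] ℂ)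
    {p : Poly N} (hp : p.totalDegree ≤ n) :
    L (p * appellDual P k t n Λ) = Λ (homogeneousComponent n p) := by
  have h : ∀ m ≤ n, L (homogeneousComponent m p * appellDual P k t n Λ) =
      if m = n then Λ (homogeneousComponent n p) else 0 := by
    intro m hm
    have h1 := map_appellDual (P := P) (k := k) (t := t) n Λ
      (L ∘ₗ LinearMap.mulLeft ℂ (homogeneousComponent m p))
    rw [LinearMap.comp_apply, LinearMap.mulLeft_apply,
      hL.appellTheta_mulLeft hP hm (homogeneousComponent_isHomogeneous m p)] at h1
    rw [h1]
    split_ifs with hmn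
    · have h2 : (2 * t : ℂ) ≠ 0 := by simpa using ht
      rw [hmn, map_C_mul_poly, ← mul_assoc, ← mul_pow, inv_mul_cancel₀ h2, one_pow, one_mul]
    · simp
  conv_lhs => rw [← sum_homogeneousComponent p]
  rw [Finset.sum_mul, map_sum, Finset.sum_congr rfl fun m hm =>
    h m ((Nat.lt_succ_iff.1 (Finset.mem_range.1 hm)).trans hp), Finset.sum_ite_eq']
  split_ifs with hn
  · rfl
  · rw [homogeneousComponent_eq_zero _ _ (by simpa using hn), map_zero]

theorem IsGaussianFunctional.map_mul_appellPoly (hP : IsPositiveSystem P k)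
    {L : Poly N →ₗ[ℂ] ℂ} (hL : IsGaussianFunctional P k t L) {κ : Fin N → ℕ}
    {p : Poly N} (hp : p.totalDegree < deg κ) :
    L (p * appellPoly P k t κ) = 0 := by
  conv_lhs => rw [← sum_homogeneousComponent p]
  rw [Finset.sum_mul, map_sum]
  refine Finset.sum_eq_zero fun m hm => ?_
  have hm' : m < deg κ := (Nat.lt_succ_iff.1 (Finset.mem_range.1 hm)).trans_lt hp
  have h1 := coeff_appellTheta (P := P) (k := k) (t := t) κ
    (L ∘ₗ LinearMap.mulLeft ℂ (homogeneousComponent m p))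
  rw [hL.appellTheta_mulLeft hP hm'.le (homogeneousComponent_isHomogeneous m p),
    if_neg hm'.ne, coeff_zero] at h1
  exact h1.symm

/-- Evaluation at a point as a linear functional. -/
def evalLin (z : Fin N → ℂ) : Poly N →ₗ[ℂ] ℂ := (aeval z).toLinearMap

theorem evalLin_apply (z : Fin N → ℂ) (p : Poly N) : evalLin z p = MvPolynomial.eval z p := rfl

/-! ### Appell characters and cocharacters as polynomials -/

theorem IsEntireSeries.C_pow_mul {Q : ℕ → Poly N} (hQ : IsEntireSeries Q) (c : ℂ) :
    IsEntireSeries fun n => C (c ^ n) * Q n where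
  homogeneous n := (hQ.homogeneous n).C_mul _
  bound r := by
    obtain ⟨B, hB, h⟩ := hQ.bound (‖c‖ * r)
    refine ⟨B, hB, fun n z hz => ?_⟩
    rw [map_mul, eval_C, ← eval_smul_of_isHomogeneous (hQ.homogeneous n)]
    refine h n (c • z) ?_
    rw [norm_smul]
    exact mul_le_mul_of_nonneg_left hz (norm_nonneg c)

theorem eval_kerComp_comm (hP : IsPositiveSystem P k) (z w : Fin N → ℂ) (n : ℕ) :
    MvPolynomial.eval z (kerComp P k w n) = MvPolynomial.eval w (kerComp P k z n) :=
  eval_kerComp_symm hP (WithLp.toLp 2 z) (WithLp.toLp 2 w) n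

theorem K_smul_right (hP : IsPositiveSystem P k) (x y : E N) (c : ℂ) :
    K P k (toC x) (fun i => c * toC y i) =
      seriesFun (fun n => C (c ^ n) * kerComp P k (toC x) n) y := by
  rw [K_eq_seriesFun, seriesFun, seriesFun]
  refine tsum_congr fun n => ?_
  rw [polyFun, polyFun, eval_kerComp_comm hP,
    eval_smul_of_isHomogeneous (isHomogeneous_kerComp hP _ n), map_mul, eval_C]

theorem K_smul_comm (hP : IsPositiveSystem P k) (x y : E N) (c : ℂ) :
    K P k (toC x) (fun i => c * toC y i) = K P k (toC y) (fun i => c * toC x i) := by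
  rw [K_smul_right hP, K_smul_right hP, seriesFun, seriesFun]
  refine tsum_congr fun n => ?_
  rw [polyFun, polyFun, map_mul, map_mul, eval_kerComp_comm hP]
  simp

theorem sum_kerComp_mul_gaussPoly (hP : IsPositiveSystem P k) (c : ℂ) (z : Fin N → ℂ) (n : ℕ) :
    ∑ ab ∈ Finset.HasAntidiagonal.antidiagonal n,
      C (c ^ ab.1) * kerComp P k z ab.1 * gaussPoly (c ^ 2 * (-t)) ab.2 =
    C (c ^ n) * appellTheta P k t n (evalLin z) := by
  refine MvPolynomial.funext fun w => ?_
  rw [map_mul, eval_appellTheta, appellGen, map_sum, map_sum, Finset.mul_sum]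
  refine Finset.sum_congr rfl fun ab hab => ?_
  rw [← Finset.HasAntidiagonal.mem_antidiagonal.1 hab, map_C_mul_poly, evalLin_apply]
  simp only [map_mul, eval_C, eval_gaussPoly]
  rw [eval_kerComp_comm hP w z, mul_assoc (c ^ 2), gaussCoeff_sq_mul, pow_add, neg_mul]
  ring

/-- The generating function of the Appell characters as a series of polynomials. -/
theorem K_mul_exp_eq_seriesFun (hP : IsPositiveSystem P k) (c : ℂ) (s : ℝ)
    (hs : (s : ℂ) = c ^ 2 * (-t)) (x : E N) :
    IsEntireSeries (fun n => C (c ^ n) * appellTheta P k t n (evalLin (toC x))) ∧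
    (fun y : E N => K P k (toC x) (fun i => c * toC y i) * (Real.exp (s * ‖y‖ ^ 2) : ℂ)) =
      seriesFun (fun n => C (c ^ n) * appellTheta P k t n (evalLin (toC x))) := by
  have h1 := (isEntireSeries_kerComp hP (toC x)).C_pow_mul c
  have h2 := isEntireSeries_gaussPoly (N := N) (s : ℂ)
  have h3 := h1.mul h2
  have h4 := seriesFun_mul h1 h2
  simp only [hs, sum_kerComp_mul_gaussPoly hP] at h3 h4
  refine ⟨h3, ?_⟩
  rw [h4, ← hs, seriesFun_gaussPoly]
  simp only [K_smul_right hP]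

/-- The generating function is taken at w = -iy, where e^{-t⟨w,w⟩} = e^{t|y|²}; the factors
(-i)^{|ν|} and i^{|ν|} cancel. -/
theorem appellR_eq_polyFun (hP : IsPositiveSystem P k) (ν : Fin N → ℕ) :
    appellR P k ν t = polyFun (C (fact ν : ℂ) * appellPoly P k t ν) := by
  ext x
  obtain ⟨h1, h2⟩ := K_mul_exp_eq_seriesFun (t := t) hP (-Complex.I) t (by simp) x
  rw [appellR, h2, opPow_pderiv_seriesFun_zero h1, coeff_C_mul, coeff_appellTheta, polyFun,
    map_mul, eval_C, evalLin_apply]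
  have h3 : Complex.I ^ deg ν * (-Complex.I) ^ deg ν = 1 := by
    rw [← mul_pow]; simp
  linear_combination (fact ν * MvPolynomial.eval (toC x) (appellPoly P k t ν)) * h3

/-- The generating function is taken at w = x/2t, where -t⟨w,w⟩ = -|x|²/4t. Symmetry of K makes x
the expansion variable, and T_x^ρ at 0 sees only degree |ρ|. -/
theorem exists_appellS_eq_polyFun (hP : IsPositiveSystem P k) (ht : t ≠ 0) (ρ : Fin N → ℕ) :
    ∃ Λ : Poly N →ₗ[ℂ] ℂ,
      (∀ p, Λ p = MvPolynomial.eval 0 (opPow (fun i => TPoly P k i) ρ p)) ∧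
      appellS P k ρ t = polyFun (appellDual P k t (deg ρ) Λ) := by
  obtain ⟨Λ, hΛ⟩ := exists_linearMap_opPow (TPoly P k) ρ
  refine ⟨evalLin 0 ∘ₗ Λ, fun p => by rw [hΛ]; rfl, ?_⟩
  ext y
  have ht' : (t : ℂ) ≠ 0 := by exact_mod_cast ht
  obtain ⟨h1, h2⟩ := K_mul_exp_eq_seriesFun (t := t) hP (2 * t : ℂ)⁻¹ (-(4 * t)⁻¹) (by
    push_cast; field_simp; norm_num) y
  have h3 : (fun x : E N => (Real.exp (-‖x‖ ^ 2 / (4 * t)) : ℂ) *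
      K P k (toC x) (toC ((2 * t)⁻¹ • y))) = fun x : E N =>
      K P k (toC y) (fun i => (2 * t : ℂ)⁻¹ * toC x i) *
        (Real.exp (-(4 * t)⁻¹ * ‖x‖ ^ 2) : ℂ) := by
    ext x
    rw [mul_comm, ← K_smul_comm hP]
    congr 2
    · ext i
      simp [toC]
    · congr 1
      ring
  rw [appellS, h3, h2, opPow_T_seriesFun_zero hP.dot_self k h1, hΛ, polyFun]
  have h4 := map_appellDual (P := P) (k := k) (t := t) (deg ρ) (evalLin 0 ∘ₗ Λ) (evalLin (toC y))
  rw [evalLin_apply] at h4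
  refine Eq.trans ?_ h4.symm
  rw [← smul_eq_C_mul, map_smul, smul_eval]
  rfl

/-- The Dunkl pairing of `V x^ν` with `x^ρ`. -/
theorem eval_zero_opPow_TPoly_V (hP : IsPositiveSystem P k) {ν ρ : Fin N → ℕ} :
    MvPolynomial.eval 0 (opPow (fun i => TPoly P k i) ρ (V P k (monoX ν))) =
      if ν = ρ then (fact ν : ℂ) else 0 := by
  have h := opPow_rel (A := fun i => ⇑(TPoly P k i))
    (B := fun i (p : Poly N) => MvPolynomial.pderiv i p) (fun f g => f = V P k g)
    (fun i f g hfg => by rw [hfg, TPoly_V hP]) ρ (f := V P k (monoX ν)) (g := monoX ν) rfl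
  have hV : ∀ q, MvPolynomial.eval 0 (V P k q) = MvPolynomial.eval 0 q := by
    intro q
    conv_lhs => rw [← sum_homogeneousComponent q]
    conv_rhs => rw [← sum_homogeneousComponent q]
    rw [map_sum, map_sum, map_sum]
    refine Finset.sum_congr rfl fun n _ => ?_
    have hq := homogeneousComponent_isHomogeneous n q
    rcases eq_or_ne n 0 with rfl | hn
    · rw [homogeneousComponent_zero, V_C hP]
    · rw [eval_zero_of_isHomogeneous hn hq, eval_zero_of_isHomogeneous hn (isHomogeneous_V hP hq)]
  rw [h, hV, eval_zero_opPow_pderiv, coeff_monoX]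
  split_ifs with e
  · rw [e, mul_one]
  · rw [mul_zero]

end

end

end Dunkl

end

/-! ### Biorthogonality of the Appell systems. -/

theorem theorem4p5 {N : ℕ} (R : Finset (Dunkl.E N)) (hR : Dunkl.IsNormalizedRootSystem R)
    (β : Dunkl.E N) (hβ : ∀ α ∈ R, inner ℝ α β ≠ 0)
    (k : Dunkl.E N → ℝ) (hk_nonneg : ∀ α ∈ R, 0 ≤ k α)
    (hk_inv : ∀ g ∈ Dunkl.reflectionGroup R, ∀ α ∈ R, k (g α) = k α)
    (t : ℝ) (ht : 0 < t) :
    (∀ ν ρ : Fin N → ℕ,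
      Integrable (fun y => Dunkl.appellR (Dunkl.positiveRoots R β) k ν t y *
          Dunkl.appellS (Dunkl.positiveRoots R β) k ρ t y)
        (Dunkl.gaussian (Dunkl.positiveRoots R β) k t 0) ∧
      ∫ y, Dunkl.appellR (Dunkl.positiveRoots R β) k ν t y *
          Dunkl.appellS (Dunkl.positiveRoots R β) k ρ t y
        ∂(Dunkl.gaussian (Dunkl.positiveRoots R β) k t 0) =
          if ν = ρ then (Dunkl.fact ν : ℂ) else 0) ∧
    (∀ (ν : Fin N → ℕ) (p : Dunkl.Poly N), p.totalDegree < Dunkl.deg ν →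
      (Integrable (fun y => Dunkl.polyFun p y *
          Dunkl.appellS (Dunkl.positiveRoots R β) k ν t y)
        (Dunkl.gaussian (Dunkl.positiveRoots R β) k t 0) ∧
      ∫ y, Dunkl.polyFun p y * Dunkl.appellS (Dunkl.positiveRoots R β) k ν t y
        ∂(Dunkl.gaussian (Dunkl.positiveRoots R β) k t 0) = 0) ∧
      (Integrable (fun y => Dunkl.polyFun p y *
          Dunkl.appellR (Dunkl.positiveRoots R β) k ν t y)
        (Dunkl.gaussian (Dunkl.positiveRoots R β) k t 0) ∧
      ∫ y, Dunkl.polyFun p y * Dunkl.appellR (Dunkl.positiveRoots R β) k ν t y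
        ∂(Dunkl.gaussian (Dunkl.positiveRoots R β) k t 0) = 0)) := by
  have hP := Dunkl.isPositiveSystem_positiveRoots hR hβ hk_nonneg hk_inv
  have hβ' : ∀ α ∈ Dunkl.positiveRoots R β, inner ℝ α β ≠ 0 := fun α hα =>
    hβ α (Finset.mem_filter.1 hα).1
  have hL := Dunkl.isGaussianFunctional_gaussLin hP hβ' ht
  set P := Dunkl.positiveRoots R β
  have hint := fun p q : Dunkl.Poly N => Dunkl.integrable_polyFun_gaussian hP ht (p * q)
  have hval : ∀ p q : Dunkl.Poly N,
      ∫ y, Dunkl.polyFun p y * Dunkl.polyFun q y ∂(Dunkl.gaussian P k t 0) =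
        Dunkl.gaussLin hP ht (p * q) := fun p q => by
    simp only [Dunkl.polyFun, ← map_mul]
    rfl
  have hmul : ∀ p q : Dunkl.Poly N, Dunkl.polyFun (p * q) =
      fun y => Dunkl.polyFun p y * Dunkl.polyFun q y := fun p q => by
    ext y
    simp [Dunkl.polyFun]
  simp only [hmul] at hint
  have hR0 : ∀ (ν : Fin N → ℕ) (p : Dunkl.Poly N), p.totalDegree < Dunkl.deg ν →
      Dunkl.gaussLin hP ht
        (p * (MvPolynomial.C (Dunkl.fact ν : ℂ) * Dunkl.appellPoly P k t ν)) = 0 := by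
    intro ν p hp
    rw [mul_left_comm, Dunkl.map_C_mul_poly, hL.map_mul_appellPoly hP hp, mul_zero]
  have hS := Dunkl.exists_appellS_eq_polyFun hP ht.ne'
  refine ⟨fun ν ρ => ?_, fun ν p hp => ⟨?_, ?_⟩⟩
  · obtain ⟨Λ, hΛ, hSρ⟩ := hS ρ
    rw [Dunkl.appellR_eq_polyFun hP, hSρ]
    refine ⟨hint _ _, ?_⟩
    rw [hval]
    -- If |ν| ≤ |ρ|, the pairing is T^ρ at 0 of the component of R_ν of degree |ρ|, which is V x^ν
    -- or zero. If |ν| > |ρ|, the factor S_ρ has degree below |ν| and R_ν is orthogonal to it.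
    rcases le_or_gt (Dunkl.deg ν) (Dunkl.deg ρ) with h | h
    · have hdeg := Dunkl.totalDegree_appellPoly_le (t := t) hP ν
      rw [mul_assoc, Dunkl.map_C_mul_poly,
        hL.map_mul_appellDual hP ht.ne' _ Λ (hdeg.trans h)]
      rcases h.eq_or_lt with h | h
      · have hf : (Dunkl.fact ν : ℂ) ≠ 0 := by
          exact_mod_cast Finset.prod_ne_zero_iff.2 fun i _ => (ν i).factorial_ne_zero
        rw [← h, Dunkl.homogeneousComponent_appellPoly hP, Dunkl.map_C_mul_poly,
          mul_inv_cancel_left₀ hf, hΛ, Dunkl.eval_zero_opPow_TPoly_V hP]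
      · rw [MvPolynomial.homogeneousComponent_eq_zero _ _ (hdeg.trans_lt h), map_zero, mul_zero,
          if_neg fun e => h.ne (congrArg Dunkl.deg e)]
    · rw [mul_comm, hR0 ν _ ((Dunkl.totalDegree_appellDual_le hP _ Λ).trans_lt h),
        if_neg fun e => h.ne' (congrArg Dunkl.deg e)]
  · obtain ⟨Λ, -, hSν⟩ := hS ν
    rw [hSν]
    refine ⟨hint _ _, ?_⟩
    rw [hval, hL.map_mul_appellDual hP ht.ne' _ Λ hp.le,
      MvPolynomial.homogeneousComponent_eq_zero _ _ hp, map_zero]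
  · rw [Dunkl.appellR_eq_polyFun hP]
    exact ⟨hint _ _, by rw [hval, hR0 ν p hp]⟩
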